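/- Let $(C,o)$ be a reduced complex-analytic curve germ with local ring $(\mathcal O,\mathfrak m)$, i.e. $\mathcal O$ is a reduced one-dimensional $\mathbb C$-algebra isomorphic to a quotient of some convergent power series ring $\mathbb C\{x_1,\dots,x_N\}$. Let $\overline{\mathcal O}$ be the integral closure of $\mathcal O$ in its total ring of fractions; writing $r$ for the number of branches of $(C,o)$, we have $\overline{\mathcal O}\cong\prod_{i=1}^r\mathbb C\{t_i\}$. Write $\mathfrak v_i$ for the order of vanishing in $t_i$. For $\ell\in\mathbb N^r$ set $$\overline{\mathcal F}(\ell)=\{f\in\overline{\mathcal O}\mid \mathfrak v_i(f)\ge\ell_i\text{ for all }i\},\qquad \mathcal F(\ell)=\overline{\mathcal F}(\ell)\cap\mathcal O,$$ $$w_0^C(\ell)=\dim_{\mathbb C}\mathcal O/\mathcal F(\ell)-\dim_{\mathbb C}\overline{\mathcal O}/(\overline{\mathcal F}(\ell)+\mathcal O)\in\mathbb Z.$$ The multiplicity of $(C,o)$ is the leading coefficient $e$ of its Hilbert--Samuel polynomial: $\dim_{\mathbb C}\mathcal O/\mathfrak m^n=en+c$ for all large $n$, with $c\in\mathbb Z$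 constant. For $n\ge 0$, a germ is of type $A_n$ if its local ring is isomorphic, as a $\mathbb C$-algebra, to $\mathbb C\{x,y\}/(x^{n+1}+y^2)$ (so $A_0$ is the smooth germ). A reduced curve germ with local ring $\mathcal O'$ birationally dominates a reduced curve germ with local ring $\mathcal O''$ if the inclusion $\mathcal O''\hookrightarrow\overline{\mathcal O''}$ factors as $\mathcal O''\hookrightarrow\mathcal O'\hookrightarrow\overline{\mathcal O''}$ with injective $\mathbb C$-algebra homomorphisms. Then the following are equivalent: (1) $(C,o)$ has multiplicity at most $2$; (2) $\min_{\ell\in\mathbb N^r}w_0^C(\ell)=0$; (3) $(C,o)$ birationally dominates a germ of type $A_n$ for some $n\ge0$; (4) $(C,o)$ is a germ of type $A_n$ for some $n\ge 0$. -/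

import Mathlib

namespace CurveGerm

noncomputable section

/-- A formal power series over `ℂ` in `N` variables is convergent if it converges absolutely on
some polydisc of positive radius around the origin. -/
def IsConvergent {N : ℕ} (f : MvPowerSeries (Fin N) ℂ) : Prop :=
  ∃ r : ℝ, 0 < r ∧ Summable fun d : Fin N →₀ ℕ => ‖MvPowerSeries.coeff d f‖ * r ^ d.degree

theorem IsConvergent.mono {N : ℕ} {f : MvPowerSeries (Fin N) ℂ} {r s : ℝ} (hs : 0 < s)
    (hsr : s ≤ r)
    (h : Summable fun d : Fin N →₀ ℕ => ‖MvPowerSeries.coeff d f‖ * r ^ d.degree) :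
    Summable fun d : Fin N →₀ ℕ => ‖MvPowerSeries.coeff d f‖ * s ^ d.degree := by
  refine Summable.of_nonneg_of_le (fun d => by positivity) (fun d => ?_) h
  gcongr

theorem isConvergent_C {N : ℕ} (a : ℂ) :
    IsConvergent (MvPowerSeries.C (σ := Fin N) a) := by
  classical
  refine ⟨1, one_pos, summable_of_ne_finset_zero (s := {0}) fun d hd => ?_⟩
  rw [Finset.mem_singleton] at hd
  simp [MvPowerSeries.coeff_C, hd]

theorem isConvergent_X {N : ℕ} (i : Fin N) :
    IsConvergent (MvPowerSeries.X i : MvPowerSeries (Fin N) ℂ) := by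
  classical
  refine ⟨1, one_pos, summable_of_ne_finset_zero (s := {Finsupp.single i 1}) fun d hd => ?_⟩
  rw [Finset.mem_singleton] at hd
  simp [MvPowerSeries.coeff_X, hd]

theorem IsConvergent.add {N : ℕ} {f g : MvPowerSeries (Fin N) ℂ}
    (hf : IsConvergent f) (hg : IsConvergent g) : IsConvergent (f + g) := by
  obtain ⟨r, hr, hf⟩ := hf
  obtain ⟨s, hs, hg⟩ := hg
  have ht : 0 < min r s := lt_min hr hs
  refine ⟨min r s, ht, Summable.of_nonneg_of_le (fun d => by positivity) (fun d => ?_)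
    ((IsConvergent.mono ht (min_le_left r s) hf).add
      (IsConvergent.mono ht (min_le_right r s) hg))⟩
  rw [← add_mul, map_add]
  gcongr
  exact norm_add_le _ _

theorem IsConvergent.mul {N : ℕ} {f g : MvPowerSeries (Fin N) ℂ}
    (hf : IsConvergent f) (hg : IsConvergent g) : IsConvergent (f * g) := by
  classical
  obtain ⟨r, hr, hf⟩ := hf
  obtain ⟨s, hs, hg⟩ := hg
  have ht : 0 < min r s := lt_min hr hs
  have key := summable_sum_mul_antidiagonal_of_summable_mul
    (Summable.mul_of_nonneg (IsConvergent.mono ht (min_le_left r s) hf)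
      (IsConvergent.mono ht (min_le_right r s) hg)
      (fun d => by positivity) (fun d => by positivity))
  refine ⟨min r s, ht, Summable.of_nonneg_of_le (fun d => by positivity) (fun d => ?_) key⟩
  rw [MvPowerSeries.coeff_mul]
  calc _ ≤ (∑ p ∈ Finset.HasAntidiagonal.antidiagonal d,
          ‖MvPowerSeries.coeff p.1 f * MvPowerSeries.coeff p.2 g‖) * min r s ^ d.degree := by
        gcongr
        exact norm_sum_le _ _
    _ = _ := by
        rw [Finset.sum_mul]
        refine Finset.sum_congr rfl fun p hp => ?_
        rw [← Finset.HasAntidiagonal.mem_antidiagonal.mp hp, map_add, pow_add, norm_mul]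
        ring

/-- The ring `ℂ{x₁, …, x_N}` of convergent power series. -/
def ConvergentSeries (N : ℕ) : Subalgebra ℂ (MvPowerSeries (Fin N) ℂ) where
  carrier := {f | IsConvergent f}
  mul_mem' := IsConvergent.mul
  add_mem' := IsConvergent.add
  algebraMap_mem' := isConvergent_C

/-- The coordinate `x_i` in `ℂ{x₁, …, x_N}`. -/
def coord {N : ℕ} (i : Fin N) : ConvergentSeries N := ⟨MvPowerSeries.X i, isConvergent_X i⟩

/-- `O` is (isomorphic to) the local ring of a reduced complex-analytic curve germ. A reduced local
ring of dimension one is automatically equidimensional. -/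
structure IsReducedCurveGerm (O : Type*) [CommRing O] [Algebra ℂ O] : Prop where
  analytic : ∃ (N : ℕ) (I : Ideal (ConvergentSeries N)),
    Nonempty (O ≃ₐ[ℂ] (ConvergentSeries N ⧸ I))
  reduced : IsReduced O
  dim_one : ringKrullDim O = 1

/-- The integral closure of `O` in its total ring of fractions. -/
abbrev Normalization (O : Type*) [CommRing O] : Type _ :=
  integralClosure O (FractionRing O)

/-- The local ring of dimension one `O` has multiplicity `e`: its Hilbert--Samuel function
`n ↦ dim_ℂ O / 𝔪 ^ n` agrees for large `n` with a polynomial `e * n + c`. -/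
def HasMultiplicity (O : Type*) [CommRing O] [IsLocalRing O] [Algebra ℂ O] (e : ℕ) : Prop :=
  ∃ c : ℤ, ∀ᶠ n : ℕ in Filter.atTop,
    (Module.finrank ℂ (O ⧸ IsLocalRing.maximalIdeal O ^ n) : ℤ) = e * n + c

/-- The lattice `ℕ ^ r`. The branches of the germ are indexed by the points of the normalization
over `o`, that is, by the (finitely many) maximal ideals of `Normalization O`. -/
abbrev Lattice (O : Type*) [CommRing O] : Type _ :=
  MaximalSpectrum (Normalization O) →₀ ℕ

/-- The lattice filtration on the normalization. As the normalization is a product of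
discrete valuation rings, one for each maximal ideal `M`, the elements of `M ^ k` are those whose
order of vanishing on the branch of `M` is at least `k`. -/
def normFiltration (O : Type*) [CommRing O] (l : Lattice O) : Ideal (Normalization O) :=
  ⨅ M : MaximalSpectrum (Normalization O), M.asIdeal ^ l M

/-- The lattice filtration on `O`. -/
def filtration (O : Type*) [CommRing O] (l : Lattice O) : Ideal O :=
  (normFiltration O l).comap (algebraMap O (Normalization O))

/-- The Hilbert function `ℓ ↦ dim_ℂ O / F(ℓ)`. -/
def hilbert (O : Type*) [CommRing O] [Algebra ℂ O] (l : Lattice O) : ℕ :=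
  Module.finrank ℂ (O ⧸ filtration O l)

/-- The Hilbert function `ℓ ↦ dim_ℂ Ō / (F̄(ℓ) + O)`, with `Ō` the normalization of `O`. -/
def normHilbert (O : Type*) [CommRing O] [Algebra ℂ O] (l : Lattice O) : ℕ :=
  Module.finrank ℂ (Normalization O ⧸
    ((normFiltration O l).restrictScalars ℂ ⊔
      LinearMap.range (IsScalarTower.toAlgHom ℂ O (Normalization O)).toLinearMap))

/-- The weight function. -/
def weight (O : Type*) [CommRing O] [Algebra ℂ O] (l : Lattice O) : ℤ :=
  (hilbert O l : ℤ) - (normHilbert O l : ℤ)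

/-- The germ with local ring `O'` birationally dominates the germ with local ring `O`: the
inclusion of `O` into its normalization factors through injections `O → O'` and
`O' → Normalization O` of `ℂ`-algebras. -/
def BirationallyDominates (O' O : Type*) [CommRing O'] [Algebra ℂ O'] [CommRing O] [Algebra ℂ O] :
    Prop :=
  ∃ (φ : O →ₐ[ℂ] O') (ψ : O' →ₐ[ℂ] Normalization O),
    Function.Injective φ ∧ Function.Injective ψ ∧
      ψ.comp φ = IsScalarTower.toAlgHom ℂ O (Normalization O)

/-- The local ring `ℂ{x, y} / (x ^ (n + 1) + y ^ 2)` of the normal form of type `A_n`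
(a smooth germ for `n = 0`). -/
abbrev AType (n : ℕ) : Type :=
  ConvergentSeries 2 ⧸
    (Ideal.span {coord 0 ^ (n + 1) + coord 1 ^ 2} : Ideal (ConvergentSeries 2))

/-- The germ with local ring `O` is a germ of type `A_n`. -/
def IsAType (O : Type*) [CommRing O] [Algebra ℂ O] (n : ℕ) : Prop :=
  Nonempty (O ≃ₐ[ℂ] AType n)

end

end CurveGerm

/-! Write `Ō` for the normalization, `𝔪` for the maximal ideal and `D = ℂ{t}`. All four conditions
are compared with one number, `e = dim O/xO`, for a well chosen parameter `x ∈ 𝔪`: each amounts to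
`e ≤ 2`.

The parameter is a generic element of `𝔪`, so that `xŌ = 𝔪Ō`
(`IsReducedCurveGerm.exists_isGoodParameter`). A division theorem with norm estimates
(`exists_remainder`) makes `O` a finite `D`-module through `t ↦ x`. In characteristic zero `Ō` is
then finite over `D` too, and a power of `x` carries `Ō` into `O`. Comparing codimensions inside `Ō`
gives `dim O/yO = dim Ō/yŌ` for every nonzerodivisor `y`. Hence `e` is the multiplicity, and it is
the least `dim O/yO` over nonzerodivisors `y ∈ 𝔪`.

Weight. If `F̄(ℓ) = xŌ`, then `F(ℓ) = 𝔪`, the two Hilbert terms are `1` and `e - 1`, and the weight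
is `2 - e`; a nonnegative weight forces `e ≤ 2`. Conversely, if `e ≤ 2`, Nakayama gives `Ō = D +
Dw`, and `d ↦ dw` maps `D/(F̄ ∩ D)` onto `Ō/(F̄ + D)`. Counting dimensions gives `2 dim Ō/(F̄ + O) ≤
dim Ō/F̄`, so every weight is nonnegative, while `ℓ = 0` has weight `0`.

Normal form. If `e ≤ 2`, then `O = D + Dw`. Completing the square and absorbing a unit by a
convergent square root gives `y² = -x^(n+1)` with `1, y` a `D`-basis, unless `w` already comes from
`D`; then `O` is smooth, which is `A_0`.

Domination. If `O` lies between a ring `A` of type `A_n` and its normalization, the first coordinate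
`x` of `A` satisfies `dim O/xO = dim Ā/xĀ = dim A/xA ≤ 2`, and minimality of `e` gives `e ≤ 2`. -/

namespace CurveGerm

/-! ### Weighted norms of power series and convergence. -/

noncomputable section

open MvPowerSeries
open scoped ENNReal NNReal

/-- The weighted `ℓ¹`-norm of a power series, with weight `r ^ |d|` on the monomial `d`. -/
def wnorm {σ : Type*} (r : ℝ≥0) (f : MvPowerSeries σ ℂ) : ℝ≥0∞ :=
  ∑' d : σ →₀ ℕ, ‖coeff d f‖ₑ * (r : ℝ≥0∞) ^ d.degree

section

variable {σ τ : Type*}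

theorem wnorm_mono {r s : ℝ≥0} (h : r ≤ s) (f : MvPowerSeries σ ℂ) : wnorm r f ≤ wnorm s f := by
  unfold wnorm
  gcongr

theorem wnorm_zero (r : ℝ≥0) : wnorm r (0 : MvPowerSeries σ ℂ) = 0 := by
  simp [wnorm]

theorem wnorm_add_le (r : ℝ≥0) (f g : MvPowerSeries σ ℂ) :
    wnorm r (f + g) ≤ wnorm r f + wnorm r g := by
  unfold wnorm
  rw [← ENNReal.tsum_add]
  refine ENNReal.tsum_le_tsum fun d => ?_
  rw [← add_mul, map_add]
  gcongr
  exact enorm_add_le _ _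

theorem wnorm_sum_le {ι : Type*} (r : ℝ≥0) (s : Finset ι) (f : ι → MvPowerSeries σ ℂ) :
    wnorm r (∑ i ∈ s, f i) ≤ ∑ i ∈ s, wnorm r (f i) := by
  classical
  induction s using Finset.induction_on with
  | empty => simp [wnorm_zero]
  | insert i s hi ih =>
    rw [Finset.sum_insert hi, Finset.sum_insert hi]
    exact (wnorm_add_le _ _ _).trans (by gcongr)

theorem wnorm_mul_le (r : ℝ≥0) (f g : MvPowerSeries σ ℂ) :
    wnorm r (f * g) ≤ wnorm r f * wnorm r g := by
  classical
  unfold wnorm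
  rw [← ENNReal.tsum_mul_right]
  simp_rw [← ENNReal.tsum_mul_left]
  rw [← ENNReal.tsum_prod
    (f := fun a b => ‖coeff a f‖ₑ * (r : ℝ≥0∞) ^ a.degree * (‖coeff b g‖ₑ * (r : ℝ≥0∞) ^ b.degree)),
    ← Finset.HasAntidiagonal.sigmaAntidiagonalEquivProd.tsum_eq, ENNReal.tsum_sigma']
  refine ENNReal.tsum_le_tsum fun d => ?_
  rw [coeff_mul, tsum_fintype, Finset.univ_eq_attach]
  refine le_trans ?_ (Finset.sum_attach (Finset.HasAntidiagonal.antidiagonal d)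
    (fun x => ‖coeff x.1 f‖ₑ * (r : ℝ≥0∞) ^ x.1.degree *
      (‖coeff x.2 g‖ₑ * (r : ℝ≥0∞) ^ x.2.degree))).ge
  calc _ ≤ (∑ p ∈ Finset.HasAntidiagonal.antidiagonal d, ‖coeff p.1 f * coeff p.2 g‖ₑ) *
        (r : ℝ≥0∞) ^ d.degree := by
        gcongr
        exact enorm_sum_le _ _
    _ = _ := by
        rw [Finset.sum_mul]
        refine Finset.sum_congr rfl fun p hp => ?_
        rw [← Finset.HasAntidiagonal.mem_antidiagonal.mp hp, map_add, pow_add, enorm_mul]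
        ring

theorem wnorm_one (r : ℝ≥0) : wnorm r (1 : MvPowerSeries σ ℂ) = 1 := by
  classical
  unfold wnorm
  rw [tsum_eq_single 0]
  · simp
  · intro d hd
    simp [coeff_one, hd]

theorem wnorm_pow_le (r : ℝ≥0) (f : MvPowerSeries σ ℂ) (n : ℕ) :
    wnorm r (f ^ n) ≤ wnorm r f ^ n := by
  induction n with
  | zero => simp [wnorm_one]
  | succ n ih =>
    rw [pow_succ, pow_succ]
    exact (wnorm_mul_le _ _ _).trans (by gcongr)

theorem wnorm_prod_le {ι : Type*} (r : ℝ≥0) (s : Finset ι) (f : ι → MvPowerSeries σ ℂ) :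
    wnorm r (∏ i ∈ s, f i) ≤ ∏ i ∈ s, wnorm r (f i) := by
  classical
  induction s using Finset.induction_on with
  | empty => simp [wnorm_one]
  | insert i s hi ih =>
    rw [Finset.prod_insert hi, Finset.prod_insert hi]
    exact (wnorm_mul_le _ _ _).trans (by gcongr)

theorem enorm_coeff_mul_le_wnorm (r : ℝ≥0) (f : MvPowerSeries σ ℂ) (d : σ →₀ ℕ) :
    ‖coeff d f‖ₑ * (r : ℝ≥0∞) ^ d.degree ≤ wnorm r f :=
  ENNReal.le_tsum (f := fun d : σ →₀ ℕ => ‖coeff d f‖ₑ * (r : ℝ≥0∞) ^ d.degree) d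

theorem wnorm_prod_pow_le {r : ℝ≥0} {ρ : ℝ≥0∞} {a : σ → MvPowerSeries τ ℂ}
    (ha : ∀ i, wnorm r (a i) ≤ ρ) (d : σ →₀ ℕ) :
    wnorm r (d.prod fun i n => a i ^ n) ≤ ρ ^ d.degree := by
  unfold Finsupp.prod
  refine (wnorm_prod_le _ _ _).trans ?_
  rw [Finsupp.degree_apply, ← Finset.prod_pow_eq_pow_sum]
  gcongr with i _
  exact (wnorm_pow_le _ _ _).trans (by gcongr; exact ha i)

/-- Expand `subst a f` over the monomials of `f` and exchange the nonnegative double sum: the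
monomial `d` in the `a i` has norm at most `ρ ^ |d|`, exactly the weight it carries in `wnorm ρ f`.
-/
theorem wnorm_subst_le [Finite σ] {r ρ : ℝ≥0} {a : σ → MvPowerSeries τ ℂ}
    (h0 : ∀ i, constantCoeff (a i) = 0) (ha : ∀ i, wnorm r (a i) ≤ ρ) (f : MvPowerSeries σ ℂ) :
    wnorm r (subst a f) ≤ wnorm ρ f := by
  have hs : HasSubst a := hasSubst_of_constantCoeff_zero h0
  calc wnorm r (subst a f)
      ≤ ∑' e : τ →₀ ℕ, ∑' d : σ →₀ ℕ,
          ‖coeff d f‖ₑ * (‖coeff e (d.prod fun i n => a i ^ n)‖ₑ * (r : ℝ≥0∞) ^ e.degree) := by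
        refine ENNReal.tsum_le_tsum fun e => ?_
        have hf := coeff_subst_finite hs f e
        rw [coeff_subst hs, finsum_eq_sum _ hf]
        calc _ ≤ (∑ d ∈ hf.toFinset, ‖coeff d f • coeff e (d.prod fun i n => a i ^ n)‖ₑ)
                * (r : ℝ≥0∞) ^ e.degree := by
              gcongr
              exact enorm_sum_le _ _
          _ = ∑ d ∈ hf.toFinset, ‖coeff d f‖ₑ *
                (‖coeff e (d.prod fun i n => a i ^ n)‖ₑ * (r : ℝ≥0∞) ^ e.degree) := by
              rw [Finset.sum_mul]
              refine Finset.sum_congr rfl fun d _ => ?_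
              rw [smul_eq_mul, enorm_mul, mul_assoc]
          _ ≤ _ := ENNReal.sum_le_tsum _
    _ = ∑' d : σ →₀ ℕ, ‖coeff d f‖ₑ * wnorm r (d.prod fun i n => a i ^ n) := by
        rw [ENNReal.tsum_comm]
        simp_rw [ENNReal.tsum_mul_left]
        rfl
    _ ≤ wnorm ρ f := by
        refine ENNReal.tsum_le_tsum fun d => ?_
        gcongr
        exact wnorm_prod_pow_le ha d

/-- Every surviving monomial has positive degree, so shrinking the radius gains at least one factor
`r / R`. This is what makes the norm of a series vanishing at the origin arbitrarily small. -/
theorem wnorm_le_of_constantCoeff_eq_zero {r R : ℝ≥0} (hr : r ≤ R) (hR : 0 < R)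
    {f : MvPowerSeries σ ℂ} (h0 : constantCoeff f = 0) :
    wnorm r f ≤ ((r / R : ℝ≥0) : ℝ≥0∞) * wnorm R f := by
  unfold wnorm
  rw [← ENNReal.tsum_mul_left]
  refine ENNReal.tsum_le_tsum fun d => ?_
  rcases eq_or_ne d 0 with rfl | hd
  · simp [h0]
  · have hd' : d.degree ≠ 0 := by rwa [Ne, Finsupp.degree_eq_zero_iff]
    obtain ⟨n, hn⟩ := Nat.exists_eq_succ_of_ne_zero hd'
    have h1 : (r / R) * R = r := div_mul_cancel₀ _ hR.ne'
    have : r ^ d.degree ≤ (r / R) * R ^ d.degree := by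
      rw [hn, pow_succ, pow_succ]
      calc r ^ n * r ≤ R ^ n * r := by gcongr
        _ = R ^ n * ((r / R) * R) := by rw [h1]
        _ = _ := by ring
    calc _ ≤ ‖coeff d f‖ₑ * (((r / R) * R ^ d.degree : ℝ≥0) : ℝ≥0∞) := by
          gcongr
          exact_mod_cast this
      _ = _ := by push_cast; ring

/-- Convergence of a power series in arbitrarily many variables: finiteness of a weighted norm. -/
def HasRadius (f : MvPowerSeries σ ℂ) : Prop := ∃ r : ℝ≥0, 0 < r ∧ wnorm r f ≠ ⊤

theorem isConvergent_iff_hasRadius {N : ℕ} (f : MvPowerSeries (Fin N) ℂ) :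
    IsConvergent f ↔ HasRadius f := by
  have key : ∀ r : ℝ≥0, (Summable fun d : Fin N →₀ ℕ => ‖coeff d f‖ * (r : ℝ) ^ d.degree) ↔
      wnorm r f ≠ ⊤ := by
    intro r
    have h1 : (fun d : Fin N →₀ ℕ => ‖coeff d f‖ * (r : ℝ) ^ d.degree) =
        fun d => ((‖coeff d f‖₊ * r ^ d.degree : ℝ≥0) : ℝ) := by
      ext d; simp
    rw [h1, NNReal.summable_coe, ← ENNReal.tsum_coe_ne_top_iff_summable]
    simp [wnorm, enorm_eq_nnnorm]
  constructor
  · rintro ⟨r, hr, h⟩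
    exact ⟨⟨r, hr.le⟩, hr, (key ⟨r, hr.le⟩).1 h⟩
  · rintro ⟨r, hr, h⟩
    exact ⟨r, hr, (key r).2 h⟩

theorem HasRadius.exists_wnorm_le {f : MvPowerSeries σ ℂ} (hf : HasRadius f)
    (h0 : constantCoeff f = 0) {ε : ℝ≥0} (hε : 0 < ε) :
    ∃ r : ℝ≥0, 0 < r ∧ ∀ s ≤ r, wnorm s f ≤ ε := by
  obtain ⟨R, hR, hf⟩ := hf
  obtain ⟨A, hA⟩ : ∃ A : ℝ≥0, (A : ℝ≥0∞) = wnorm R f := ⟨_, ENNReal.coe_toNNReal hf⟩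
  -- The radius is chosen so that `(s / R) * A ≤ ε`; the `+ 1` covers `A = 0`.
  refine ⟨min R (R * ε / (A + 1)), lt_min hR (by positivity), fun s hs => ?_⟩
  refine (wnorm_mono hs f).trans ?_
  refine (wnorm_le_of_constantCoeff_eq_zero (min_le_left _ _) hR h0).trans ?_
  rw [← hA, ← ENNReal.coe_mul, ENNReal.coe_le_coe]
  calc _ ≤ (R * ε / (A + 1)) / R * (A + 1) := by
        gcongr
        · exact min_le_right _ _
        · exact le_self_add
    _ = ε := by field_simp

theorem HasRadius.exists_forall_wnorm_le {ι : Type*} [Finite ι] {f : ι → MvPowerSeries σ ℂ}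
    (hf : ∀ i, HasRadius (f i)) (h0 : ∀ i, constantCoeff (f i) = 0) {ε : ℝ≥0} (hε : 0 < ε) :
    ∃ r : ℝ≥0, 0 < r ∧ ∀ s ≤ r, ∀ i, wnorm s (f i) ≤ ε := by
  cases nonempty_fintype ι
  choose r hr h using fun i => (hf i).exists_wnorm_le (h0 i) hε
  rcases isEmpty_or_nonempty ι with h' | h'
  · exact ⟨1, one_pos, fun s _ i => h'.elim i⟩
  · refine ⟨Finset.univ.inf' Finset.univ_nonempty r, ?_, fun s hs i => ?_⟩
    · rw [Finset.lt_inf'_iff]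
      exact fun i _ => hr i
    · exact h i s (hs.trans (Finset.inf'_le _ (Finset.mem_univ i)))

theorem HasRadius.exists_forall_wnorm_ne_top {ι : Type*} [Finite ι] {f : ι → MvPowerSeries σ ℂ}
    (hf : ∀ i, HasRadius (f i)) :
    ∃ r : ℝ≥0, 0 < r ∧ ∀ s ≤ r, ∀ i, wnorm s (f i) ≠ ⊤ := by
  cases nonempty_fintype ι
  choose r hr h using hf
  rcases isEmpty_or_nonempty ι with h' | h'
  · exact ⟨1, one_pos, fun s _ i => h'.elim i⟩
  · refine ⟨Finset.univ.inf' Finset.univ_nonempty r, ?_, fun s hs i => ?_⟩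
    · rw [Finset.lt_inf'_iff]
      exact fun i _ => hr i
    · exact ne_top_of_le_ne_top (h i)
        (wnorm_mono (hs.trans (Finset.inf'_le _ (Finset.mem_univ i))) _)

theorem HasRadius.subst [Finite σ] {a : σ → MvPowerSeries τ ℂ} {f : MvPowerSeries σ ℂ}
    (hf : HasRadius f) (ha : ∀ i, HasRadius (a i)) (h0 : ∀ i, constantCoeff (a i) = 0) :
    HasRadius (subst a f) := by
  obtain ⟨ρ, hρ, hf⟩ := hf
  obtain ⟨r, hr, h⟩ := HasRadius.exists_forall_wnorm_le ha h0 hρ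
  exact ⟨r, hr, ne_top_of_le_ne_top hf (wnorm_subst_le h0 (h r le_rfl) f)⟩

end

end

end CurveGerm

/-! ### The local ring of convergent power series: shifts, substitution, units, square roots. -/

namespace CurveGerm

noncomputable section

open MvPowerSeries
open scoped ENNReal NNReal

section Shift

variable {N : ℕ}

/-- The part of `f` made of the monomials `X ^ d` for which `i` is the first index with `K ≤ d i`,
divided by `X i ^ K`. -/
def shift (K : ℕ) (i : Fin N) (f : MvPowerSeries (Fin N) ℂ) : MvPowerSeries (Fin N) ℂ :=
  fun e => if ∀ j < i, e j < K then coeff (e + Finsupp.single i K) f else 0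

theorem coeff_shift (K : ℕ) (i : Fin N) (f : MvPowerSeries (Fin N) ℂ) (e : Fin N →₀ ℕ) :
    coeff e (shift K i f) = if ∀ j < i, e j < K then coeff (e + Finsupp.single i K) f else 0 :=
  rfl

/-- The exponent with entries `e j < K`. -/
def boxExponent {K : ℕ} (e : Fin N → Fin K) : Fin N →₀ ℕ :=
  Finsupp.equivFunOnFinite.symm fun j => (e j : ℕ)

theorem coeff_X_pow_mul_shift (K : ℕ) (i : Fin N) (f : MvPowerSeries (Fin N) ℂ)
    (d : Fin N →₀ ℕ) :
    coeff d (X i ^ K * shift K i f) =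
      if K ≤ d i ∧ ∀ j < i, d j < K then coeff d f else 0 := by
  rw [X_pow_eq, coeff_monomial_mul, one_mul, coeff_shift]
  have h1 : Finsupp.single i K ≤ d ↔ K ≤ d i := by
    simp
  by_cases h : K ≤ d i
  · rw [if_pos (h1.2 h), tsub_add_cancel_of_le (h1.2 h)]
    have h2 : (∀ j < i, (d - Finsupp.single i K) j < K) ↔ ∀ j < i, d j < K := by
      refine forall₂_congr fun j hj => ?_
      simp [Finsupp.tsub_apply, Finsupp.single_eq_of_ne hj.ne]
    simp only [h2, h, true_and]
  · rw [if_neg (fun h' => h (h1.1 h')), if_neg (fun h' => h h'.1)]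

/-- A monomial outside the box of exponents below `K` is claimed by exactly one coordinate, the
first whose exponent reaches `K`, so nothing is counted twice. -/
theorem eq_box_add_sum_shift (K : ℕ) (f : MvPowerSeries (Fin N) ℂ) :
    f = ∑ e : Fin N → Fin K, monomial (boxExponent e) (coeff (boxExponent e) f) +
      ∑ i, X i ^ K * shift K i f := by
  classical
  ext d
  rw [map_add, map_sum, map_sum]
  simp only [coeff_X_pow_mul_shift, coeff_monomial]
  by_cases h : ∀ j, d j < K
  · have h1 : d = boxExponent fun j => (⟨d j, h j⟩ : Fin K) := by
      ext j; simp [boxExponent]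
    rw [Finset.sum_eq_single fun j => (⟨d j, h j⟩ : Fin K), ← h1, if_pos rfl,
      Finset.sum_eq_zero, add_zero]
    · intro i _
      rw [if_neg]
      exact fun h' => (h i).not_ge h'.1
    · intro e _ he
      rw [if_neg]
      rintro rfl
      exact he (by ext j; simp [boxExponent])
    · simp
  · push Not at h
    have hne : (Finset.univ.filter fun j => K ≤ d j).Nonempty := by
      obtain ⟨j, hj⟩ := h
      exact ⟨j, by simpa using hj⟩
    have hmem := Finset.min'_mem _ hne
    set i := Finset.min' _ hne with hi
    have hK : K ≤ d i := by simpa using hmem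
    have hlt : ∀ j < i, d j < K := by
      intro j hj
      by_contra hj'
      exact hj.not_ge (Finset.min'_le _ j (by simpa using hj'))
    rw [Finset.sum_eq_zero, zero_add, Finset.sum_eq_single i]
    · rw [if_pos ⟨hK, hlt⟩]
    · intro j _ hj
      rw [if_neg]
      rintro ⟨h1, h2⟩
      rcases lt_or_gt_of_ne hj with h3 | h3
      · exact (hlt j h3).not_ge h1
      · exact (h2 i h3).not_ge hK
    · simp
    · intro e _
      rw [if_neg]
      rintro rfl
      exact hK.not_gt (by simp [boxExponent])

/-- The coefficients of the shift are some of those of `f`, reindexed injectively. Dividing by `X i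
^ K` therefore costs only the factor `r ^ (-K)`, which controls the division algorithm. -/
theorem pow_mul_wnorm_shift_le (r : ℝ≥0) (K : ℕ) (i : Fin N) (f : MvPowerSeries (Fin N) ℂ) :
    (r : ℝ≥0∞) ^ K * wnorm r (shift K i f) ≤ wnorm r f := by
  unfold wnorm
  rw [← ENNReal.tsum_mul_left]
  refine le_trans (ENNReal.tsum_le_tsum fun e => ?_) (ENNReal.tsum_comp_le_tsum_of_injective
    (add_left_injective (Finsupp.single i K))
    (fun d : Fin N →₀ ℕ => ‖coeff d f‖ₑ * (r : ℝ≥0∞) ^ d.degree))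
  rw [coeff_shift]
  split_ifs
  · simp only [map_add, Finsupp.degree_single, pow_add]
    exact (by ring : (_ : ℝ≥0∞) = _).le
  · simp

theorem HasRadius.shift {f : MvPowerSeries (Fin N) ℂ} (hf : HasRadius f) (K : ℕ) (i : Fin N) :
    HasRadius (shift K i f) := by
  obtain ⟨r, hr, hf⟩ := hf
  refine ⟨r, hr, fun h => hf ?_⟩
  have := pow_mul_wnorm_shift_le r K i f
  rw [h, ENNReal.mul_top (by positivity)] at this
  exact top_le_iff.1 this

end Shift

section Ring

variable {N k : ℕ}

theorem hasRadius_coe (f : ConvergentSeries N) : HasRadius f.1 :=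
  (isConvergent_iff_hasRadius _).1 f.2

/-- The value at the origin of a convergent power series. -/
def evalZero : ConvergentSeries N →ₐ[ℂ] ℂ where
  toRingHom := (constantCoeff (σ := Fin N) (R := ℂ)).comp (ConvergentSeries N).val.toRingHom
  commutes' c := by
    change constantCoeff (C (σ := Fin N) c) = c
    exact constantCoeff_C c

theorem evalZero_apply (f : ConvergentSeries N) : evalZero f = constantCoeff f.1 := rfl

@[simp]
theorem evalZero_coord (i : Fin N) : evalZero (coord i) = 0 := by
  simp [evalZero_apply, coord]

/-- The part `shift` of a convergent power series. -/
def cshift (K : ℕ) (i : Fin N) (f : ConvergentSeries N) : ConvergentSeries N :=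
  ⟨shift K i f.1, (isConvergent_iff_hasRadius _).2 ((hasRadius_coe f).shift K i)⟩

/-- The monomial with a given exponent. -/
def cmonomial (d : Fin N →₀ ℕ) : ConvergentSeries N := d.prod fun i n => coord i ^ n

theorem cmonomial_val (d : Fin N →₀ ℕ) : (cmonomial d).1 = monomial d 1 := by
  rw [monomial_one_eq]
  change (ConvergentSeries N).val (d.prod fun i n => coord i ^ n) = _
  rw [map_finsuppProd]
  simp only [map_pow]
  rfl

theorem eq_sum_box_add_sum_cshift (K : ℕ) (f : ConvergentSeries N) :
    f = ∑ e : Fin N → Fin K, coeff (boxExponent e) f.1 • cmonomial (boxExponent e) +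
      ∑ i, coord i ^ K * cshift K i f := by
  apply Subtype.ext
  conv_lhs => rw [eq_box_add_sum_shift K f.1]
  rw [Subalgebra.coe_add, AddSubmonoidClass.coe_finsetSum, AddSubmonoidClass.coe_finsetSum]
  congr 1
  refine Finset.sum_congr rfl fun e _ => ?_
  rw [Subalgebra.coe_smul, cmonomial_val, ← map_smul, smul_eq_mul, mul_one]

/-- Case `K = 1` of the box decomposition, where the box is the single exponent `0`. -/
theorem eq_algebraMap_add_sum_coord_mul (f : ConvergentSeries N) :
    f = algebraMap ℂ _ (evalZero f) + ∑ i, coord i * cshift 1 i f := by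
  conv_lhs => rw [eq_sum_box_add_sum_cshift 1 f]
  have h : boxExponent (default : Fin N → Fin 1) = 0 := by
    ext j; simp [boxExponent]
  simp only [pow_one, Fintype.sum_unique, h]
  rw [Algebra.algebraMap_eq_smul_one]
  simp [cmonomial, evalZero_apply]

theorem ker_evalZero :
    RingHom.ker (evalZero : ConvergentSeries N →ₐ[ℂ] ℂ) = Ideal.span (Set.range coord) := by
  apply le_antisymm
  · intro f hf
    rw [RingHom.mem_ker] at hf
    rw [eq_algebraMap_add_sum_coord_mul f, hf, map_zero, zero_add]
    exact Ideal.sum_mem _ fun i _ => Ideal.mul_mem_right _ _ (Ideal.subset_span ⟨i, rfl⟩)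
  · rw [Ideal.span_le]
    rintro _ ⟨i, rfl⟩
    exact evalZero_coord i

instance : IsDomain (ConvergentSeries N) :=
  have : IsDomain (MvPowerSeries (Fin N) ℂ) := NoZeroDivisors.to_isDomain _
  (Subtype.val_injective (p := fun f => f ∈ ConvergentSeries N)).isDomain
    (ConvergentSeries N).val.toRingHom

/-- The formal quotient converges: its coefficients are coefficients of `f` with shifted index, so
`r` times its norm is at most the norm of `f`. -/
theorem coord_dvd_iff {i : Fin N} {f : ConvergentSeries N} :
    coord i ∣ f ↔ ∀ d : Fin N →₀ ℕ, d i = 0 → coeff d f.1 = 0 := by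
  constructor
  · rintro ⟨g, rfl⟩
    exact X_dvd_iff.1 (Dvd.intro g.1 rfl)
  · intro h
    obtain ⟨g, hg⟩ := X_dvd_iff.2 h
    refine ⟨⟨g, ?_⟩, Subtype.ext hg⟩
    refine (isConvergent_iff_hasRadius _).2 ?_
    obtain ⟨r, hr, hf⟩ := hasRadius_coe f
    refine ⟨r, hr, fun h' => hf (top_le_iff.1 ?_)⟩
    calc (⊤ : ℝ≥0∞) = r * wnorm r g := by rw [h', ENNReal.mul_top (by positivity)]
      _ = ∑' e : Fin N →₀ ℕ, ‖coeff (e + Finsupp.single i 1) f.1‖ₑ *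
          (r : ℝ≥0∞) ^ (e + Finsupp.single i 1).degree := by
        unfold wnorm
        rw [← ENNReal.tsum_mul_left]
        refine tsum_congr fun e => ?_
        rw [hg, X_def, add_comm e, coeff_add_monomial_mul, one_mul, map_add,
          Finsupp.degree_single, pow_add, pow_one]
        ring
      _ ≤ wnorm r f.1 := ENNReal.tsum_comp_le_tsum_of_injective
          (add_left_injective (Finsupp.single i 1))
          (fun d : Fin N →₀ ℕ => ‖coeff d f.1‖ₑ * (r : ℝ≥0∞) ^ d.degree)

/-- Substitution of convergent power series vanishing at the origin. -/
def csubst (b : Fin k → ConvergentSeries N) (hb : ∀ i, evalZero (b i) = 0) :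
    ConvergentSeries k →ₐ[ℂ] ConvergentSeries N :=
  AlgHom.codRestrict
    ((substAlgHom (R := ℂ) (hasSubst_of_constantCoeff_zero (a := fun i => (b i).1) hb)).comp
      (ConvergentSeries k).val) _ fun f => by
    change IsConvergent _
    rw [AlgHom.comp_apply, substAlgHom_apply, isConvergent_iff_hasRadius]
    exact (hasRadius_coe f).subst (fun i => hasRadius_coe (b i)) hb

theorem csubst_val (b : Fin k → ConvergentSeries N) (hb : ∀ i, evalZero (b i) = 0)
    (f : ConvergentSeries k) : (csubst b hb f).1 = subst (fun i => (b i).1) f.1 := by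
  change substAlgHom (hasSubst_of_constantCoeff_zero (a := fun i => (b i).1) hb) f.1 = _
  rw [substAlgHom_apply]

@[simp]
theorem csubst_coord (b : Fin k → ConvergentSeries N) (hb : ∀ i, evalZero (b i) = 0)
    (i : Fin k) : csubst b hb (coord i) = b i :=
  Subtype.ext ((csubst_val _ _ _).trans
    (subst_X (hasSubst_of_constantCoeff_zero (a := fun i => (b i).1) hb) i))

/-- Substitution of a convergent power series vanishing at the origin into a power series in one
variable with bounded coefficients. -/
theorem hasRadius_powerSeries_subst {F : PowerSeries ℂ} {A : ℝ≥0}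
    (hF : ∀ n, ‖PowerSeries.coeff n F‖ₑ ≤ A) (g : ConvergentSeries N) (hg : evalZero g = 0) :
    HasRadius (PowerSeries.subst g.1 F) := by
  -- With bounded coefficients, the norm at radius `1 / 2` is dominated by a geometric series.
  refine HasRadius.subst (σ := Unit) ⟨1 / 2, by positivity, ?_⟩ (fun _ => hasRadius_coe g)
    (fun _ => hg)
  have : wnorm (1 / 2) F ≤ ∑' n : ℕ, (A : ℝ≥0∞) * (2⁻¹ : ℝ≥0∞) ^ n := by
    unfold wnorm
    rw [← (Finsupp.uniqueEquiv (M := ℕ) ()).symm.tsum_eq]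
    refine ENNReal.tsum_le_tsum fun n => ?_
    have h1 : (Finsupp.uniqueEquiv (M := ℕ) ()).symm n = Finsupp.single () n := by
      ext; simp
    rw [h1, Finsupp.degree_single]
    gcongr
    · exact hF n
    · simp
  refine ne_top_of_le_ne_top ?_ this
  rw [ENNReal.tsum_mul_left, ENNReal.tsum_geometric]
  exact ENNReal.mul_ne_top ENNReal.coe_ne_top (by simp)

/-- The inverse is the geometric series evaluated at `g`. -/
theorem isUnit_one_sub {g : ConvergentSeries N} (hg : evalZero g = 0) : IsUnit (1 - g) := by
  have hs : PowerSeries.HasSubst g.1 := PowerSeries.HasSubst.of_constantCoeff_zero hg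
  refine IsUnit.of_mul_eq_one ⟨PowerSeries.subst g.1 (PowerSeries.mk 1 : PowerSeries ℂ),
    (isConvergent_iff_hasRadius _).2 (hasRadius_powerSeries_subst (A := 1) (by simp) g hg)⟩ ?_
  apply Subtype.ext
  have h := congrArg (PowerSeries.substAlgHom (R := ℂ) hs)
    (PowerSeries.mk_one_mul_one_sub_eq_one ℂ)
  rw [map_mul, map_sub, map_one, PowerSeries.substAlgHom_X, mul_comm,
    PowerSeries.coe_substAlgHom] at h
  exact h

theorem isUnit_iff {f : ConvergentSeries N} : IsUnit f ↔ evalZero f ≠ 0 := by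
  refine ⟨fun h => (h.map evalZero).ne_zero, fun h => ?_⟩
  have h1 : IsUnit (1 - (1 - algebraMap ℂ (ConvergentSeries N) (evalZero f)⁻¹ * f)) :=
    isUnit_one_sub (by simp [h])
  rw [sub_sub_cancel] at h1
  exact (IsUnit.mul_iff.1 h1).2

instance : IsLocalRing (ConvergentSeries N) :=
  IsLocalRing.of_nonunits_add fun a b ha hb => by
    simp only [mem_nonunits_iff, isUnit_iff, not_not] at *
    rw [map_add, ha, hb, add_zero]

theorem mem_maximalIdeal_iff {f : ConvergentSeries N} :
    f ∈ IsLocalRing.maximalIdeal (ConvergentSeries N) ↔ evalZero f = 0 := by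
  rw [IsLocalRing.mem_maximalIdeal, mem_nonunits_iff, isUnit_iff, not_not]

theorem maximalIdeal_eq_span :
    IsLocalRing.maximalIdeal (ConvergentSeries N) = Ideal.span (Set.range coord) := by
  rw [← ker_evalZero]
  ext f
  exact mem_maximalIdeal_iff

/-- Consecutive binomial coefficients have ratio `(1/2 - n) / (n + 1)`, of norm at most `1`. The
bound makes the series of `√(1 + X)` converge. -/
theorem norm_choose_half_le (n : ℕ) : ‖Ring.choose (1 / 2 : ℂ) n‖ ≤ 1 := by
  induction n with
  | zero => simp
  | succ n ih =>
    have h : Ring.choose (1 / 2 : ℂ) (n + 1) * (n + 1) =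
        Ring.choose (1 / 2 : ℂ) n * (1 / 2 - n) := by
      rw [Ring.choose_eq_smul, Ring.choose_eq_smul, descPochhammer_succ_right,
        Polynomial.smeval_mul,
        Nat.factorial_succ]
      have : (n.factorial : ℂ) ≠ 0 := by exact_mod_cast n.factorial_ne_zero
      have : (n + 1 : ℂ) ≠ 0 := by exact_mod_cast n.succ_ne_zero
      simp [Polynomial.smeval_sub, Polynomial.smeval_natCast]
      field_simp
    have h2 : ‖(1 / 2 - n : ℂ)‖ ≤ n + 1 := by
      refine (norm_sub_le _ _).trans ?_
      simp
      linarith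
    have h3 := congrArg norm h
    rw [norm_mul, norm_mul] at h3
    have h4 : ‖(n + 1 : ℂ)‖ = n + 1 := by
      have := Complex.norm_natCast (n + 1)
      push_cast at this
      exact this
    rw [h4] at h3
    have h5 : ‖Ring.choose (1 / 2 : ℂ) (n + 1)‖ * (n + 1) ≤ 1 * (n + 1) := by
      rw [h3]
      exact mul_le_mul ih h2 (norm_nonneg _) zero_le_one
    exact le_of_mul_le_mul_right h5 (by positivity)

theorem exists_sq_eq_one_add {g : ConvergentSeries N} (hg : evalZero g = 0) :
    ∃ s : ConvergentSeries N, s ^ 2 = 1 + g := by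
  have hs : PowerSeries.HasSubst g.1 := PowerSeries.HasSubst.of_constantCoeff_zero hg
  refine ⟨⟨PowerSeries.subst g.1 (PowerSeries.binomialSeries ℂ (1 / 2 : ℂ)),
    (isConvergent_iff_hasRadius _).2 (hasRadius_powerSeries_subst (A := 1) (fun n => ?_) g hg)⟩, ?_⟩
  · rw [PowerSeries.binomialSeries_coeff, smul_eq_mul, mul_one, ← ofReal_norm]
    simpa only [ENNReal.coe_one, ENNReal.ofReal_le_one] using norm_choose_half_le n
  · apply Subtype.ext
    have h : PowerSeries.binomialSeries ℂ (1 / 2 : ℂ) ^ 2 = 1 + PowerSeries.X := by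
      rw [sq, ← PowerSeries.binomialSeries_add]
      have := PowerSeries.binomialSeries_nat (R := ℂ) (A := ℂ) 1
      norm_num at this ⊢
      exact this
    have h2 := congrArg (PowerSeries.substAlgHom (R := ℂ) hs) h
    rw [map_pow, map_add, map_one, PowerSeries.substAlgHom_X, PowerSeries.coe_substAlgHom] at h2
    exact h2

theorem exists_sq_eq_of_isUnit {u : ConvergentSeries N} (hu : IsUnit u) :
    ∃ s : ConvergentSeries N, s ^ 2 = u := by
  have h0 := isUnit_iff.1 hu
  obtain ⟨c, hc⟩ := IsAlgClosed.exists_pow_nat_eq (evalZero u) two_pos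
  obtain ⟨s, hs⟩ := exists_sq_eq_one_add
    (g := algebraMap ℂ (ConvergentSeries N) (evalZero u)⁻¹ * u - 1) (by simp [h0])
  refine ⟨algebraMap ℂ _ c * s, ?_⟩
  rw [mul_pow, hs, add_sub_cancel, ← map_pow, hc, ← mul_assoc, ← map_mul, mul_inv_cancel₀ h0,
    map_one, one_mul]

end Ring

end

end CurveGerm

/-! ### Formal summation and the division theorem. -/

namespace CurveGerm

noncomputable section

open MvPowerSeries
open scoped ENNReal NNReal

section FormalSum

variable {σ : Type*}

/-- The formal sum of a sequence of power series `F n` of order at least `n`. -/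
def formalSum (F : ℕ → MvPowerSeries σ ℂ) : MvPowerSeries σ ℂ :=
  fun d => ∑ n ∈ Finset.range (d.degree + 1), coeff d (F n)

theorem coeff_formalSum (F : ℕ → MvPowerSeries σ ℂ) (d : σ →₀ ℕ) :
    coeff d (formalSum F) = ∑ n ∈ Finset.range (d.degree + 1), coeff d (F n) := rfl

/-- Only the terms of index at most `|d|` reach the coefficient `d`, so partial sums agree with the
formal sum up to order `m`. -/
theorem le_order_formalSum_sub {F : ℕ → MvPowerSeries σ ℂ} (hF : ∀ n : ℕ, n ≤ (F n).order)
    (m : ℕ) : m ≤ (formalSum F - ∑ n ∈ Finset.range m, F n).order := by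
  refine nat_le_order fun d hd => ?_
  rw [map_sub, map_sum, coeff_formalSum, sub_eq_zero]
  refine Finset.sum_subset (fun n hn => ?_) fun n _ hn => coeff_of_lt_order ?_
  · rw [Finset.mem_range] at *
    omega
  · rw [Finset.mem_range] at hn
    refine lt_of_lt_of_le ?_ (hF n)
    exact_mod_cast (by omega : d.degree < n)

theorem wnorm_formalSum_le (r : ℝ≥0) (F : ℕ → MvPowerSeries σ ℂ) :
    wnorm r (formalSum F) ≤ ∑' n, wnorm r (F n) := by
  unfold wnorm
  rw [ENNReal.tsum_comm]
  refine ENNReal.tsum_le_tsum fun d => ?_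
  rw [ENNReal.tsum_mul_right, coeff_formalSum]
  gcongr
  exact (enorm_sum_le _ _).trans (ENNReal.sum_le_tsum _)

theorem wnorm_formalSum_ne_top {r : ℝ≥0} {F : ℕ → MvPowerSeries σ ℂ} {x L : ℝ≥0∞}
    (hx : x < 1) (hL : L ≠ ⊤) (h : ∀ n, wnorm r (F n) ≤ x ^ n * L) :
    wnorm r (formalSum F) ≠ ⊤ := by
  refine ne_top_of_le_ne_top ?_ ((wnorm_formalSum_le r F).trans (ENNReal.tsum_le_tsum h))
  rw [ENNReal.tsum_mul_right, ENNReal.tsum_geometric]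
  exact ENNReal.mul_ne_top (ENNReal.inv_ne_top.2 (tsub_pos_of_lt hx).ne') hL

end FormalSum

section Order

variable {N k : ℕ}

/-- The ideal of convergent power series of order at least `m`. -/
def orderIdeal (N m : ℕ) : Ideal (ConvergentSeries N) where
  carrier := {f | (m : ℕ∞) ≤ f.1.order}
  zero_mem' := by simp
  add_mem' {f g} hf hg := le_trans (le_min hf hg) min_order_le_add
  smul_mem' f g hg := le_trans (le_trans hg le_add_self) (le_order_mul (f := f.1))

theorem mem_orderIdeal {m : ℕ} {f : ConvergentSeries N} :
    f ∈ orderIdeal N m ↔ (m : ℕ∞) ≤ f.1.order := Iff.rfl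

/-- Lets identities between infinite sums be checked modulo each order, without any limit. -/
theorem eq_zero_of_forall_mem_orderIdeal {f : ConvergentSeries N}
    (h : ∀ m, f ∈ orderIdeal N m) : f = 0 := by
  refine Subtype.ext (order_eq_top_iff.1 ?_)
  exact ENat.eq_top_iff_forall_ge.2 h

theorem csubst_mem_orderIdeal (b : Fin k → ConvergentSeries N) (hb : ∀ i, evalZero (b i) = 0)
    {m : ℕ} {f : ConvergentSeries k} (hf : f ∈ orderIdeal k m) :
    csubst b hb f ∈ orderIdeal N m := by
  rw [mem_orderIdeal] at *
  rw [csubst_val]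
  refine le_trans ?_ (le_order_subst (hasSubst_of_constantCoeff_zero hb) f.1)
  have : (1 : ℕ∞) ≤ ⨅ i, (b i).1.order :=
    le_iInf fun i => one_le_order_iff_constCoeff_eq_zero.2 (hb i)
  calc (m : ℕ∞) ≤ f.1.order := hf
    _ = 1 * f.1.order := (one_mul _).symm
    _ ≤ _ := by gcongr

theorem prod_mem_orderIdeal {n : ℕ} {g : Fin n → ConvergentSeries N}
    (hg : ∀ i, evalZero (g i) = 0) : ∏ i, g i ∈ orderIdeal N n := by
  induction n with
  | zero => simp [mem_orderIdeal]
  | succ n ih =>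
    rw [Fin.prod_univ_succ, mem_orderIdeal]
    refine le_trans ?_ (le_order_mul (f := (g 0).1))
    rw [Nat.cast_succ, add_comm]
    exact add_le_add (one_le_order_iff_constCoeff_eq_zero.2 (hg 0)) (ih fun i => hg i.succ)

end Order

section Division

variable {N k K : ℕ} (q : Fin N → Fin k → ConvergentSeries N)

/-- The `j`-th quotient in the division of a power series by `b`, when `X i ^ K` is
`∑ j, b j * q i j` up to an error term. -/
def quot (K : ℕ) (j : Fin k) (f : ConvergentSeries N) : ConvergentSeries N :=
  ∑ i, q i j * cshift K i f

/-- Iterated quotients. -/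
def iterQuot (K : ℕ) (f : ConvergentSeries N) : (n : ℕ) → (Fin n → Fin k) → ConvergentSeries N
  | 0, _ => f
  | n + 1, w => quot q K (w 0) (iterQuot K f n (Fin.tail w))

/-- Splits off the first letter of each word, that is, the most recent division step. -/
theorem sum_prod_mul_iterQuot_succ (b : Fin k → ConvergentSeries N) (f : ConvergentSeries N)
    (n : ℕ) :
    ∑ w : Fin (n + 1) → Fin k, (∏ i, b (w i)) * iterQuot q K f (n + 1) w =
      ∑ w : Fin n → Fin k, (∏ i, b (w i)) * ∑ j, b j * quot q K j (iterQuot q K f n w) := by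
  rw [← (Fin.consEquiv fun _ : Fin (n + 1) => Fin k).sum_comp, Fintype.sum_prod_type,
    Finset.sum_comm]
  refine Finset.sum_congr rfl fun w _ => ?_
  rw [Finset.mul_sum]
  refine Finset.sum_congr rfl fun j _ => ?_
  rw [Fin.prod_univ_succ]
  change b j * (∏ i, b (w i)) * quot q K j (iterQuot q K f n w) = _
  ring

theorem wnorm_cshift_le {r : ℝ≥0} (hr : 0 < r) (i : Fin N) (f : ConvergentSeries N) :
    wnorm r (cshift K i f).1 ≤ ((r : ℝ≥0∞) ^ K)⁻¹ * wnorm r f.1 := by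
  have h0 : (r : ℝ≥0∞) ^ K ≠ 0 := by positivity
  rw [mul_comm, ← div_eq_mul_inv, ENNReal.le_div_iff_mul_le (Or.inl h0) (Or.inl (by finiteness)),
    mul_comm]
  exact pow_mul_wnorm_shift_le r K i f.1

/-- At a fixed radius each quotient operation is bounded; the same constant serves every `f` and
`j`, so `n` steps cost at most its `n`-th power. -/
theorem exists_wnorm_quot_le {r : ℝ≥0} (hr : 0 < r) (hq : ∀ i j, wnorm r (q i j).1 ≠ ⊤) :
    ∃ C : ℝ≥0, ∀ (j : Fin k) (f : ConvergentSeries N),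
      wnorm r (quot q K j f).1 ≤ C * wnorm r f.1 := by
  have hC : ∑ i, ∑ j, wnorm r (q i j).1 * ((r : ℝ≥0∞) ^ K)⁻¹ ≠ ⊤ := by
    refine ENNReal.sum_ne_top.2 fun i _ => ENNReal.sum_ne_top.2 fun j _ => ?_
    exact ENNReal.mul_ne_top (hq i j) (ENNReal.inv_ne_top.2 (by positivity))
  refine ⟨(∑ i, ∑ j, wnorm r (q i j).1 * ((r : ℝ≥0∞) ^ K)⁻¹).toNNReal, fun j f => ?_⟩
  rw [ENNReal.coe_toNNReal hC, quot, AddSubmonoidClass.coe_finsetSum, Finset.sum_mul]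
  refine (wnorm_sum_le _ _ _).trans (Finset.sum_le_sum fun i _ => ?_)
  calc _ ≤ wnorm r (q i j).1 * (((r : ℝ≥0∞) ^ K)⁻¹ * wnorm r f.1) :=
        (wnorm_mul_le _ _ _).trans (by gcongr; exact wnorm_cshift_le hr i f)
    _ = (wnorm r (q i j).1 * ((r : ℝ≥0∞) ^ K)⁻¹) * wnorm r f.1 := by ring
    _ ≤ _ := by
        gcongr
        exact Finset.single_le_sum (f := fun j => wnorm r (q i j).1 * ((r : ℝ≥0∞) ^ K)⁻¹)
          (fun _ _ => zero_le) (Finset.mem_univ j)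

theorem wnorm_iterQuot_le {r C : ℝ≥0}
    (hC : ∀ (j : Fin k) (f : ConvergentSeries N), wnorm r (quot q K j f).1 ≤ C * wnorm r f.1)
    (f : ConvergentSeries N) (n : ℕ) (w : Fin n → Fin k) :
    wnorm r (iterQuot q K f n w).1 ≤ (C : ℝ≥0∞) ^ n * wnorm r f.1 := by
  induction n with
  | zero => simp [iterQuot]
  | succ n ih =>
    rw [iterQuot, pow_succ', mul_assoc]
    exact (hC _ _).trans (by gcongr; exact ih _)

/-- The degree `n` part of the coefficient at `e` of the remainder. -/
def remainderPart (K : ℕ) (f : ConvergentSeries N) (e : Fin N →₀ ℕ) (n : ℕ) : ConvergentSeries k :=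
  ∑ w : Fin n → Fin k, coeff e (iterQuot q K f n w).1 • ∏ i, coord (w i)

/-- The degree `n` part of the coefficient at the error term with index `i`. -/
def errorPart (K : ℕ) (b : Fin k → ConvergentSeries N)
    (f : ConvergentSeries N) (i : Fin N) (n : ℕ) :
    ConvergentSeries N :=
  ∑ w : Fin n → Fin k, (∏ l, b (w l)) * cshift K i (iterQuot q K f n w)

theorem remainderPart_mem (f : ConvergentSeries N) (e : Fin N →₀ ℕ) (n : ℕ) :
    remainderPart q K f e n ∈ orderIdeal k n :=
  Ideal.sum_mem _ fun w _ => by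
    rw [Algebra.smul_def]
    exact Ideal.mul_mem_left _ _ (prod_mem_orderIdeal fun i => evalZero_coord _)

theorem errorPart_mem {b : Fin k → ConvergentSeries N} (hb : ∀ i, evalZero (b i) = 0)
    (f : ConvergentSeries N) (i : Fin N) (n : ℕ) :
    errorPart q K b f i n ∈ orderIdeal N n :=
  Ideal.sum_mem _ fun _ _ => Ideal.mul_mem_right _ _ (prod_mem_orderIdeal fun _ => hb _)

theorem wnorm_coord_le (r : ℝ≥0) (i : Fin N) : wnorm r (coord i).1 ≤ r := by
  classical
  change wnorm r (X i) ≤ r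
  unfold wnorm
  rw [tsum_eq_single (Finsupp.single i 1)]
  · simp [coeff_X]
  · intro d hd
    simp [coeff_X, hd]

theorem coe_prod_convergentSeries {n : ℕ} (g : Fin n → ConvergentSeries N) :
    (∏ i, g i).1 = ∏ i, (g i).1 := by
  exact map_prod (ConvergentSeries N).val g Finset.univ

theorem wnorm_prod_fin_le {n : ℕ} {r : ℝ≥0} {ρ : ℝ≥0∞} {g : Fin n → ConvergentSeries N}
    (hg : ∀ i, wnorm r (g i).1 ≤ ρ) : wnorm r (∏ i, g i).1 ≤ ρ ^ n := by
  rw [coe_prod_convergentSeries]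
  refine (wnorm_prod_le _ _ _).trans ?_
  calc _ ≤ ∏ _i : Fin n, ρ := Finset.prod_le_prod' fun i _ => hg i
    _ = ρ ^ n := by simp

theorem wnorm_smul_le (r : ℝ≥0) (c : ℂ) (f : MvPowerSeries (Fin N) ℂ) :
    wnorm r (c • f) ≤ ‖c‖ₑ * wnorm r f := by
  unfold wnorm
  rw [← ENNReal.tsum_mul_left]
  refine ENNReal.tsum_le_tsum fun d => ?_
  rw [map_smul, smul_eq_mul, enorm_mul, mul_assoc]

/-- There are `k ^ n` words; each contributes `C ^ n` from the iterated quotient and `ρ ^ n` from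
the monomial. For small `ρ` the bound decays geometrically. -/
theorem wnorm_remainderPart_le {r C ρ : ℝ≥0} (hr : 0 < r)
    (hC : ∀ (j : Fin k) (f : ConvergentSeries N), wnorm r (quot q K j f).1 ≤ C * wnorm r f.1)
    (f : ConvergentSeries N) (e : Fin N →₀ ℕ) (n : ℕ) :
    wnorm ρ (remainderPart q K f e n).1 ≤
      ((k * C * ρ : ℝ≥0) : ℝ≥0∞) ^ n * (wnorm r f.1 * ((r : ℝ≥0∞) ^ e.degree)⁻¹) := by
  have h0 : (r : ℝ≥0∞) ^ e.degree ≠ 0 := by positivity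
  rw [remainderPart, AddSubmonoidClass.coe_finsetSum]
  refine (wnorm_sum_le _ _ _).trans ?_
  calc _ ≤ ∑ _w : Fin n → Fin k,
        (C : ℝ≥0∞) ^ n * (wnorm r f.1 * ((r : ℝ≥0∞) ^ e.degree)⁻¹) * (ρ : ℝ≥0∞) ^ n := by
        refine Finset.sum_le_sum fun w _ => ?_
        rw [Subalgebra.coe_smul]
        refine (wnorm_smul_le _ _ _).trans ?_
        gcongr
        · rw [← mul_assoc, ← div_eq_mul_inv,
            ENNReal.le_div_iff_mul_le (Or.inl h0) (Or.inl (by finiteness))]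
          exact (enorm_coeff_mul_le_wnorm _ _ _).trans (wnorm_iterQuot_le q hC f n w)
        · exact wnorm_prod_fin_le fun i => wnorm_coord_le _ _
    _ = _ := by
        rw [Finset.sum_const, Finset.card_univ, Fintype.card_fun, Fintype.card_fin,
          Fintype.card_fin, nsmul_eq_mul]
        push_cast
        ring

theorem wnorm_errorPart_le {r s C ρ : ℝ≥0} (hr : 0 < r) (hs : s ≤ r)
    (hC : ∀ (j : Fin k) (f : ConvergentSeries N), wnorm r (quot q K j f).1 ≤ C * wnorm r f.1)
    {b : Fin k → ConvergentSeries N} (hb : ∀ i, wnorm s (b i).1 ≤ ρ)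
    (f : ConvergentSeries N) (i : Fin N) (n : ℕ) :
    wnorm s (errorPart q K b f i n).1 ≤
      ((k * C * ρ : ℝ≥0) : ℝ≥0∞) ^ n * (((r : ℝ≥0∞) ^ K)⁻¹ * wnorm r f.1) := by
  rw [errorPart, AddSubmonoidClass.coe_finsetSum]
  refine (wnorm_sum_le _ _ _).trans ?_
  calc _ ≤ ∑ _w : Fin n → Fin k, (ρ : ℝ≥0∞) ^ n *
        (((r : ℝ≥0∞) ^ K)⁻¹ * ((C : ℝ≥0∞) ^ n * wnorm r f.1)) := by
        refine Finset.sum_le_sum fun w _ => ?_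
        refine (wnorm_mul_le _ _ _).trans ?_
        gcongr
        · exact wnorm_prod_fin_le fun i => hb _
        · refine (wnorm_mono hs _).trans ((wnorm_cshift_le hr _ _).trans ?_)
          exact mul_le_mul_right (wnorm_iterQuot_le q hC f n w) _
    _ = _ := by
        rw [Finset.sum_const, Finset.card_univ, Fintype.card_fun, Fintype.card_fin,
          Fintype.card_fin, nsmul_eq_mul]
        push_cast
        ring

/-- One step replaces each iterated quotient by its box part plus the shifts, and rewrites each
`coord i ^ K` as a combination of the `b j` plus `c i`. The last sum is what remains undivided after
`m` steps; it has order at least `m`. -/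
theorem eq_sum_remainder_add_error {b : Fin k → ConvergentSeries N}
    (hb : ∀ i, evalZero (b i) = 0) {c : Fin N → ConvergentSeries N}
    (hq : ∀ i, coord i ^ K = ∑ j, b j * q i j + c i) (f : ConvergentSeries N) (m : ℕ) :
    f = ∑ n ∈ Finset.range m, (∑ e : Fin N → Fin K,
          csubst b hb (remainderPart q K f (boxExponent e) n) * cmonomial (boxExponent e) +
          ∑ i, c i * errorPart q K b f i n) +
        ∑ w : Fin m → Fin k, (∏ i, b (w i)) * iterQuot q K f m w := by
  induction m with
  | zero => simp [iterQuot]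
  | succ m ih =>
    conv_lhs => rw [ih]
    rw [Finset.sum_range_succ, add_assoc]
    congr 1
    rw [sum_prod_mul_iterQuot_succ]
    simp only [remainderPart, errorPart, map_sum, map_smul, map_prod, csubst_coord, Finset.sum_mul,
      Finset.mul_sum (s := (Finset.univ : Finset (Fin m → Fin k)))]
    rw [Finset.sum_comm, Finset.sum_comm (s := (Finset.univ : Finset (Fin N))),
      ← Finset.sum_add_distrib, ← Finset.sum_add_distrib]
    refine Finset.sum_congr rfl fun w _ => ?_
    conv_lhs => rw [eq_sum_box_add_sum_cshift K (iterQuot q K f m w)]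
    simp only [hq, quot, add_mul, Finset.sum_add_distrib, mul_add, Finset.mul_sum, Finset.sum_mul]
    rw [← add_assoc, add_right_comm]
    congr 1
    · congr 1
      · refine Finset.sum_congr rfl fun e _ => ?_
        simp only [Algebra.smul_def]
        ring
      · exact Finset.sum_congr rfl fun i _ => by ring
    · rw [Finset.sum_comm]
      exact Finset.sum_congr rfl fun i _ => Finset.sum_congr rfl fun j _ => by ring

/-- **Division theorem**: if a power of each coordinate lies in the ideal generated by the `b j`
modulo `I`, then the monomials of bounded degree generate `ℂ{x} / I` over the subring of
convergent power series in the `b j`. -/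
theorem exists_remainder {b : Fin k → ConvergentSeries N} (hb : ∀ i, evalZero (b i) = 0)
    {I : Ideal (ConvergentSeries N)}
    (hI : ∀ i, coord i ^ K ∈ Ideal.span (Set.range b) ⊔ I) (f : ConvergentSeries N) :
    ∃ A : (Fin N → Fin K) → ConvergentSeries k,
      f - ∑ e, csubst b hb (A e) * cmonomial (boxExponent e) ∈ I := by
  have hI' : ∀ i, ∃ (q : Fin k → ConvergentSeries N) (c : ConvergentSeries N),
      c ∈ I ∧ coord i ^ K = ∑ j, b j * q j + c := by
    intro i
    obtain ⟨g, hg, c, hc, h⟩ := Submodule.mem_sup.1 (hI i)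
    obtain ⟨q, hq⟩ := (Ideal.mem_span_range_iff_exists_fun).1 hg
    refine ⟨q, c, hc, ?_⟩
    rw [← h, ← hq]
    simp only [mul_comm]
  choose q c hc hq using hI'
  obtain ⟨r₁, hr₁, h₁⟩ := HasRadius.exists_forall_wnorm_ne_top
    (f := fun p : Fin N × Fin k => (q p.1 p.2).1) fun p => hasRadius_coe _
  obtain ⟨r₂, hr₂, h₂⟩ := hasRadius_coe f
  set r := min r₁ r₂
  have hr : 0 < r := lt_min hr₁ hr₂
  have hf : wnorm r f.1 ≠ ⊤ := ne_top_of_le_ne_top h₂ (wnorm_mono (min_le_right _ _) _)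
  obtain ⟨C, hC⟩ := exists_wnorm_quot_le (K := K) q hr fun i j => h₁ r (min_le_left _ _) (i, j)
  -- Chosen to make `k * C * ρ < 1`, the ratio of the geometric majorants for remainders and errors.
  set ρ : ℝ≥0 := 1 / (2 * (k * C + 1))
  have hρ : 0 < ρ := by positivity
  have hx : ((k * C * ρ : ℝ≥0) : ℝ≥0∞) < 1 := by
    rw [← ENNReal.coe_one, ENNReal.coe_lt_coe]
    change k * C * (1 / (2 * (k * C + 1))) < 1
    rw [mul_one_div, div_lt_one (by positivity)]
    calc (k * C : ℝ≥0) < k * C + 1 := lt_add_one _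
      _ ≤ 2 * (k * C + 1) := le_mul_of_one_le_left (by positivity) one_le_two
  obtain ⟨s₀, hs₀, hs⟩ := HasRadius.exists_forall_wnorm_le
    (f := fun i => (b i).1) (fun i => hasRadius_coe _) hb hρ
  have hD : ∀ i, HasRadius (formalSum fun n => (errorPart q K b f i n).1) := fun i =>
    ⟨min s₀ r, lt_min hs₀ hr, wnorm_formalSum_ne_top hx
      (ENNReal.mul_ne_top (ENNReal.inv_ne_top.2 (by positivity)) hf)
      (wnorm_errorPart_le q hr (min_le_right _ _) hC (hs _ (min_le_left _ _)) f i)⟩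
  have hA : ∀ e : Fin N → Fin K,
      HasRadius (formalSum fun n => (remainderPart q K f (boxExponent e) n).1) := fun e =>
    ⟨ρ, hρ, wnorm_formalSum_ne_top hx
      (ENNReal.mul_ne_top hf (ENNReal.inv_ne_top.2 (by positivity)))
      (wnorm_remainderPart_le q hr hC f _)⟩
  let A : (Fin N → Fin K) → ConvergentSeries k := fun e =>
    ⟨_, (isConvergent_iff_hasRadius _).2 (hA e)⟩
  let D : Fin N → ConvergentSeries N := fun i => ⟨_, (isConvergent_iff_hasRadius _).2 (hD i)⟩
  refine ⟨A, ?_⟩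
  suffices h : f - ∑ e, csubst b hb (A e) * cmonomial (boxExponent e) - ∑ i, c i * D i = 0 by
    rw [sub_eq_zero] at h
    rw [h]
    exact Ideal.sum_mem _ fun i _ => Ideal.mul_mem_right _ _ (hc i)
  -- Modulo order `m`, the formal sums may be replaced by partial sums and the finite identity
  -- applies.
  refine eq_zero_of_forall_mem_orderIdeal fun m => ?_
  have hAm : ∀ e, A e - ∑ n ∈ Finset.range m, remainderPart q K f (boxExponent e) n ∈
      orderIdeal k m := fun e => by
    rw [mem_orderIdeal, Subalgebra.coe_sub, AddSubmonoidClass.coe_finsetSum]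
    exact le_order_formalSum_sub (fun n => remainderPart_mem q f _ n) m
  have hDm : ∀ i, D i - ∑ n ∈ Finset.range m, errorPart q K b f i n ∈ orderIdeal N m :=
    fun i => by
    rw [mem_orderIdeal, Subalgebra.coe_sub, AddSubmonoidClass.coe_finsetSum]
    exact le_order_formalSum_sub (fun n => errorPart_mem q hb f _ n) m
  have hfm := eq_sum_remainder_add_error q hb hq f m
  have key : f - ∑ e, csubst b hb (A e) * cmonomial (boxExponent e) - ∑ i, c i * D i =
      (∑ w : Fin m → Fin k, (∏ i, b (w i)) * iterQuot q K f m w)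
      - ∑ e, csubst b hb (A e - ∑ n ∈ Finset.range m, remainderPart q K f (boxExponent e) n) *
          cmonomial (boxExponent e)
      - ∑ i, c i * (D i - ∑ n ∈ Finset.range m, errorPart q K b f i n) := by
    conv_lhs => rw [hfm]
    simp only [map_sub, map_sum, sub_mul, mul_sub, Finset.sum_sub_distrib, Finset.sum_add_distrib,
      Finset.sum_mul, Finset.mul_sum]
    rw [Finset.sum_comm, Finset.sum_comm (s := Finset.range m)]
    ring
  rw [key]
  refine Ideal.sub_mem _ (Ideal.sub_mem _ (Ideal.sum_mem _ fun w _ => ?_)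
    (Ideal.sum_mem _ fun e _ => ?_)) (Ideal.sum_mem _ fun i _ => ?_)
  · exact Ideal.mul_mem_right _ _ (prod_mem_orderIdeal fun i => hb _)
  · exact Ideal.mul_mem_right _ _ (csubst_mem_orderIdeal b hb (hAm e))
  · exact Ideal.mul_mem_left _ _ (hDm i)

end Division

end

end CurveGerm

/-! ### Analytic local algebras: evaluation, finiteness, systems of parameters. -/

namespace CurveGerm

noncomputable section

open MvPowerSeries IsLocalRing

section Analytic

/-- A `ℂ`-algebra is analytic if it is a quotient of a ring of convergent power series. -/
def IsAnalytic (O : Type*) [CommRing O] [Algebra ℂ O] : Prop :=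
  ∃ (N : ℕ) (π : ConvergentSeries N →ₐ[ℂ] O), Function.Surjective π

theorem map_maximalIdeal_eq_span {N : ℕ} {O : Type*} [CommRing O] [Algebra ℂ O]
    (φ : ConvergentSeries N →ₐ[ℂ] O) :
    (maximalIdeal (ConvergentSeries N)).map φ = Ideal.span (Set.range fun i => φ (coord i)) := by
  rw [maximalIdeal_eq_span, Ideal.map_span, ← Set.range_comp]
  rfl

variable {N k : ℕ} {O : Type*} [CommRing O] [IsLocalRing O] [Algebra ℂ O]

/-- If `π f` had inverse `π g`, the unit `1 - f * g` would map to `0`. -/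
theorem map_mem_maximalIdeal_of_surjective {π : ConvergentSeries N →ₐ[ℂ] O}
    (hπ : Function.Surjective π) {f : ConvergentSeries N} (hf : evalZero f = 0) :
    π f ∈ maximalIdeal O := by
  intro hu
  obtain ⟨y, hy⟩ := hu.exists_right_inv
  obtain ⟨g, rfl⟩ := hπ y
  have h1 : IsUnit (1 - f * g) := isUnit_one_sub (by simp [hf])
  have h2 := h1.map π
  rw [map_sub, map_one, map_mul, hy, sub_self] at h2
  exact not_isUnit_zero h2

theorem IsAnalytic.exists_sub_mem (hO : IsAnalytic O) (x : O) :
    ∃ c : ℂ, x - algebraMap ℂ O c ∈ maximalIdeal O := by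
  obtain ⟨N, π, hπ⟩ := hO
  obtain ⟨f, rfl⟩ := hπ x
  refine ⟨evalZero f, ?_⟩
  rw [← π.commutes, ← map_sub]
  exact map_mem_maximalIdeal_of_surjective hπ (by simp)

/-- Locality is automatic, without surjectivity of `φ`: if `φ f` had residue `c ≠ 0`, then `f - c`
would be a unit with image in the maximal ideal. -/
theorem IsAnalytic.map_mem_maximalIdeal_iff (hO : IsAnalytic O) {φ : ConvergentSeries N →ₐ[ℂ] O}
    {f : ConvergentSeries N} : φ f ∈ maximalIdeal O ↔ evalZero f = 0 := by
  refine ⟨fun h => ?_, fun h => ?_⟩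
  · by_contra h'
    exact h ((isUnit_iff.2 h').map φ)
  · obtain ⟨c, hc⟩ := hO.exists_sub_mem (φ f)
    rcases eq_or_ne c 0 with rfl | hc0
    · simpa using hc
    · have h2 : IsUnit (f - algebraMap ℂ _ c) := isUnit_iff.2 (by simp [h, hc0])
      have h3 := h2.map φ
      rw [map_sub, AlgHom.commutes] at h3
      exact absurd h3 hc

theorem IsAnalytic.map_coord_mem (hO : IsAnalytic O) (φ : ConvergentSeries N →ₐ[ℂ] O)
    (i : Fin N) : φ (coord i) ∈ maximalIdeal O :=
  hO.map_mem_maximalIdeal_iff.2 (evalZero_coord i)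

theorem maximalIdeal_eq_map_of_surjective {π : ConvergentSeries N →ₐ[ℂ] O}
    (hπ : Function.Surjective π) :
    maximalIdeal O = (maximalIdeal (ConvergentSeries N)).map π := by
  apply le_antisymm
  · intro x hx
    obtain ⟨f, rfl⟩ := hπ x
    exact Ideal.mem_map_of_mem _
      (mem_maximalIdeal_iff.2 ((IsAnalytic.map_mem_maximalIdeal_iff ⟨N, π, hπ⟩).1 hx))
  · rw [Ideal.map_le_iff_le_comap]
    intro f hf
    exact map_mem_maximalIdeal_of_surjective hπ (mem_maximalIdeal_iff.1 hf)

/-- Evaluation of convergent power series at elements of the maximal ideal of an analytic algebra,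
and finiteness of the resulting homomorphism if these elements generate a primary ideal. -/
theorem IsAnalytic.exists_algHom (hO : IsAnalytic O) (a : Fin k → O)
    (ha : ∀ i, a i ∈ maximalIdeal O) :
    ∃ φ : ConvergentSeries k →ₐ[ℂ] O, (∀ i, φ (coord i) = a i) ∧
      ((∃ K, maximalIdeal O ^ K ≤ Ideal.span (Set.range a)) → φ.toRingHom.Finite) := by
  obtain ⟨N, π, hπ⟩ := hO
  choose b hb using fun i => hπ (a i)
  have hb0 : ∀ i, evalZero (b i) = 0 := fun i =>
    (IsAnalytic.map_mem_maximalIdeal_iff ⟨N, π, hπ⟩).1 (by rw [hb]; exact ha i)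
  refine ⟨π.comp (csubst b hb0), fun i => by simp [hb], ?_⟩
  rintro ⟨K, hK⟩
  -- The primary condition, lifted along `π`, is the hypothesis of the division theorem with error
  -- ideal `ker π`.
  have hI : ∀ i, coord i ^ K ∈ Ideal.span (Set.range b) ⊔ RingHom.ker π := by
    intro i
    have h1 : π (coord i ^ K) ∈ (Ideal.span (Set.range b)).map π := by
      rw [Ideal.map_span, ← Set.range_comp]
      have : π ∘ b = a := funext hb
      rw [this, map_pow]
      exact hK (Ideal.pow_mem_pow (IsAnalytic.map_coord_mem ⟨N, π, hπ⟩ π i) K)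
    obtain ⟨g, hg, h2⟩ := (Ideal.mem_map_iff_of_surjective π hπ).1 h1
    rw [← sub_add_cancel (coord i ^ K) g, add_comm]
    refine Submodule.add_mem_sup hg ?_
    rw [RingHom.mem_ker, map_sub, h2, sub_self]
  let := (π.comp (csubst b hb0)).toRingHom.toAlgebra
  change Module.Finite (ConvergentSeries k) O
  refine ⟨(Submodule.fg_def).2 ⟨Set.range fun e : Fin N → Fin K => π (cmonomial (boxExponent e)),
    Set.finite_range _, ?_⟩⟩
  rw [eq_top_iff]
  rintro x -
  obtain ⟨f, rfl⟩ := hπ x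
  obtain ⟨A, hA⟩ := exists_remainder hb0 hI f
  rw [RingHom.mem_ker, map_sub, sub_eq_zero] at hA
  rw [hA, map_sum]
  refine Submodule.sum_mem _ fun e _ => ?_
  have : π (csubst b hb0 (A e) * cmonomial (boxExponent e)) =
      A e • π (cmonomial (boxExponent e)) := by
    rw [map_mul, Algebra.smul_def]
    rfl
  rw [this]
  exact Submodule.smul_mem _ _ (Submodule.subset_span ⟨e, rfl⟩)

theorem exists_aeval_sub_mem (f : ConvergentSeries N) (m : ℕ) :
    ∃ p : MvPolynomial (Fin N) ℂ,
      f - MvPolynomial.aeval coord p ∈ maximalIdeal (ConvergentSeries N) ^ m := by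
  induction m generalizing f with
  | zero => exact ⟨0, by simp⟩
  | succ m ih =>
    choose p hp using fun i => ih (cshift 1 i f)
    refine ⟨MvPolynomial.C (evalZero f) + ∑ i, MvPolynomial.X i * p i, ?_⟩
    have h := eq_algebraMap_add_sum_coord_mul f
    have h2 : f - MvPolynomial.aeval coord (MvPolynomial.C (evalZero f) +
        ∑ i, MvPolynomial.X i * p i) =
        ∑ i, coord i * (cshift 1 i f - MvPolynomial.aeval coord (p i)) := by
      conv_lhs => rw [h]
      simp [mul_sub, Finset.sum_sub_distrib]
    rw [h2, pow_succ']
    exact Ideal.sum_mem _ fun i _ => Ideal.mul_mem_mul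
      (mem_maximalIdeal_iff.2 (evalZero_coord i)) (hp i)

/-- Homomorphisms from a ring of convergent power series are determined by the images of the
coordinates. -/
theorem IsAnalytic.algHom_ext [IsNoetherianRing O] (hO : IsAnalytic O)
    {φ ψ : ConvergentSeries N →ₐ[ℂ] O} (h : ∀ i, φ (coord i) = ψ (coord i)) : φ = ψ := by
  ext f
  rw [← sub_eq_zero, ← Ideal.mem_bot,
    ← Ideal.iInf_pow_eq_bot_of_isLocalRing (maximalIdeal O) Ideal.IsPrime.ne_top', Ideal.mem_iInf]
  -- By Krull's intersection theorem it is enough to work modulo each power of the maximal ideal,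
  -- where `f` is a polynomial in the coordinates.
  intro m
  obtain ⟨p, hp⟩ := exists_aeval_sub_mem f m
  have key : ∀ χ : ConvergentSeries N →ₐ[ℂ] O,
      χ f - MvPolynomial.aeval (fun i => χ (coord i)) p ∈ maximalIdeal O ^ m := by
    intro χ
    have h1 : (maximalIdeal (ConvergentSeries N)).map χ ≤ maximalIdeal O := by
      rw [map_maximalIdeal_eq_span, Ideal.span_le]
      rintro _ ⟨i, rfl⟩
      exact hO.map_coord_mem χ i
    have h2 := Ideal.mem_map_of_mem χ hp
    rw [Ideal.map_pow, map_sub] at h2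
    have h3 := Ideal.pow_right_mono h1 m h2
    have h4 : χ (MvPolynomial.aeval coord p) = MvPolynomial.aeval (fun i => χ (coord i)) p := by
      rw [← AlgHom.comp_apply, MvPolynomial.comp_aeval]
    rwa [h4] at h3
  have := Ideal.sub_mem _ (key φ) (key ψ)
  simpa [h] using this

end Analytic

section LinearForms

variable {n d : ℕ}

theorem orderIdeal_le (N m : ℕ) : orderIdeal N m ≤ maximalIdeal (ConvergentSeries N) ^ m := by
  induction m with
  | zero => simp
  | succ m ih =>
    intro f hf
    have h0 : evalZero f = 0 := by
      refine one_le_order_iff_constCoeff_eq_zero.1 (le_trans ?_ (mem_orderIdeal.1 hf))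
      exact_mod_cast Nat.succ_pos m
    rw [eq_algebraMap_add_sum_coord_mul f, h0, map_zero, zero_add, pow_succ']
    refine Ideal.sum_mem _ fun i _ => Ideal.mul_mem_mul
      (mem_maximalIdeal_iff.2 (evalZero_coord i)) (ih ?_)
    refine nat_le_order fun d hd => ?_
    change coeff d (shift 1 i f.1) = 0
    rw [coeff_shift]
    split_ifs
    · refine coeff_of_lt_order (lt_of_lt_of_le ?_ (mem_orderIdeal.1 hf))
      rw [map_add, Finsupp.degree_single]
      exact_mod_cast Nat.succ_lt_succ hd
    · rfl

theorem sup_pow_le {R : Type*} [CommRing R] (I J : Ideal R) (m : ℕ) :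
    (I ⊔ J) ^ m ≤ I ⊔ J ^ m := by
  induction m with
  | zero => simp
  | succ m ih =>
    rw [pow_succ, pow_succ]
    refine (Ideal.mul_mono_left ih).trans ?_
    rw [Ideal.sup_mul, Ideal.mul_sup (J ^ m)]
    have h1 : I * (I ⊔ J) ≤ I := Ideal.mul_le_left
    have h2 : J ^ m * I ≤ I := Ideal.mul_le_right
    exact sup_le (h1.trans le_sup_left) (sup_le_sup_right h2 _)

/-- A convergent power series vanishing at the origin, together with suitable linear forms, one
less than the number of variables, generates a primary ideal. -/
theorem exists_linearForms {g : ConvergentSeries (n + 1)} (hg : g ≠ 0) (hg0 : evalZero g = 0) :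
    ∃ l : Fin n → ConvergentSeries (n + 1), (∀ j, evalZero (l j) = 0) ∧
      ∃ K, maximalIdeal (ConvergentSeries (n + 1)) ^ K ≤
        Ideal.span (Set.range l) ⊔ Ideal.span {g} := by
  classical
  have hg' : g.1 ≠ 0 := fun h => hg (Subtype.ext h)
  obtain ⟨K, hK⟩ := ENat.ne_top_iff_exists.1 (mt order_eq_top_iff.1 hg')
  have hK1 : 1 ≤ K := by
    have := one_le_order_iff_constCoeff_eq_zero.2 hg0
    rw [← hK] at this
    exact_mod_cast this
  let S : Finset (Fin (n + 1) →₀ ℕ) := Finset.finsuppAntidiag Finset.univ K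
  have hS : ∀ e, e ∈ S ↔ e.degree = K := by
    intro e
    simp [S, Finset.mem_finsuppAntidiag, Finsupp.degree_eq_sum]
  -- The initial form of `g`. A point `c` with `F(c) ≠ 0` gives a line not tangent to `g = 0`.
  let F : MvPolynomial (Fin (n + 1)) ℂ := ∑ e ∈ S, MvPolynomial.monomial e (coeff e g.1)
  have hFc : ∀ e, F.coeff e = if e.degree = K then coeff e g.1 else 0 := by
    intro e
    simp only [F, MvPolynomial.coeff_sum, MvPolynomial.coeff_monomial]
    rw [Finset.sum_ite_eq' S e]
    simp only [hS]
  have hF0 : F ≠ 0 := by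
    obtain ⟨e, he, he'⟩ := exists_coeff_ne_zero_and_order (f := g.1) (by rw [← hK]; rfl)
    rw [← hK] at he'
    have he'' : e.degree = K := by exact_mod_cast he'
    intro h
    have := hFc e
    rw [h, if_pos he''] at this
    exact he this.symm
  obtain ⟨c, hc⟩ : ∃ c, MvPolynomial.eval c F ≠ 0 := by
    by_contra! h
    exact hF0 (MvPolynomial.funext fun c => by simp [h])
  obtain ⟨i₀, hi₀⟩ : ∃ i, c i ≠ 0 := by
    by_contra! h
    apply hc
    have hc0 : c = 0 := funext h
    rw [hc0]
    change MvPolynomial.eval (0 : Fin (n + 1) → ℂ) F = 0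
    rw [MvPolynomial.eval_zero, MvPolynomial.constantCoeff_eq, hFc, if_neg]
    simp only [map_zero]
    omega
  -- The forms `l j` cut out the line `ℂ c`, and `s` is the coordinate on it with value `1` at `c`;
  -- modulo the `l j`, each `coord i` becomes `c i • s`.
  let s : ConvergentSeries (n + 1) := (c i₀)⁻¹ • coord i₀
  let l : Fin n → ConvergentSeries (n + 1) := fun j =>
    coord (i₀.succAbove j) - c (i₀.succAbove j) • s
  have hl : ∀ i, coord i - c i • s ∈ Ideal.span (Set.range l) := by
    intro i
    rcases Fin.eq_self_or_eq_succAbove i₀ i with rfl | ⟨j, rfl⟩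
    · simp [s, smul_smul, hi₀]
    · exact Ideal.subset_span ⟨j, rfl⟩
  refine ⟨l, fun j => by simp [l, s], K, ?_⟩
  set J := Ideal.span (Set.range l)
  have hm : maximalIdeal (ConvergentSeries (n + 1)) ≤ J ⊔ Ideal.span {s} := by
    rw [maximalIdeal_eq_span, Ideal.span_le]
    rintro _ ⟨i, rfl⟩
    rw [← sub_add_cancel (coord i) (c i • s)]
    refine Submodule.add_mem_sup (hl i) ?_
    rw [Algebra.smul_def]
    exact Ideal.mul_mem_left _ _ (Ideal.mem_span_singleton_self s)
  have h1 : g - MvPolynomial.aeval coord F ∈ maximalIdeal (ConvergentSeries (n + 1)) ^ (K + 1) := by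
    refine orderIdeal_le _ _ (nat_le_order fun e he => ?_)
    have h2 : (MvPolynomial.aeval coord F : ConvergentSeries (n + 1)).1 = F := by
      change (ConvergentSeries (n + 1)).val (MvPolynomial.aeval coord F) = F
      rw [← AlgHom.comp_apply, MvPolynomial.comp_aeval]
      change MvPolynomial.aeval (fun i => X i) F = MvPolynomial.coeToMvPowerSeries.algHom ℂ F
      congr 1
      refine MvPolynomial.algHom_ext fun i => ?_
      simp
    rw [Subalgebra.coe_sub, h2, map_sub, MvPolynomial.coeff_coe, hFc]
    split_ifs with h3
    · simp
    · rw [sub_zero]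
      refine coeff_of_lt_order ?_
      rw [← hK]
      exact_mod_cast (by omega : e.degree < K)
  have h2 : MvPolynomial.aeval coord F - MvPolynomial.eval c F • s ^ K ∈ J := by
    rw [← Ideal.Quotient.eq]
    have h3 : ∀ i, Ideal.Quotient.mkₐ ℂ J (coord i) = Ideal.Quotient.mkₐ ℂ J (c i • s) :=
      fun i => Ideal.Quotient.eq.2 (hl i)
    have h4 : MvPolynomial.aeval (fun i => c i • s) F = MvPolynomial.eval c F • s ^ K := by
      simp only [F, map_sum, MvPolynomial.aeval_monomial, MvPolynomial.eval_monomial,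
        Finset.sum_smul]
      refine Finset.sum_congr rfl fun e he => ?_
      have : (e.prod fun i k => (c i • s) ^ k) = (e.prod fun i k => c i ^ k) • s ^ K := by
        simp only [Finsupp.prod, smul_pow, Finset.prod_smul, Finset.prod_pow_eq_pow_sum]
        rw [← (hS e).1 he, Finsupp.degree_apply]
      rw [this, mul_smul, Algebra.smul_def (coeff e g.1)]
    rw [← h4]
    change Ideal.Quotient.mkₐ ℂ J _ = Ideal.Quotient.mkₐ ℂ J _
    rw [← AlgHom.comp_apply, ← AlgHom.comp_apply]
    congr 1
    refine MvPolynomial.algHom_ext fun i => ?_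
    rw [AlgHom.comp_apply, AlgHom.comp_apply, MvPolynomial.aeval_X, MvPolynomial.aeval_X, h3]
  -- Nakayama: modulo the forms, `g ≡ F(c) s ^ K` up to order `K + 1`, so the inclusion need only
  -- hold modulo the next power of the maximal ideal.
  refine Submodule.le_of_le_smul_of_le_jacobson_bot
    (I := maximalIdeal (ConvergentSeries (n + 1)))
    ?_ (maximalIdeal_le_jacobson _) ?_
  · refine Ideal.FG.pow ?_
    rw [maximalIdeal_eq_span]
    exact Submodule.fg_span (Set.finite_range _)
  · rw [smul_eq_mul, ← pow_succ']
    refine ((Ideal.pow_right_mono hm K).trans (sup_pow_le _ _ _)).trans (sup_le ?_ ?_)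
    · exact le_sup_left.trans le_sup_left
    · rw [Ideal.span_singleton_pow, Ideal.span_singleton_le_iff_mem]
      have h5 : MvPolynomial.eval c F • s ^ K ∈ J ⊔ Ideal.span {g} ⊔
          maximalIdeal (ConvergentSeries (n + 1)) ^ (K + 1) := by
        have : MvPolynomial.eval c F • s ^ K =
            (-(MvPolynomial.aeval coord F - MvPolynomial.eval c F • s ^ K) + g) +
              -(g - MvPolynomial.aeval coord F) := by ring
        rw [this]
        exact Submodule.add_mem_sup (Submodule.add_mem_sup (neg_mem h2)
          (Ideal.mem_span_singleton_self g)) (neg_mem h1)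
      have h6 : s ^ K = algebraMap ℂ _ (MvPolynomial.eval c F)⁻¹ *
          (MvPolynomial.eval c F • s ^ K) := by
        rw [← Algebra.smul_def, smul_smul, inv_mul_cancel₀ hc, one_smul]
      rw [h6]
      exact Ideal.mul_mem_left _ _ h5

/-- An analytic local ring of dimension one has a one-element system of parameters. -/
theorem IsAnalytic.exists_parameter {O : Type*} [CommRing O] [IsLocalRing O] [Algebra ℂ O]
    (hO : IsAnalytic O) (hdim : ringKrullDim O ≤ 1) :
    ∃ x ∈ maximalIdeal O, ∃ K, maximalIdeal O ^ K ≤ Ideal.span {x} := by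
  classical
  have hex : ∃ d, ∃ a : Fin d → O, (∀ i, a i ∈ maximalIdeal O) ∧
      ∃ K, maximalIdeal O ^ K ≤ Ideal.span (Set.range a) := by
    obtain ⟨N, π, hπ⟩ := hO
    refine ⟨N, fun i => π (coord i), IsAnalytic.map_coord_mem ⟨N, π, hπ⟩ π, 1, ?_⟩
    rw [pow_one, maximalIdeal_eq_map_of_surjective hπ, map_maximalIdeal_eq_span]
  -- As long as at least two elements generate a primary ideal, their number can be lowered by one.
  have hd1 : ∀ d, (∃ a : Fin d → O, (∀ i, a i ∈ maximalIdeal O) ∧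
      ∃ K, maximalIdeal O ^ K ≤ Ideal.span (Set.range a)) → 2 ≤ d → ∃ d' < d,
      ∃ a : Fin d' → O, (∀ i, a i ∈ maximalIdeal O) ∧
      ∃ K, maximalIdeal O ^ K ≤ Ideal.span (Set.range a) := by
    rintro d ⟨a, ha, K, hK⟩ hd
    obtain ⟨n, rfl⟩ : ∃ n, d = n + 2 := ⟨d - 2, by omega⟩
    obtain ⟨φ, hφ, hfin⟩ := hO.exists_algHom a ha
    have hspan : Ideal.span (Set.range a) = (maximalIdeal (ConvergentSeries (n + 2))).map φ := by
      rw [map_maximalIdeal_eq_span]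
      simp only [hφ]
    have hint := (hfin ⟨K, hK⟩).to_isIntegral
    by_cases hinj : Function.Injective φ
    -- With no relation between the parameters, `ℂ{x₁, …, x_(n+2)} ⊆ O` is integral. By going up,
    -- every prime containing `coord 0` lies under a non-minimal, hence maximal, prime of `O`. So
    -- `coord 0` would lie in no prime but the maximal ideal, making a power of `coord 1` divisible
    -- by `coord 0`.
    · exfalso
      let := φ.toRingHom.toAlgebra
      have : Algebra.IsIntegral (ConvergentSeries (n + 2)) O := ⟨hint⟩
      have hinj' : Function.Injective (algebraMap (ConvergentSeries (n + 2)) O) := hinj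
      have : Ring.KrullDimLE 1 O := (Order.krullDimLE_iff 1 (PrimeSpectrum O)).2 hdim
      have hmax : ∀ P : Ideal (ConvergentSeries (n + 2)), P.IsPrime → coord 0 ∈ P →
          P = maximalIdeal _ := by
        intro P hP hP0
        obtain ⟨Q₀, -, hQ₀p, hQ₀⟩ := Ideal.exists_ideal_over_prime_of_isIntegral
          (⊥ : Ideal (ConvergentSeries (n + 2))) (⊥ : Ideal O)
          (by rw [← RingHom.ker_eq_comap_bot, (RingHom.injective_iff_ker_eq_bot _).1 hinj'])
        obtain ⟨Q₁, hQ₁, hQ₁p, hQ₁c⟩ := Ideal.exists_ideal_over_prime_of_isIntegral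
          P Q₀ (by rw [hQ₀]; exact bot_le)
        have hne : Q₁ ∉ minimalPrimes O := by
          intro hmin
          have h1 : Q₁ ≤ Q₀ := hmin.2 ⟨hQ₀p, bot_le⟩ hQ₁
          have h2 : P ≤ ⊥ := by
            rw [← hQ₁c, ← hQ₀]
            exact Ideal.comap_mono h1
          have h3 : (coord 0 : ConvergentSeries (n + 2)) = 0 := h2 hP0
          have h4 := congrArg (fun f => coeff (Finsupp.single 0 1) f.1) h3
          change coeff _ (X 0) = coeff _ 0 at h4
          rw [coeff_X, if_pos rfl, map_zero] at h4
          exact one_ne_zero h4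
        have hQm : Q₁.IsMaximal :=
          (Ring.krullDimLE_one_iff.1 this Q₁ hQ₁p).resolve_left hne
        have := Ideal.isMaximal_comap_of_isIntegral_of_isMaximal
          (R := ConvergentSeries (n + 2)) Q₁
        rw [hQ₁c] at this
        exact IsLocalRing.eq_maximalIdeal this
      have hrad : (coord 1 : ConvergentSeries (n + 2)) ∈ (Ideal.span {coord 0}).radical := by
        rw [Ideal.radical_eq_sInf, Ideal.mem_sInf]
        rintro P ⟨hP0, hP⟩
        rw [hmax P hP (hP0 (Ideal.mem_span_singleton_self _))]
        exact mem_maximalIdeal_iff.2 (evalZero_coord 1)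
      obtain ⟨m, hm⟩ := hrad
      rw [Ideal.mem_span_singleton, coord_dvd_iff] at hm
      have := hm (Finsupp.single 1 m) (by simp)
      change coeff _ ((X 1 : MvPowerSeries (Fin (n + 2)) ℂ) ^ m) = 0 at this
      rw [coeff_X_pow, if_pos rfl] at this
      exact one_ne_zero this
    · rw [injective_iff_map_eq_zero] at hinj
      push Not at hinj
      obtain ⟨g, hg, hg0⟩ := hinj
      have hge : evalZero g = 0 := hO.map_mem_maximalIdeal_iff.1 (by rw [hg]; exact zero_mem _)
      -- A relation `g` between the parameters maps to `0`, so the linear forms that complement `g`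
      -- already generate a primary ideal in `O`.
      obtain ⟨l, hl, K', hK'⟩ := exists_linearForms hg0 hge
      refine ⟨n + 1, by omega, fun j => φ (l j), fun j => hO.map_mem_maximalIdeal_iff.2 (hl j),
        K * K', ?_⟩
      calc maximalIdeal O ^ (K * K') = (maximalIdeal O ^ K) ^ K' := pow_mul _ _ _
        _ ≤ (Ideal.span (Set.range a)) ^ K' := Ideal.pow_right_mono hK _
        _ = ((maximalIdeal (ConvergentSeries (n + 2))) ^ K').map φ := by
          rw [hspan, Ideal.map_pow]
        _ ≤ (Ideal.span (Set.range l) ⊔ Ideal.span {g}).map φ := Ideal.map_mono hK'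
        _ ≤ _ := by
          rw [Ideal.map_sup, Ideal.map_span, Ideal.map_span, Set.image_singleton, hg,
            ← Set.range_comp]
          simp [Function.comp_def]
  have hmin : ∃ d ≤ 1, ∃ a : Fin d → O, (∀ i, a i ∈ maximalIdeal O) ∧
      ∃ K, maximalIdeal O ^ K ≤ Ideal.span (Set.range a) := by
    refine ⟨Nat.find hex, ?_, Nat.find_spec hex⟩
    by_contra h
    obtain ⟨d', hd', h'⟩ := hd1 _ (Nat.find_spec hex) (by omega)
    exact Nat.find_min hex hd' h'
  obtain ⟨d, hd, a, ha, K, hK⟩ := hmin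
  interval_cases d
  -- No generators at all: the zero ideal is primary and `0` serves as the parameter.
  · refine ⟨0, zero_mem _, K, hK.trans ?_⟩
    simp
  · refine ⟨a 0, ha 0, K, hK.trans (Ideal.span_mono ?_)⟩
    rintro _ ⟨i, rfl⟩
    rw [Subsingleton.elim i 0]
    rfl

end LinearForms

end

end CurveGerm

/-! ### The discrete valuation ring `ℂ{t}` and codimension counts. -/

namespace CurveGerm

noncomputable section

open MvPowerSeries IsLocalRing

section DVR

theorem span_coord_eq_maximalIdeal :
    maximalIdeal (ConvergentSeries 1) = Ideal.span {coord 0} := by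
  rw [maximalIdeal_eq_span]
  congr 1
  ext f
  simp [Unique.exists_iff, eq_comm]

theorem coord_ne_zero {N : ℕ} (i : Fin N) : (coord i : ConvergentSeries N) ≠ 0 := by
  intro h
  have h4 := congrArg (fun f => coeff (Finsupp.single i 1) f.1) h
  change coeff _ (X i) = coeff _ 0 at h4
  rw [coeff_X, if_pos rfl, map_zero] at h4
  exact one_ne_zero h4

theorem irreducible_coord : Irreducible (coord 0 : ConvergentSeries 1) :=
  IsDiscreteValuationRing.irreducible_of_span_eq_maximalIdeal _ (coord_ne_zero 0)
    span_coord_eq_maximalIdeal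

/-- The exponent is the order of `f`; a cofactor vanishing at the origin would raise that order. -/
theorem exists_eq_coord_pow_mul_unit {f : ConvergentSeries 1} (hf : f ≠ 0) :
    ∃ (n : ℕ) (u : ConvergentSeries 1), IsUnit u ∧ f = coord 0 ^ n * u := by
  have hf' : f.1 ≠ 0 := fun h => hf (Subtype.ext h)
  obtain ⟨K, hK⟩ := ENat.ne_top_iff_exists.1 (mt order_eq_top_iff.1 hf')
  have h1 : f ∈ orderIdeal 1 K := mem_orderIdeal.2 hK.le
  have h2 := orderIdeal_le _ _ h1
  rw [span_coord_eq_maximalIdeal, Ideal.span_singleton_pow, Ideal.mem_span_singleton] at h2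
  obtain ⟨u, rfl⟩ := h2
  refine ⟨K, u, ?_, rfl⟩
  rw [isUnit_iff]
  intro hu
  have h3 : coord 0 ^ K * u ∈ orderIdeal 1 (K + 1) := by
    rw [mem_orderIdeal]
    refine le_trans ?_ (le_order_mul (f := (coord 0 ^ K : ConvergentSeries 1).1))
    push_cast
    refine add_le_add ?_ (one_le_order_iff_constCoeff_eq_zero.2 hu)
    exact le_order_pow_of_constantCoeff_eq_zero K (evalZero_coord 0)
  rw [mem_orderIdeal, ← hK] at h3
  exact absurd h3 (by exact_mod_cast Nat.not_succ_le_self K)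

instance : IsDiscreteValuationRing (ConvergentSeries 1) := by
  refine IsDiscreteValuationRing.ofHasUnitMulPowIrreducibleFactorization
    ⟨coord 0, irreducible_coord, fun {f} hf => ?_⟩
  obtain ⟨n, u, hu, rfl⟩ := exists_eq_coord_pow_mul_unit hf
  exact ⟨n, hu.unit, rfl⟩

end DVR

section FiniteDimensional

variable {M : Type*} [AddCommGroup M] [Module ℂ M] [Module (ConvergentSeries 1) M]
  [IsScalarTower ℂ (ConvergentSeries 1) M] [Module.Finite (ConvergentSeries 1) M]

/-- Spanned over `ℂ` by `t ^ j` times the module generators, with `j < k`. -/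
theorem finite_of_coord_pow_smul_eq_zero (k : ℕ)
    (h : ∀ m : M, (coord 0 ^ k : ConvergentSeries 1) • m = 0) : Module.Finite ℂ M := by
  obtain ⟨n, s, hs⟩ := Module.Finite.exists_fin (R := ConvergentSeries 1) (M := M)
  let v : (Fin 1 → Fin k) × Fin n → M := fun p =>
    (cmonomial (boxExponent p.1) : ConvergentSeries 1) • s p.2
  refine ⟨(Submodule.fg_def).2 ⟨Set.range v, Set.finite_range v, ?_⟩⟩
  rw [eq_top_iff]
  rintro m -
  have hm : m ∈ Submodule.span (ConvergentSeries 1) (Set.range s) := hs ▸ Submodule.mem_top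
  obtain ⟨c, rfl⟩ := (Submodule.mem_span_range_iff_exists_fun _).1 hm
  refine Submodule.sum_mem _ fun j _ => ?_
  rw [eq_sum_box_add_sum_cshift k (c j), add_smul, Fintype.sum_unique (ι := Fin 1), mul_smul]
  rw [show (coord default ^ k : ConvergentSeries 1) = coord 0 ^ k from rfl, h, add_zero,
    Finset.sum_smul]
  refine Submodule.sum_mem _ fun e _ => ?_
  rw [smul_assoc]
  exact Submodule.smul_mem _ _ (Submodule.subset_span ⟨(e, j), rfl⟩)

theorem finite_quotient_of_coord_pow_mem {A : Type*} [CommRing A] [Algebra ℂ A]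
    [Algebra (ConvergentSeries 1) A] [IsScalarTower ℂ (ConvergentSeries 1) A]
    [Module.Finite (ConvergentSeries 1) A] {J : Ideal A} {k : ℕ}
    (h : algebraMap (ConvergentSeries 1) A (coord 0) ^ k ∈ J) : Module.Finite ℂ (A ⧸ J) := by
  have : Module.Finite (ConvergentSeries 1) (A ⧸ J) :=
    Module.Finite.of_surjective (Ideal.Quotient.mkₐ (ConvergentSeries 1) J).toLinearMap
      Ideal.Quotient.mk_surjective
  refine finite_of_coord_pow_smul_eq_zero k fun m => ?_
  obtain ⟨a, rfl⟩ := Ideal.Quotient.mk_surjective m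
  change Ideal.Quotient.mk J ((coord 0 ^ k : ConvergentSeries 1) • a) = 0
  rw [Ideal.Quotient.eq_zero_iff_mem, Algebra.smul_def, map_pow]
  exact Ideal.mul_mem_right _ _ h

theorem finite_quotient_of_coord_pow_mul_mem {A : Type*} [CommRing A] [Algebra ℂ A]
    [Algebra (ConvergentSeries 1) A] [IsScalarTower ℂ (ConvergentSeries 1) A]
    [Module.Finite (ConvergentSeries 1) A] {W : Submodule ℂ A} {k : ℕ}
    (h : ∀ a, algebraMap (ConvergentSeries 1) A (coord 0) ^ k * a ∈ W) :
    Module.Finite ℂ (A ⧸ W) := by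
  set y := algebraMap (ConvergentSeries 1) A (coord 0) ^ k
  have := finite_quotient_of_coord_pow_mem (Ideal.mem_span_singleton_self y)
  have hle : (Ideal.span {y}).restrictScalars ℂ ≤ W := by
    intro a ha
    obtain ⟨b, rfl⟩ := Ideal.mem_span_singleton'.1 ha
    rw [mul_comm]
    exact h b
  have : Module.Finite ℂ (A ⧸ (Ideal.span {y}).restrictScalars ℂ) :=
    Module.Finite.equiv (Submodule.Quotient.restrictScalarsEquiv ℂ (Ideal.span {y})).symm
  exact Module.Finite.of_surjective _ (Submodule.factor_surjective hle)

end FiniteDimensional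

section Codim

variable {K V W : Type*} [Field K] [AddCommGroup V] [Module K V] [AddCommGroup W] [Module K W]

/-- The exact sequence `0 → W/f⁻¹A → V/A → V/(A + im f) → 0`. All later dimension counts rest on it.
-/
theorem finrank_quotient_eq_add (f : W →ₗ[K] V) (A : Submodule K V) [Module.Finite K (V ⧸ A)] :
    Module.finrank K (V ⧸ A) =
      Module.finrank K (V ⧸ (A ⊔ LinearMap.range f)) + Module.finrank K (W ⧸ A.comap f) := by
  have h1 := Submodule.finrank_quotient_add_finrank (LinearMap.range (A.mkQ ∘ₗ f))
  have h2 : Module.finrank K (LinearMap.range (A.mkQ ∘ₗ f)) =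
      Module.finrank K (W ⧸ A.comap f) := by
    rw [← (LinearMap.quotKerEquivRange (A.mkQ ∘ₗ f)).finrank_eq]
    rw [LinearMap.ker_comp, Submodule.ker_mkQ]
  have h3 : Module.finrank K ((V ⧸ A) ⧸ LinearMap.range (A.mkQ ∘ₗ f)) =
      Module.finrank K (V ⧸ (A ⊔ LinearMap.range f)) := by
    have h4 : LinearMap.range (A.mkQ ∘ₗ f) = (A ⊔ LinearMap.range f).map A.mkQ := by
      rw [LinearMap.range_comp, Submodule.map_sup]
      simp
    rw [h4]
    exact (Submodule.quotientQuotientEquivQuotient A (A ⊔ LinearMap.range f) le_sup_left).finrank_eq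
  rw [← h1, h2, h3]

theorem finrank_quotient_le_of_le {A B : Submodule K V} (h : A ≤ B) [Module.Finite K (V ⧸ A)] :
    Module.finrank K (V ⧸ B) ≤ Module.finrank K (V ⧸ A) :=
  LinearMap.finrank_le_finrank_of_surjective (f := Submodule.factor h)
    (Submodule.factor_surjective h)

/-- Injectivity identifies `V/A` with `f(V)/f(A)`. Applied below to multiplication by a
nonzerodivisor. -/
theorem finrank_quotient_map_eq_add (f : V →ₗ[K] V) (hf : Function.Injective f)
    (A : Submodule K V) [Module.Finite K (V ⧸ A.map f)] :
    Module.finrank K (V ⧸ A.map f) =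
      Module.finrank K (V ⧸ LinearMap.range f) + Module.finrank K (V ⧸ A) := by
  rw [finrank_quotient_eq_add f (A.map f), Submodule.comap_map_eq_of_injective hf,
    sup_eq_right.2 LinearMap.map_le_range]

end Codim

end

end CurveGerm

/-! ### One-dimensional integrally closed rings: local principality and generic generators. -/

namespace CurveGerm

noncomputable section

open IsLocalRing

section SemilocalDim1

variable {R : Type*} [CommRing R]

/-- The determinant trick: `z` acts on the finitely generated module `N`, and the nonzerodivisor in
`N` makes the action faithful. -/
theorem isIntegral_of_mul_mem {A : Type*} [CommRing A] [Algebra R A] (N : Submodule R A)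
    (hN : N.FG) {a : A} (ha : a ∈ N) (ha' : a ∈ nonZeroDivisors A) {z : A}
    (hz : ∀ n ∈ N, z * n ∈ N) : IsIntegral R z := by
  let B : Subalgebra R A :=
    { carrier := {z | ∀ n ∈ N, z * n ∈ N}
      mul_mem' := fun {a b} ha hb n hn => by rw [mul_assoc]; exact ha _ (hb _ hn)
      one_mem' := fun n hn => by rwa [one_mul]
      add_mem' := fun {a b} ha hb n hn => by rw [add_mul]; exact N.add_mem (ha _ hn) (hb _ hn)
      zero_mem' := fun n _ => by rw [zero_mul]; exact N.zero_mem
      algebraMap_mem' := fun r n hn => by rw [← Algebra.smul_def]; exact N.smul_mem r hn }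
  let f : B →ₐ[R] Module.End R N :=
    AlgHom.ofLinearMap
      { toFun := fun z => (LinearMap.mulLeft R z.1).restrict z.2
        map_add' := by intro x y; ext; exact add_mul _ _ _
        map_smul' := by intro r s; ext; exact smul_mul_assoc _ _ _ }
      (by ext; exact one_mul _)
      (by intro x y; ext; exact mul_assoc _ _ _)
  have hf : Function.Injective f := by
    rw [injective_iff_map_eq_zero]
    intro s hs
    have : s.1 * a = 0 := congrArg Subtype.val (LinearMap.congr_fun hs ⟨a, ha⟩)
    exact Subtype.ext ((mul_right_mem_nonZeroDivisors_eq_zero_iff ha').1 this)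
  change IsIntegral R (B.val ⟨z, hz⟩)
  rw [isIntegral_algHom_iff B.val Subtype.val_injective]
  have : Module.Finite R N := by rwa [Module.Finite.iff_fg]
  have h1 : IsIntegral R (f ⟨z, hz⟩ : Module.End R N) := Algebra.IsIntegral.isIntegral _
  obtain ⟨p, hp, h⟩ := h1
  refine ⟨p, hp, hf ?_⟩
  rw [map_zero, ← h]
  exact (Polynomial.aeval_algHom_apply f ⟨z, hz⟩ p).symm

/-- `M` is minimal over `(x)`, hence an associated prime of `R/(x)`; `y` represents a class with
annihilator `M`. -/
theorem exists_not_dvd_forall_dvd_mul [IsNoetherianRing R] {x : R}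
    (hx : ∀ P : Ideal R, P.IsPrime → x ∈ P → P.IsMaximal) {M : Ideal R} [M.IsMaximal]
    (hM : x ∈ M) : ∃ y, ¬ x ∣ y ∧ ∀ a ∈ M, x ∣ y * a := by
  have h1 : M ∈ (Module.annihilator R (R ⧸ Ideal.span {x})).minimalPrimes := by
    rw [Ideal.annihilator_quotient]
    refine ⟨⟨inferInstance, (Ideal.span_singleton_le_iff_mem M).2 hM⟩, fun P hP hPM => ?_⟩
    exact ((hx P hP.1 ((Ideal.span_singleton_le_iff_mem P).1 hP.2)).eq_of_le
      Ideal.IsPrime.ne_top' hPM).ge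
  have h2 := Module.associatedPrimes.minimalPrimes_annihilator_subset_associatedPrimes R
    (R ⧸ Ideal.span {x}) h1
  obtain ⟨-, y', hy'⟩ := isAssociatedPrime_iff.1 (AssociatedPrimes.mem_iff.1 h2)
  obtain ⟨y, rfl⟩ := Ideal.Quotient.mk_surjective y'
  have key : ∀ a, a ∈ M ↔ x ∣ y * a := by
    intro a
    rw [hy', Submodule.mem_colon_singleton, Submodule.mem_bot, ← Ideal.mem_span_singleton,
      ← Ideal.Quotient.eq_zero_iff_mem, mul_comm]
    rfl
  refine ⟨y, fun h => ?_, fun a ha => (key a).1 ha⟩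
  exact (Ideal.ne_top_iff_one M).1 Ideal.IsPrime.ne_top' ((key 1).2 (by rwa [mul_one]))

/-- Maximal ideals of an integrally closed one-dimensional ring are principal modulo their
square. -/
theorem exists_le_span_sup_sq [IsNoetherianRing R] {L : Type*} [CommRing L] [Algebra R L]
    (hL : Function.Injective (algebraMap R L))
    (hint : ∀ z : L, IsIntegral R z → z ∈ (algebraMap R L).range) {x : R}
    (hxL : IsUnit (algebraMap R L x))
    (hx : ∀ P : Ideal R, P.IsPrime → x ∈ P → P.IsMaximal) {M : Ideal R} [M.IsMaximal]
    (hM : x ∈ M) : ∃ p ∈ M, M ≤ Ideal.span {p} ⊔ M ^ 2 := by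
  have hx0 : ∀ a b, x * a = x * b → a = b := by
    intro a b h
    apply hL
    apply hxL.mul_left_cancel
    rw [← map_mul, ← map_mul, h]
  obtain ⟨y, hy, hyM⟩ := exists_not_dvd_forall_dvd_mul hx hM
  obtain ⟨u, hu⟩ := hxL
  -- If `y / x` mapped `M` into itself it would be integral, so it would lie in `R`, contradicting
  -- `¬ x ∣ y`. Hence some `y * p / x` lies outside `M`.
  have h1 : ∃ p ∈ M, ∃ s, s ∉ M ∧ y * p = x * s := by
    by_contra! hcon
    apply hy
    have h2 : ∀ n ∈ Submodule.map (Algebra.linearMap R L) M,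
        (algebraMap R L y * ↑u⁻¹) * n ∈ Submodule.map (Algebra.linearMap R L) M := by
      rintro _ ⟨a, ha, rfl⟩
      obtain ⟨s, hs⟩ := hyM a ha
      have hsM : s ∈ M := by
        by_contra h
        exact hcon a ha s h hs
      refine ⟨s, hsM, ?_⟩
      rw [Algebra.linearMap_apply, Algebra.linearMap_apply, mul_right_comm, ← map_mul, hs,
        map_mul, ← hu, mul_comm (u : L), mul_assoc, Units.mul_inv, mul_one]
    have h3 := isIntegral_of_mul_mem (R := R) (Submodule.map (Algebra.linearMap R L) M)
      (Submodule.FG.map _ (IsNoetherian.noetherian M)) (a := algebraMap R L x) ⟨x, hM, rfl⟩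
      (hu ▸ u.isUnit.mem_nonZeroDivisors) h2
    obtain ⟨r, hr⟩ := hint _ h3
    refine ⟨r, hL ?_⟩
    rw [map_mul, hr, ← hu, mul_comm (u : L), mul_assoc, Units.inv_mul, mul_one]
  obtain ⟨p, hp, s, hs, hps⟩ := h1
  refine ⟨p, hp, fun a ha => ?_⟩
  obtain ⟨b, hb⟩ := hyM a ha
  have h2 : s * a = p * b := by
    apply hx0
    calc x * (s * a) = (y * p) * a := by rw [hps]; ring
      _ = p * (y * a) := by ring
      _ = x * (p * b) := by rw [hb]; ring
  obtain ⟨s', m, hm, hs'⟩ : ∃ s', ∃ m ∈ M, s * s' + m = 1 := by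
    have := Ideal.IsMaximal.exists_inv ‹M.IsMaximal› hs
    obtain ⟨s', m, hm, h⟩ := this
    exact ⟨s', m, hm, by rw [mul_comm]; exact h⟩
  have h3 : a = p * (b * s') + m * a := by
    calc a = (s * s' + m) * a := by rw [hs', one_mul]
      _ = (s * a) * s' + m * a := by ring
      _ = _ := by rw [h2]; ring
  rw [h3]
  refine Submodule.add_mem_sup (Ideal.mul_mem_right _ _ (Ideal.mem_span_singleton_self p)) ?_
  rw [sq]
  exact Ideal.mul_mem_mul hm ha

/-- An element of exact order `j` at `M` is `r * p ^ j` modulo `M ^ (j + 1)` with `r ∉ M`. Inverting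
`r` modulo `M` recovers `p ^ j`, and iteration reaches any precision. -/
theorem pow_le_span_sup_pow {M : Ideal R} [M.IsMaximal] {p : R} (hp : p ∈ M)
    (h : M ≤ Ideal.span {p} ⊔ M ^ 2) {f : R} {j : ℕ} (hf : f ∈ M ^ j) (hf' : f ∉ M ^ (j + 1))
    (k : ℕ) : M ^ j ≤ Ideal.span {f} ⊔ M ^ k := by
  have h1 : ∀ i, M ^ i ≤ Ideal.span {p ^ i} ⊔ M ^ (i + 1) := by
    intro i
    induction i with
    | zero => simp
    | succ i ih =>
      calc M ^ (i + 1) = M ^ i * M := pow_succ _ _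
        _ ≤ (Ideal.span {p ^ i} ⊔ M ^ (i + 1)) * M := Ideal.mul_mono_left ih
        _ = Ideal.span {p ^ i} * M ⊔ M ^ (i + 2) := by rw [Ideal.sup_mul, ← pow_succ]
        _ ≤ Ideal.span {p ^ i} * (Ideal.span {p} ⊔ M ^ 2) ⊔ M ^ (i + 2) :=
          sup_le_sup_right (Ideal.mul_mono_right h) _
        _ = Ideal.span {p ^ (i + 1)} ⊔ (Ideal.span {p ^ i} * M ^ 2 ⊔ M ^ (i + 2)) := by
          rw [Ideal.mul_sup, Ideal.span_singleton_mul_span_singleton, ← pow_succ, sup_assoc]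
        _ ≤ _ := by
          refine sup_le_sup_left (sup_le ?_ le_rfl) _
          rw [pow_add]
          refine Ideal.mul_mono_left ?_
          rw [Ideal.span_singleton_le_iff_mem]
          exact Ideal.pow_mem_pow hp i
  have h2 : M ^ j ≤ Ideal.span {f} ⊔ M ^ (j + 1) := by
    obtain ⟨g, hg, m, hm, hgm⟩ := Submodule.mem_sup.1 (h1 j hf)
    obtain ⟨r, rfl⟩ := Ideal.mem_span_singleton'.1 hg
    have hr : r ∉ M := by
      intro hr
      apply hf'
      rw [← hgm, pow_succ']
      exact add_mem (Ideal.mul_mem_mul hr (Ideal.pow_mem_pow hp j))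
        (by rw [← pow_succ']; exact hm)
    obtain ⟨s, m', hm', hs⟩ := Ideal.IsMaximal.exists_inv ‹M.IsMaximal› hr
    refine (h1 j).trans (sup_le ?_ le_sup_right)
    rw [Ideal.span_singleton_le_iff_mem]
    have : p ^ j = s * f + (m' * p ^ j - s * m) := by
      calc p ^ j = (s * r + m') * p ^ j := by rw [hs, one_mul]
        _ = s * (r * p ^ j + m) + (m' * p ^ j - s * m) := by ring
        _ = _ := by rw [hgm]
    rw [this]
    refine Submodule.add_mem_sup (Ideal.mul_mem_left _ _ (Ideal.mem_span_singleton_self f))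
      (sub_mem ?_ (Ideal.mul_mem_left _ _ hm))
    rw [pow_succ']
    exact Ideal.mul_mem_mul hm' (Ideal.pow_mem_pow hp j)
  induction k with
  | zero => simp
  | succ k ih =>
    rcases le_or_gt k j with hkj | hkj
    · exact h2.trans (sup_le_sup_left (Ideal.pow_le_pow_right (by omega)) _)
    · refine ih.trans (sup_le le_sup_left ?_)
      obtain ⟨i, rfl⟩ := Nat.exists_eq_add_of_lt hkj
      calc M ^ (j + i + 1) = M ^ j * M ^ (i + 1) := by rw [← pow_add, add_assoc]
        _ ≤ (Ideal.span {f} ⊔ M ^ (j + 1)) * M ^ (i + 1) := Ideal.mul_mono_left h2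
        _ = Ideal.span {f} * M ^ (i + 1) ⊔ M ^ (j + i + 1 + 1) := by
          rw [Ideal.sup_mul, ← pow_add]
          congr 2
          omega
        _ ≤ _ := sup_le_sup_right Ideal.mul_le_left _

/-- The maximal ideals are minimal primes over `(x)`, and a Noetherian ring has finitely many of
these. -/
theorem finite_maximalSpectrum [IsNoetherianRing R] {x : R}
    (hx : ∀ P : Ideal R, P.IsPrime → x ∈ P → P.IsMaximal)
    (hM : ∀ M : Ideal R, M.IsMaximal → x ∈ M) : Finite (MaximalSpectrum R) := by
  have hfin := Ideal.finite_minimalPrimes_of_isNoetherianRing R (Ideal.span {x})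
  have : Finite (Ideal.span {x}).minimalPrimes := hfin
  refine Finite.of_injective
    (fun M : MaximalSpectrum R => (⟨M.asIdeal, ⟨⟨M.isMaximal.isPrime,
      (Ideal.span_singleton_le_iff_mem _).2 (hM _ M.isMaximal)⟩, fun P hP hPM => ?_⟩⟩ :
        (Ideal.span {x}).minimalPrimes)) ?_
  · exact ((hx P hP.1 ((Ideal.span_singleton_le_iff_mem P).1 hP.2)).eq_of_le
      M.isMaximal.ne_top hPM).ge
  · intro M M' h
    exact MaximalSpectrum.ext (congrArg Subtype.val h)

/-- A generic element of a linear subspace of an integrally closed one-dimensional ring generates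
the same ideal as the subspace. -/
theorem exists_generic_generator [IsNoetherianRing R] [Algebra ℂ R] {x : R}
    (hx0 : x ∈ nonZeroDivisors R)
    (hx : ∀ P : Ideal R, P.IsPrime → x ∈ P → P.IsMaximal)
    (hM : ∀ M : Ideal R, M.IsMaximal → x ∈ M)
    (hp : ∀ M : Ideal R, M.IsMaximal → ∃ p ∈ M, M ≤ Ideal.span {p} ⊔ M ^ 2)
    (V : Submodule ℂ R) (hV : x ∈ V) :
    ∃ x₀ ∈ V, ∃ l : MaximalSpectrum R →₀ ℕ,
      Ideal.span {x₀} = ⨅ M : MaximalSpectrum R, M.asIdeal ^ l M ∧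
        Ideal.span (V : Set R) = Ideal.span {x₀} := by
  classical
  have := finite_maximalSpectrum hx hM
  -- The order of `V` along `M` is finite by Krull's theorem, because `V` contains the
  -- nonzerodivisor `x`.
  have h1 : ∀ M : MaximalSpectrum R, ∃ j, Ideal.span (V : Set R) ≤ M.asIdeal ^ j ∧
      ¬ Ideal.span (V : Set R) ≤ M.asIdeal ^ (j + 1) := by
    intro M
    have h2 : ∃ j, ¬ Ideal.span (V : Set R) ≤ M.asIdeal ^ j := by
      by_contra! hcon
      have h3 : x ∈ (⨅ i : ℕ, M.asIdeal ^ i • ⊤ : Ideal R) := by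
        rw [Submodule.mem_iInf]
        intro i
        rw [smul_eq_mul, Ideal.mul_top]
        exact hcon i (Ideal.subset_span hV)
      obtain ⟨r, hr⟩ := (Ideal.mem_iInf_smul_pow_eq_bot_iff M.asIdeal x).1 h3
      have h4 : ((r : R) - 1) * x = 0 := by
        rw [sub_mul, one_mul, ← smul_eq_mul, hr, sub_self]
      rw [mul_right_mem_nonZeroDivisors_eq_zero_iff hx0, sub_eq_zero] at h4
      exact (Ideal.ne_top_iff_one _).1 M.isMaximal.ne_top (h4 ▸ r.2)
    obtain ⟨j, hj⟩ : ∃ j, Nat.find h2 = j + 1 := by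
      refine Nat.exists_eq_succ_of_ne_zero fun h => ?_
      have := Nat.find_spec h2
      rw [h] at this
      simp at this
    refine ⟨j, ?_, hj ▸ Nat.find_spec h2⟩
    have := Nat.find_min h2 (m := j) (by omega)
    rwa [not_not] at this
  choose l hl hl' using h1
  -- A complex vector space is not a finite union of proper subspaces, so one vector attains the
  -- minimal order at all `M` simultaneously.
  have h2 : ∃ v : V, ∀ M : MaximalSpectrum R, (v : R) ∉ M.asIdeal ^ (l M + 1) := by
    by_contra! hcon
    obtain ⟨M, hM⟩ := Subspace.exists_eq_top_of_iUnion_eq_univ (k := ℂ) (E := V)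
      (p := fun M : MaximalSpectrum R =>
        ((M.asIdeal ^ (l M + 1)).restrictScalars ℂ).comap V.subtype)
      (Set.eq_univ_of_forall fun v => Set.mem_iUnion.2 (hcon v))
    apply hl' M
    rw [Ideal.span_le]
    intro v hv
    have : (⟨v, hv⟩ : V) ∈ ((M.asIdeal ^ (l M + 1)).restrictScalars ℂ).comap V.subtype :=
      hM ▸ Submodule.mem_top
    exact this
  obtain ⟨⟨x₀, hx₀V⟩, hx₀⟩ := h2
  have h3 : ⨅ M : MaximalSpectrum R, M.asIdeal ^ l M ≤ Ideal.span {x₀} := by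
    intro f hf
    rw [Ideal.mem_iInf] at hf
    by_contra hf'
    -- Membership in `(x₀)` is local: at a maximal ideal `M` over the colon ideal, `f` lies in every
    -- `(x₀) + M ^ i`. Krull's theorem gives `r ∈ M` with `(1 - r) * f ∈ (x₀)`, which is absurd.
    have h4 : (Ideal.span {x₀}).colon {f} ≠ ⊤ := by
      rw [Ideal.ne_top_iff_one, Submodule.mem_colon_singleton, one_smul]
      exact hf'
    obtain ⟨M, hMmax, hMle⟩ := Ideal.exists_le_maximal _ h4
    obtain ⟨p, hpM, hpM'⟩ := hp M hMmax
    have h5 : Ideal.Quotient.mk (Ideal.span {x₀}) f ∈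
        (⨅ i : ℕ, M ^ i • ⊤ : Submodule R (R ⧸ Ideal.span {x₀})) := by
      rw [Submodule.mem_iInf]
      intro i
      have h6 := pow_le_span_sup_pow hpM hpM'
        (hl ⟨M, hMmax⟩ (Ideal.subset_span hx₀V)) (hx₀ ⟨M, hMmax⟩) i (hf ⟨M, hMmax⟩)
      obtain ⟨g, hg, m, hm, rfl⟩ := Submodule.mem_sup.1 h6
      rw [map_add, Ideal.Quotient.eq_zero_iff_mem.2 hg, zero_add]
      have : Ideal.Quotient.mk (Ideal.span {x₀}) m =
          m • (1 : R ⧸ Ideal.span {x₀}) := by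
        rw [Algebra.smul_def, mul_one]
        rfl
      rw [this]
      exact Submodule.smul_mem_smul hm Submodule.mem_top
    obtain ⟨r, hr⟩ := (Ideal.mem_iInf_smul_pow_eq_bot_iff M _).1 h5
    have h6 : (1 - (r : R)) ∈ M := by
      apply hMle
      rw [Submodule.mem_colon_singleton, smul_eq_mul, ← Ideal.Quotient.eq_zero_iff_mem, map_mul,
        map_sub, map_one, sub_mul, one_mul, sub_eq_zero]
      rw [Algebra.smul_def] at hr
      exact hr.symm
    have h7 := add_mem h6 r.2
    rw [sub_add_cancel] at h7
    exact (Ideal.ne_top_iff_one M).1 hMmax.ne_top h7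
  have h4 : Ideal.span (V : Set R) ≤ ⨅ M : MaximalSpectrum R, M.asIdeal ^ l M :=
    le_iInf hl
  have h5 : Ideal.span {x₀} ≤ Ideal.span (V : Set R) := by
    rw [Ideal.span_singleton_le_iff_mem]
    exact Ideal.subset_span hx₀V
  exact ⟨x₀, hx₀V, Finsupp.equivFunOnFinite.symm l, le_antisymm (h5.trans h4) h3,
    le_antisymm (h4.trans h3) h5⟩

end SemilocalDim1

end

end CurveGerm

/-! ### Finiteness of the normalization and the existence of a parameter. -/

namespace CurveGerm

noncomputable section

open IsLocalRing
open scoped nonZeroDivisors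

section FiniteNormalization

variable {D : Type*} [CommRing D] [IsDomain D] [IsIntegrallyClosed D] [IsNoetherianRing D]
  [CharZero D] {O : Type*} [CommRing O] [IsReduced O] [Algebra D O] [Module.Finite D O]

theorem finite_integralClosure_fractionRing {B : Type*} [CommRing B] [IsDomain B] [Algebra D B]
    [Module.Finite D B] (hinj : Function.Injective (algebraMap D B)) :
    Module.Finite D (integralClosure D (FractionRing B)) := by
  have : FaithfulSMul D B := (faithfulSMul_iff_algebraMap_injective D B).2 hinj
  have : FaithfulSMul D (FractionRing B) := (faithfulSMul_iff_algebraMap_injective _ _).2 <| by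
    rw [IsScalarTower.algebraMap_eq D B]
    exact (IsFractionRing.injective B _).comp hinj
  let := FractionRing.liftAlgebra D (FractionRing B)
  have := FractionRing.isScalarTower_liftAlgebra D (FractionRing B)
  have : Algebra.IsAlgebraic D B := inferInstance
  have : FiniteDimensional (FractionRing D) (FractionRing B) := .of_isLocalization D B D⁰
  have : CharZero (FractionRing D) := IsFractionRing.charZero_of_isFractionRing D
  exact IsIntegralClosure.finite D (FractionRing D) (FractionRing B) _

/-- Since `O` is reduced, its total ring of fractions embeds in the product of the fields
`Frac(O/p)` over the finitely many minimal primes. Each integral closure there is finite over `D` by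
separability in characteristic zero, and `D` is Noetherian. Nonzerodivisors avoid minimal primes, so
`D` embeds in each `O/p`. -/
theorem finite_normalization (hnzd : ∀ d : D, d ≠ 0 → algebraMap D O d ∈ O⁰) :
    Module.Finite D (Normalization O) := by
  have : IsNoetherianRing O := IsNoetherianRing.of_finite D O
  have : Finite (minimalPrimes O) := minimalPrimes.finite_of_isNoetherianRing O
  have hprime : ∀ p : minimalPrimes O, p.1.IsPrime := fun p => p.2.1.1
  have hinj : ∀ p : minimalPrimes O, Function.Injective (algebraMap D (O ⧸ p.1)) := by
    intro p
    rw [injective_iff_map_eq_zero]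
    intro d hd
    by_contra hd0
    rw [IsScalarTower.algebraMap_apply D O, Ideal.Quotient.algebraMap_eq,
      Ideal.Quotient.eq_zero_iff_mem] at hd
    exact notMem_nonZeroDivisors_of_mem_mem_minimalPrimes hd p.2 (hnzd d hd0)
  have hfin : ∀ p : minimalPrimes O,
      Module.Finite D (integralClosure D (FractionRing (O ⧸ p.1))) := fun p =>
    finite_integralClosure_fractionRing (hinj p)
  have hunit : ∀ (p : minimalPrimes O) (s : O⁰),
      IsUnit (algebraMap O (FractionRing (O ⧸ p.1)) s) := by
    intro p s
    rw [isUnit_iff_ne_zero, IsScalarTower.algebraMap_apply O (O ⧸ p.1), Ne,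
      FaithfulSMul.algebraMap_eq_zero_iff, Ideal.Quotient.algebraMap_eq,
      Ideal.Quotient.eq_zero_iff_mem]
    exact fun h => notMem_nonZeroDivisors_of_mem_mem_minimalPrimes h p.2 s.2
  let φ : ∀ p : minimalPrimes O, FractionRing O →ₐ[O] FractionRing (O ⧸ p.1) := fun p =>
    { IsLocalization.lift (hunit p) with
      commutes' := fun a => IsLocalization.lift_eq (hunit p) a }
  have hφ : ∀ z : FractionRing O, (∀ p, φ p z = 0) → z = 0 := by
    intro z hz
    obtain ⟨a, s, rfl⟩ := IsLocalization.exists_mk'_eq O⁰ z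
    have ha : a ∈ sInf (minimalPrimes O) := by
      rw [Ideal.mem_sInf]
      intro p hp
      have h1 := hz ⟨p, hp⟩
      have h2 : φ ⟨p, hp⟩ (algebraMap O _ a) = 0 := by
        rw [← IsLocalization.mk'_spec (FractionRing O) a s, map_mul, h1, zero_mul]
      rw [AlgHom.commutes, IsScalarTower.algebraMap_apply O (O ⧸ p),
        FaithfulSMul.algebraMap_eq_zero_iff, Ideal.Quotient.algebraMap_eq,
        Ideal.Quotient.eq_zero_iff_mem] at h2
      exact h2
    rw [minimalPrimes, Ideal.sInf_minimalPrimes] at ha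
    have h0 : a = 0 := by
      have : IsNilpotent a := ha
      exact this.eq_zero
    rw [h0, IsLocalization.mk'_zero]
  have : Algebra.IsIntegral D O := inferInstance
  let f : Normalization O →ₗ[D] (∀ p : minimalPrimes O,
      integralClosure D (FractionRing (O ⧸ p.1))) :=
    LinearMap.pi fun p => LinearMap.codRestrict
      (Subalgebra.toSubmodule (integralClosure D (FractionRing (O ⧸ p.1))))
      (((φ p).toLinearMap.restrictScalars D).comp
        ((integralClosure O (FractionRing O)).val.toLinearMap.restrictScalars D)) fun z => by
        change IsIntegral D (φ p z.1)
        have h1 : IsIntegral D z.1 := isIntegral_trans z.1 z.2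
        exact h1.map ((φ p).restrictScalars D)
  refine Module.Finite.of_injective f ?_
  rw [← LinearMap.ker_eq_bot, LinearMap.ker_eq_bot']
  intro z hz
  refine Subtype.ext (hφ z.1 fun p => ?_)
  exact congrArg Subtype.val (congrFun hz p)

end FiniteNormalization

section Normalization

variable {O : Type*} [CommRing O]

theorem injective_algebraMap_normalization :
    Function.Injective (algebraMap O (Normalization O)) := by
  refine Function.Injective.of_comp (f := algebraMap (Normalization O) (FractionRing O)) ?_
  exact IsLocalization.injective (FractionRing O) le_rfl

theorem algebraMap_normalization_mem_nonZeroDivisors {s : O} (hs : s ∈ O⁰) :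
    algebraMap O (Normalization O) s ∈ (Normalization O)⁰ := by
  rw [mem_nonZeroDivisors_iff_right]
  intro z hz
  refine Subtype.ext ?_
  have h1 : z.1 * algebraMap O (FractionRing O) s = 0 := congrArg Subtype.val hz
  exact ((IsLocalization.map_units (FractionRing O) (⟨s, hs⟩ : O⁰)).mul_left_eq_zero).1 h1

theorem mem_range_of_isIntegral_normalization (z : FractionRing O)
    (hz : IsIntegral (Normalization O) z) :
    z ∈ (algebraMap (Normalization O) (FractionRing O)).range :=
  ⟨⟨z, isIntegral_trans z hz⟩, rfl⟩

theorem exists_mul_mem_range (z : Normalization O) :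
    ∃ s ∈ O⁰, ∃ a : O, algebraMap O (Normalization O) s * z = algebraMap O (Normalization O) a := by
  obtain ⟨⟨a, s⟩, h⟩ := IsLocalization.surj O⁰ z.1
  refine ⟨s, s.2, a, Subtype.ext ?_⟩
  change algebraMap O (FractionRing O) s * z.1 = algebraMap O (FractionRing O) a
  rw [mul_comm]
  exact h

/-- The product of denominators of finitely many module generators is a common denominator for the
whole normalization. -/
theorem exists_forall_mul_mem_range {D : Type*} [CommRing D] [Algebra D O]
    [Module.Finite D (Normalization O)] :
    ∃ s ∈ O⁰, ∀ z : Normalization O,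
      algebraMap O (Normalization O) s * z ∈ (algebraMap O (Normalization O)).range := by
  obtain ⟨n, v, hv⟩ := Module.Finite.exists_fin (R := D) (M := Normalization O)
  choose s hs a ha using fun i => exists_mul_mem_range (v i)
  refine ⟨∏ i, s i, Submonoid.prod_mem _ fun i _ => hs i, fun z => ?_⟩
  obtain ⟨c, rfl⟩ := (Submodule.mem_span_range_iff_exists_fun D).1
    (hv ▸ Submodule.mem_top : z ∈ Submodule.span D (Set.range v))
  rw [Finset.mul_sum]
  refine sum_mem fun i _ => ?_
  rw [← Finset.prod_erase_mul _ _ (Finset.mem_univ i), map_mul, mul_smul_comm, mul_assoc, ha,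
    Algebra.smul_def, IsScalarTower.algebraMap_apply D O (Normalization O), ← map_mul, ← map_mul]
  exact ⟨_, rfl⟩

end Normalization

section Curve

/-- A nonzerodivisor in the maximal ideal generating a primary ideal. -/
theorem mem_nonZeroDivisors_of_pow_le {O : Type*} [CommRing O] [IsLocalRing O] [IsReduced O]
    (hdim : ringKrullDim O = 1) {x : O} {K : ℕ} (hK : maximalIdeal O ^ K ≤ Ideal.span {x}) :
    x ∈ O⁰ := by
  rw [mem_nonZeroDivisors_iff_right]
  intro y hyx
  by_contra hy
  have h1 : ∃ p ∈ minimalPrimes O, y ∉ p := by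
    by_contra! h
    have h2 : y ∈ sInf (minimalPrimes O) := by
      rw [Ideal.mem_sInf]
      exact fun {p} hp => h p hp
    rw [minimalPrimes, Ideal.sInf_minimalPrimes] at h2
    have h3 : IsNilpotent y := h2
    exact hy h3.eq_zero
  obtain ⟨p, hp, hyp⟩ := h1
  have hpp : p.IsPrime := hp.1.1
  have hxp : x ∈ p := (hpp.mem_or_mem (hyx ▸ p.zero_mem)).resolve_left hyp
  -- A minimal prime containing `x` contains a power of the maximal ideal, hence equals it; the
  -- dimension would then be `0`.
  have h4 : maximalIdeal O ≤ p := hpp.le_of_pow_le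
    (hK.trans ((Ideal.span_singleton_le_iff_mem p).2 hxp))
  have h5 : Ring.KrullDimLE 0 O := by
    rw [Ring.krullDimLE_zero_iff]
    intro I hI
    have h6 : p ≤ I := hp.2 ⟨hI, bot_le⟩ ((le_maximalIdeal hI.ne_top).trans h4)
    have h7 : I = maximalIdeal O := le_antisymm (le_maximalIdeal hI.ne_top) (h4.trans h6)
    rw [h7]
    infer_instance
  have h6 := (ringKrullDimZero_iff_ringKrullDim_eq_zero).1 h5
  rw [hdim] at h6
  exact one_ne_zero h6

variable {O : Type*} [CommRing O] [Algebra ℂ O]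

theorem IsReducedCurveGerm.isAnalytic (hO : IsReducedCurveGerm O) : IsAnalytic O := by
  obtain ⟨N, I, ⟨e⟩⟩ := hO.analytic
  exact ⟨N, e.symm.toAlgHom.comp (Ideal.Quotient.mkₐ ℂ I),
    e.symm.surjective.comp Ideal.Quotient.mk_surjective⟩

theorem IsReducedCurveGerm.exists_parameter [IsLocalRing O] (hO : IsReducedCurveGerm O) :
    ∃ x ∈ maximalIdeal O, x ∈ O⁰ ∧ ∃ K, maximalIdeal O ^ K ≤ Ideal.span {x} := by
  obtain ⟨x, hx, K, hK⟩ := hO.isAnalytic.exists_parameter hO.dim_one.le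
  have := hO.reduced
  exact ⟨x, hx, mem_nonZeroDivisors_of_pow_le hO.dim_one hK, K, hK⟩

/-- Evaluation of convergent power series in one variable at a parameter. -/
theorem IsAnalytic.exists_finite_algHom [IsLocalRing O] (hO : IsAnalytic O)
    {x : O} (hx : x ∈ maximalIdeal O) {K : ℕ} (hK : maximalIdeal O ^ K ≤ Ideal.span {x}) :
    ∃ φ : ConvergentSeries 1 →ₐ[ℂ] O, φ (coord 0) = x ∧ φ.toRingHom.Finite := by
  obtain ⟨φ, hφ, hfin⟩ := hO.exists_algHom (fun _ : Fin 1 => x) fun _ => hx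
  exact ⟨φ, hφ 0, hfin ⟨K, by rwa [Set.range_const]⟩⟩

end Curve

end

end CurveGerm

/-! ### Conductor bounds and good parameters. -/

namespace CurveGerm

noncomputable section

open IsLocalRing
open scoped nonZeroDivisors

instance : CharZero (ConvergentSeries 1) :=
  charZero_of_injective_algebraMap (algebraMap ℂ (ConvergentSeries 1)).injective

theorem algebraMap_mem_nonZeroDivisors {O : Type*} [CommRing O] [Algebra (ConvergentSeries 1) O]
    (hx : algebraMap (ConvergentSeries 1) O (coord 0) ∈ O⁰) {d : ConvergentSeries 1}
    (hd : d ≠ 0) : algebraMap (ConvergentSeries 1) O d ∈ O⁰ := by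
  obtain ⟨n, u, hu, rfl⟩ := exists_eq_coord_pow_mul_unit hd
  rw [map_mul, map_pow]
  exact mul_mem (pow_mem hx n) (hu.map _).mem_nonZeroDivisors

/-- An integral nonzerodivisor divides a nonzero element of `ℂ{t}`, which is a power of `t` up to a
unit. -/
theorem exists_dvd_pow {O : Type*} [CommRing O] [Algebra (ConvergentSeries 1) O]
    [Module.Finite (ConvergentSeries 1) O]
    (hx : algebraMap (ConvergentSeries 1) O (coord 0) ∈ O⁰) {s : O} (hs : s ∈ O⁰) :
    ∃ k, s ∣ algebraMap (ConvergentSeries 1) O (coord 0) ^ k := by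
  cases subsingleton_or_nontrivial O
  · exact ⟨0, 0, Subsingleton.elim _ _⟩
  have hinj : Function.Injective (algebraMap (ConvergentSeries 1) O) := by
    rw [injective_iff_map_eq_zero]
    intro d hd
    by_contra hd0
    exact zero_notMem_nonZeroDivisors (hd ▸ algebraMap_mem_nonZeroDivisors hx hd0)
  have : Algebra.IsIntegral (ConvergentSeries 1) O := inferInstance
  obtain ⟨d, hd, hsd⟩ := ((Algebra.IsIntegral.isIntegral (R := ConvergentSeries 1) s
    ).isAlgebraic).exists_nonzero_dvd hs
  obtain ⟨n, u, hu, rfl⟩ := exists_eq_coord_pow_mul_unit hd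
  refine ⟨n, ?_⟩
  rw [map_mul, map_pow] at hsd
  exact (hu.map (algebraMap _ O)).dvd_mul_right.1 hsd

section Parameter

variable {O : Type*} [CommRing O] [IsReduced O] [Algebra (ConvergentSeries 1) O]
  [Module.Finite (ConvergentSeries 1) O]

theorem finite_normalization_convergentSeries
    (hx : algebraMap (ConvergentSeries 1) O (coord 0) ∈ O⁰) :
    Module.Finite (ConvergentSeries 1) (Normalization O) :=
  finite_normalization fun _ hd => algebraMap_mem_nonZeroDivisors hx hd

theorem exists_conductor (hx : algebraMap (ConvergentSeries 1) O (coord 0) ∈ O⁰) :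
    ∃ k, ∀ z : Normalization O,
      algebraMap (ConvergentSeries 1) (Normalization O) (coord 0) ^ k * z ∈
        (algebraMap O (Normalization O)).range := by
  have := finite_normalization_convergentSeries hx
  obtain ⟨s, hs, h⟩ := exists_forall_mul_mem_range (O := O) (D := ConvergentSeries 1)
  obtain ⟨k, r, hr⟩ := exists_dvd_pow hx hs
  refine ⟨k, fun z => ?_⟩
  rw [IsScalarTower.algebraMap_apply _ O, ← map_pow, hr, mul_comm s, map_mul, mul_assoc]
  obtain ⟨a, ha⟩ := h z
  rw [← ha, ← map_mul]
  exact ⟨_, rfl⟩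

end Parameter

/-- A parameter of a one-dimensional local ring generating, over the normalization, the same ideal
as the maximal ideal. -/
structure IsGoodParameter (O : Type*) [CommRing O] [IsLocalRing O] (x : O) : Prop where
  mem : x ∈ maximalIdeal O
  mem_nonZeroDivisors : x ∈ O⁰
  exists_pow_le : ∃ K, maximalIdeal O ^ K ≤ Ideal.span {x}
  map_eq : (maximalIdeal O).map (algebraMap O (Normalization O)) =
    Ideal.span {algebraMap O (Normalization O) x}
  exists_filtration : ∃ l : Lattice O,
    normFiltration O l = Ideal.span {algebraMap O (Normalization O) x}

theorem mem_of_isMaximal_normalization {O : Type*} [CommRing O] [IsLocalRing O] {x : O}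
    (hx : x ∈ maximalIdeal O) (M : Ideal (Normalization O)) [M.IsMaximal] :
    algebraMap O (Normalization O) x ∈ M := by
  have h1 : (M.comap (algebraMap O (Normalization O))).IsMaximal :=
    Ideal.isMaximal_comap_of_isIntegral_of_isMaximal M
  have h2 : x ∈ M.comap (algebraMap O (Normalization O)) := by
    rw [IsLocalRing.eq_maximalIdeal h1]
    exact hx
  exact h2

/-- `A/P` is a domain of finite dimension over `ℂ`, hence a field. -/
theorem isMaximal_of_coord_mem {A : Type*} [CommRing A] [Algebra ℂ A]
    [Algebra (ConvergentSeries 1) A] [IsScalarTower ℂ (ConvergentSeries 1) A]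
    [Module.Finite (ConvergentSeries 1) A] {P : Ideal A} [P.IsPrime]
    (hP : algebraMap (ConvergentSeries 1) A (coord 0) ∈ P) : P.IsMaximal := by
  have : Module.Finite ℂ (A ⧸ P) := finite_quotient_of_coord_pow_mem (k := 1) (by rwa [pow_one])
  have : Algebra.IsIntegral ℂ (A ⧸ P) := Algebra.IsIntegral.of_finite ℂ _
  exact Ideal.Quotient.maximal_of_isField _
    (isField_of_isIntegral_of_isField' (R := ℂ) (S := A ⧸ P) (Field.toIsField ℂ))

/-- An arbitrary parameter `x` supplies the finiteness results; a generic element `x₀` of the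
maximal ideal then generates the extension of that ideal to the normalization. -/
theorem IsReducedCurveGerm.exists_isGoodParameter {O : Type*} [CommRing O] [IsLocalRing O]
    [Algebra ℂ O] (hO : IsReducedCurveGerm O) : ∃ x, IsGoodParameter O x := by
  have hred := hO.reduced
  obtain ⟨x, hxm, hx, K, hK⟩ := hO.exists_parameter
  obtain ⟨φ, hφ, hfin⟩ := hO.isAnalytic.exists_finite_algHom hxm hK
  let := φ.toRingHom.toAlgebra
  have : IsScalarTower ℂ (ConvergentSeries 1) O :=
    IsScalarTower.of_algebraMap_eq fun c => (φ.commutes c).symm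
  have : Module.Finite (ConvergentSeries 1) O := hfin
  have hφ' : algebraMap (ConvergentSeries 1) O (coord 0) = x := hφ
  have hfinR := finite_normalization_convergentSeries (hφ' ▸ hx)
  have hφ'' : algebraMap (ConvergentSeries 1) (Normalization O) (coord 0) =
      algebraMap O (Normalization O) x := by
    rw [IsScalarTower.algebraMap_apply _ O, hφ']
  have : IsNoetherianRing (Normalization O) := IsNoetherianRing.of_finite (ConvergentSeries 1) _
  have hprime : ∀ P : Ideal (Normalization O), P.IsPrime → algebraMap O (Normalization O) x ∈ P →
      P.IsMaximal := by
    intro P hP hxP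
    exact isMaximal_of_coord_mem (by rwa [hφ''])
  have hcot : ∀ M : Ideal (Normalization O), M.IsMaximal →
      ∃ p ∈ M, M ≤ Ideal.span {p} ⊔ M ^ 2 := fun M hM =>
    exists_le_span_sup_sq (L := FractionRing O) Subtype.val_injective
      mem_range_of_isIntegral_normalization
      (IsLocalization.map_units (FractionRing O) (⟨x, hx⟩ : O⁰)) hprime
      (mem_of_isMaximal_normalization hxm M)
  obtain ⟨z, ⟨x₀, hx₀m, rfl⟩, l, hl, hl'⟩ := exists_generic_generator
    (algebraMap_normalization_mem_nonZeroDivisors hx) hprime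
    (fun M _ => mem_of_isMaximal_normalization hxm M) hcot
    (((maximalIdeal O).restrictScalars ℂ).map
      (IsScalarTower.toAlgHom ℂ O (Normalization O)).toLinearMap) ⟨x, hxm, rfl⟩
  have hmap : (maximalIdeal O).map (algebraMap O (Normalization O)) =
      Ideal.span {algebraMap O (Normalization O) x₀} := hl'
  obtain ⟨k, hk⟩ := exists_conductor (hφ' ▸ hx)
  -- In the normalization `x = x₀ * r`, and `x ^ k * r` descends to `O`. Hence `x₀` is itself a
  -- parameter.
  have hdvd : x₀ ∣ x ^ (k + 1) := by
    have h1 := Ideal.mem_map_of_mem (algebraMap O (Normalization O)) hxm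
    rw [hmap, Ideal.mem_span_singleton] at h1
    obtain ⟨r, hr⟩ := h1
    obtain ⟨a, ha⟩ := hk r
    refine ⟨a, injective_algebraMap_normalization ?_⟩
    rw [map_mul, ha, hφ'', map_pow, pow_succ, hr]
    ring
  have hpow : maximalIdeal O ^ (K * (k + 1)) ≤ Ideal.span {x₀} := by
    rw [pow_mul]
    refine (Ideal.pow_right_mono hK _).trans ?_
    rw [Ideal.span_singleton_pow, Ideal.span_singleton_le_span_singleton]
    exact hdvd
  exact ⟨x₀, hx₀m, mem_nonZeroDivisors_of_pow_le hO.dim_one hpow, ⟨_, hpow⟩, hmap, l, hl.symm⟩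

end

end CurveGerm

/-! ### Multiplicity as the colength of a good parameter. -/

namespace CurveGerm

noncomputable section

open IsLocalRing
open scoped nonZeroDivisors

section Multiplicity

theorem HasMultiplicity.unique {O : Type*} [CommRing O] [IsLocalRing O] [Algebra ℂ O] {e e' : ℕ}
    (h : HasMultiplicity O e) (h' : HasMultiplicity O e') : e = e' := by
  obtain ⟨c, h⟩ := h
  obtain ⟨c', h'⟩ := h'
  obtain ⟨n₀, hn₀⟩ := Filter.eventually_atTop.1 (h.and h')
  have h1 := hn₀ n₀ le_rfl
  have h2 := hn₀ (n₀ + 1) (Nat.le_succ _)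
  have h3 := h1.1.symm.trans h1.2
  have h4 := h2.1.symm.trans h2.2
  push_cast at h4
  have : (e : ℤ) = e' := by linarith
  exact_mod_cast this

theorem exists_eventually_eq_of_antitone {b : ℕ → ℕ} (hb : Antitone b) :
    ∃ c, ∀ᶠ n in Filter.atTop, b n = c := by
  obtain ⟨n₀, hn₀⟩ := Nat.sInf_mem (Set.range_nonempty b)
  exact ⟨b n₀, Filter.eventually_atTop.2 ⟨n₀, fun n hn => le_antisymm (hb hn)
    (hn₀ ▸ Nat.sInf_le ⟨n, rfl⟩)⟩⟩

/-- The inclusion of a germ in its normalization, as a linear map. -/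
abbrev normMap (O : Type*) [CommRing O] [Algebra ℂ O] : O →ₗ[ℂ] Normalization O :=
  (IsScalarTower.toAlgHom ℂ O (Normalization O)).toLinearMap

theorem finrank_restrictScalars_quotient {A : Type*} [CommRing A] [Algebra ℂ A] (I : Ideal A) :
    Module.finrank ℂ (A ⧸ I.restrictScalars ℂ) = Module.finrank ℂ (A ⧸ I) :=
  (Submodule.Quotient.restrictScalarsEquiv ℂ I).finrank_eq

theorem range_mulLeft {A : Type*} [CommRing A] [Algebra ℂ A] (y : A) :
    LinearMap.range (LinearMap.mulLeft ℂ y) = (Ideal.span {y}).restrictScalars ℂ := by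
  ext a
  rw [Submodule.restrictScalars_mem, Ideal.mem_span_singleton', LinearMap.mem_range]
  simp [mul_comm]

variable {O : Type*} [CommRing O] [Algebra ℂ O]

theorem finrank_quotient_map_normMap (I : Ideal O)
    [Module.Finite ℂ (Normalization O ⧸ (I.restrictScalars ℂ).map (normMap O))] :
    Module.finrank ℂ (Normalization O ⧸ (I.restrictScalars ℂ).map (normMap O)) =
      Module.finrank ℂ (Normalization O ⧸ LinearMap.range (normMap O)) +
        Module.finrank ℂ (O ⧸ I) := by
  rw [finrank_quotient_eq_add (normMap O), Submodule.comap_map_eq_of_injective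
    injective_algebraMap_normalization, sup_eq_right.2 LinearMap.map_le_range,
    finrank_restrictScalars_quotient]

variable [IsReduced O] [Algebra (ConvergentSeries 1) O] [IsScalarTower ℂ (ConvergentSeries 1) O]
  [Module.Finite (ConvergentSeries 1) O]

theorem finite_quotient_map_normMap (hx : algebraMap (ConvergentSeries 1) O (coord 0) ∈ O⁰)
    {I : Ideal O} {n : ℕ} (hI : algebraMap (ConvergentSeries 1) O (coord 0) ^ n ∈ I) :
    Module.Finite ℂ (Normalization O ⧸ (I.restrictScalars ℂ).map (normMap O)) := by
  have := finite_normalization_convergentSeries hx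
  obtain ⟨k, hk⟩ := exists_conductor hx
  refine finite_quotient_of_coord_pow_mul_mem (k := n + k) fun z => ?_
  obtain ⟨a, ha⟩ := hk z
  refine ⟨algebraMap (ConvergentSeries 1) O (coord 0) ^ n * a, I.mul_mem_right _ hI, ?_⟩
  change algebraMap O (Normalization O) _ = _
  rw [map_mul, ha, map_pow, ← IsScalarTower.algebraMap_apply, pow_add, mul_assoc]

/-- Compute `dim Ō/yO` through `O` and through `yŌ`. The term `dim Ō/O` occurs in both, since `yŌ/yO
≅ Ō/O`, and cancels. -/
theorem finrank_quotient_span_singleton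
    (hx : algebraMap (ConvergentSeries 1) O (coord 0) ∈ O⁰) {y : O} (hy : y ∈ O⁰) :
    Module.finrank ℂ (O ⧸ Ideal.span {y}) =
      Module.finrank ℂ (Normalization O ⧸ Ideal.span {algebraMap O (Normalization O) y}) := by
  obtain ⟨k, hk⟩ := exists_dvd_pow hx hy
  have hfin := finite_quotient_map_normMap hx (Ideal.mem_span_singleton.2 hk)
  have h1 := finrank_quotient_map_normMap (Ideal.span {y})
  have h2 : ((Ideal.span {y}).restrictScalars ℂ).map (normMap O) =
      (LinearMap.range (normMap O)).map
        (LinearMap.mulLeft ℂ (algebraMap O (Normalization O) y)) := by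
    rw [← range_mulLeft, ← LinearMap.range_comp, ← LinearMap.range_comp]
    congr 1
    ext a
    exact congrArg Subtype.val (map_mul (algebraMap O (Normalization O)) y a)
  rw [h2] at hfin h1
  rw [finrank_quotient_map_eq_add _ (fun a b h =>
    (mul_cancel_left_mem_nonZeroDivisors
      (algebraMap_normalization_mem_nonZeroDivisors hy)).1 h), range_mulLeft,
    finrank_restrictScalars_quotient] at h1
  omega

end Multiplicity

section GoodParameter

variable {O : Type*} [CommRing O] [IsLocalRing O] [Algebra ℂ O]
  [IsReduced O] [Algebra (ConvergentSeries 1) O] [IsScalarTower ℂ (ConvergentSeries 1) O]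
  [Module.Finite (ConvergentSeries 1) O]

/-- After passing to `Ō` this is the inclusion `yŌ ⊆ 𝔪Ō = xŌ`. -/
theorem IsGoodParameter.finrank_quotient_le
    (hx : IsGoodParameter O (algebraMap (ConvergentSeries 1) O (coord 0))) {y : O}
    (hy : y ∈ O⁰) (hym : y ∈ maximalIdeal O) :
    Module.finrank ℂ
      (O ⧸ Ideal.span {algebraMap (ConvergentSeries 1) O (coord 0)}) ≤
      Module.finrank ℂ (O ⧸ Ideal.span {y}) := by
  have hx0 := hx.mem_nonZeroDivisors
  have := finite_normalization_convergentSeries hx0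
  rw [finrank_quotient_span_singleton hx0 hx0, finrank_quotient_span_singleton hx0 hy,
    ← finrank_restrictScalars_quotient, ← finrank_restrictScalars_quotient]
  obtain ⟨k, r, hr⟩ := exists_dvd_pow hx0 hy
  have : Module.Finite ℂ (Normalization O ⧸
      (Ideal.span {algebraMap O (Normalization O) y}).restrictScalars ℂ) := by
    refine finite_quotient_of_coord_pow_mul_mem (k := k) fun z => ?_
    rw [IsScalarTower.algebraMap_apply (ConvergentSeries 1) O (Normalization O), ← map_pow, hr,
      map_mul, mul_assoc]
    exact Ideal.mul_mem_right _ _ (Ideal.mem_span_singleton_self _)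
  refine finrank_quotient_le_of_le ?_
  intro z hz
  have h1 := Ideal.mem_map_of_mem (algebraMap O (Normalization O)) hym
  rw [hx.map_eq] at h1
  exact ((Ideal.span_singleton_le_iff_mem _).2 h1) hz

/-- Let `c n = dim Ō/𝔪ⁿ`. From `𝔪ⁿ ⊆ xⁿŌ` follows `n * e ≤ c n`, and from `x𝔪ⁿ ⊆ 𝔪ⁿ⁺¹` follows `c (n
+ 1) ≤ e + c n`. So `c n - n * e` is a decreasing sequence of naturals, eventually constant, and
`dim O/𝔪ⁿ` differs from `c n` by the constant `dim Ō/O`. -/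
theorem IsGoodParameter.hasMultiplicity
    (hx : IsGoodParameter O (algebraMap (ConvergentSeries 1) O (coord 0))) :
    HasMultiplicity O (Module.finrank ℂ
      (O ⧸ Ideal.span {algebraMap (ConvergentSeries 1) O (coord 0)})) := by
  have hx0 := hx.mem_nonZeroDivisors
  have := finite_normalization_convergentSeries hx0
  rw [finrank_quotient_span_singleton hx0 hx0]
  set x := algebraMap (ConvergentSeries 1) O (coord 0)
  set y := algebraMap O (Normalization O) x with hy
  have hyx : algebraMap (ConvergentSeries 1) (Normalization O) (coord 0) = y := by
    rw [IsScalarTower.algebraMap_apply _ O]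
  set e := Module.finrank ℂ (Normalization O ⧸ Ideal.span {y}) with he
  have hinj : Function.Injective (LinearMap.mulLeft ℂ y) := fun a b h =>
    (mul_cancel_left_mem_nonZeroDivisors
      (algebraMap_normalization_mem_nonZeroDivisors hx0)).1 h
  have hfin : ∀ n, Module.Finite ℂ
      (Normalization O ⧸ ((maximalIdeal O ^ n).restrictScalars ℂ).map (normMap O)) :=
    fun n => finite_quotient_map_normMap hx0 (Ideal.pow_mem_pow hx.mem n)
  have hfin' : ∀ n, Module.Finite ℂ
      (Normalization O ⧸ (Ideal.span {y ^ n}).restrictScalars ℂ) := fun n =>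
    finite_quotient_of_coord_pow_mul_mem (k := n) fun z => by
      rw [hyx]
      exact Ideal.mul_mem_right _ _ (Ideal.mem_span_singleton_self _)
  set c : ℕ → ℕ := fun n => Module.finrank ℂ
    (Normalization O ⧸ ((maximalIdeal O ^ n).restrictScalars ℂ).map (normMap O)) with hc
  have h1 : ∀ n, Module.finrank ℂ
      (Normalization O ⧸ (Ideal.span {y ^ n}).restrictScalars ℂ) = n * e := by
    intro n
    induction n with
    | zero =>
      rw [finrank_restrictScalars_quotient, pow_zero, Ideal.span_singleton_one, zero_mul]
      have : Subsingleton (Normalization O ⧸ (⊤ : Ideal (Normalization O))) :=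
        Ideal.Quotient.subsingleton_iff.2 rfl
      exact Module.finrank_zero_of_subsingleton
    | succ n ih =>
      have h2 : (Ideal.span {y ^ (n + 1)}).restrictScalars ℂ =
          ((Ideal.span {y ^ n}).restrictScalars ℂ).map (LinearMap.mulLeft ℂ y) := by
        rw [← range_mulLeft, ← range_mulLeft, ← LinearMap.range_comp]
        congr 1
        ext a
        simp [pow_succ']
      have := hfin' (n + 1)
      rw [h2] at this ⊢
      rw [finrank_quotient_map_eq_add _ hinj, ih, range_mulLeft, finrank_restrictScalars_quotient]
      ring
  have h2 : ∀ n, n * e ≤ c n := by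
    intro n
    rw [← h1 n]
    refine finrank_quotient_le_of_le ?_
    rintro _ ⟨a, ha, rfl⟩
    have h3 := Ideal.mem_map_of_mem (algebraMap O (Normalization O)) ha
    rw [Ideal.map_pow, hx.map_eq, Ideal.span_singleton_pow] at h3
    exact h3
  have h3 : ∀ n, c (n + 1) ≤ e + c n := by
    intro n
    have h4 : (((maximalIdeal O ^ n).restrictScalars ℂ).map (normMap O)).map
        (LinearMap.mulLeft ℂ y) =
        ((Ideal.span {x} * maximalIdeal O ^ n).restrictScalars ℂ).map (normMap O) := by
      rw [← Submodule.map_comp]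
      ext z
      simp only [Submodule.mem_map, Submodule.restrictScalars_mem,
        Ideal.mem_span_singleton_mul]
      constructor
      · rintro ⟨a, ha, rfl⟩
        exact ⟨x * a, ⟨a, ha, rfl⟩, map_mul (algebraMap O (Normalization O)) x a⟩
      · rintro ⟨_, ⟨a, ha, rfl⟩, rfl⟩
        exact ⟨a, ha, (map_mul (algebraMap O (Normalization O)) x a).symm⟩
    have h5 := finite_quotient_map_normMap (n := n + 1) hx0
      (I := Ideal.span {x} * maximalIdeal O ^ n)
      (by rw [pow_succ']; exact Ideal.mul_mem_mul (Ideal.mem_span_singleton_self _)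
            (Ideal.pow_mem_pow hx.mem n))
    have h6 : ((Ideal.span {x} * maximalIdeal O ^ n).restrictScalars ℂ).map (normMap O) ≤
        ((maximalIdeal O ^ (n + 1)).restrictScalars ℂ).map (normMap O) := by
      refine Submodule.map_mono ?_
      change Ideal.span {x} * maximalIdeal O ^ n ≤ maximalIdeal O ^ (n + 1)
      rw [pow_succ']
      exact Ideal.mul_mono_left ((Ideal.span_singleton_le_iff_mem _).2 hx.mem)
    refine (finrank_quotient_le_of_le h6).trans ?_
    rw [← h4] at h5 ⊢
    rw [finrank_quotient_map_eq_add _ hinj, range_mulLeft, finrank_restrictScalars_quotient]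
  have h4 : Antitone fun n => c n - n * e := by
    refine antitone_nat_of_succ_le fun n => ?_
    have := h2 n
    have := h3 n
    rw [add_mul, one_mul]
    omega
  obtain ⟨a, ha⟩ := exists_eventually_eq_of_antitone h4
  refine ⟨a - Module.finrank ℂ (Normalization O ⧸ LinearMap.range (normMap O)), ?_⟩
  filter_upwards [ha] with n hn
  have h5 := finrank_quotient_map_normMap (maximalIdeal O ^ n)
  have h6 := h2 n
  change c n = _ at h5
  zify [h6] at hn h5
  linarith

end GoodParameter

end

end CurveGerm

/-! ### The weight function and multiplicity at most two. -/

namespace CurveGerm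

noncomputable section

open IsLocalRing
open scoped nonZeroDivisors

section TwoGenerators

theorem exists_forall_sub_mem {A : Type*} [CommRing A] [Algebra ℂ A] {I : Ideal A}
    [Module.Finite ℂ (A ⧸ I)] (h1 : (1 : A) ∉ I) (h2 : Module.finrank ℂ (A ⧸ I) ≤ 2) :
    ∃ w : A, ∀ a, ∃ c d : ℂ, a - (algebraMap ℂ A c + algebraMap ℂ A d * w) ∈ I := by
  have hne : (1 : A ⧸ I) ≠ 0 := fun h => h1 (Ideal.Quotient.eq_zero_iff_mem.1 h)
  have h3 := Submodule.finrank_quotient_add_finrank (ℂ ∙ (1 : A ⧸ I))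
  rw [finrank_span_singleton hne] at h3
  obtain ⟨v, hv⟩ := (finrank_le_one_iff (K := ℂ) (V := (A ⧸ I) ⧸ (ℂ ∙ (1 : A ⧸ I)))).1 (by omega)
  obtain ⟨w, rfl⟩ := Submodule.Quotient.mk_surjective _ v
  obtain ⟨w, rfl⟩ := Ideal.Quotient.mk_surjective w
  refine ⟨w, fun a => ?_⟩
  obtain ⟨d, hd⟩ := hv (Submodule.Quotient.mk (Ideal.Quotient.mk I a))
  rw [← Submodule.Quotient.mk_smul, eq_comm, Submodule.Quotient.eq,
    Submodule.mem_span_singleton] at hd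
  obtain ⟨c, hc⟩ := hd
  refine ⟨c, d, ?_⟩
  rw [← Ideal.Quotient.eq_zero_iff_mem, map_sub, map_add, map_mul]
  rw [Algebra.smul_def, Algebra.smul_def, mul_one] at hc
  change _ - (algebraMap ℂ (A ⧸ I) c + algebraMap ℂ (A ⧸ I) d * _) = 0
  rw [hc]
  ring

/-- Nakayama over `ℂ{t}`: generators `1, w` modulo `t` generate. -/
theorem exists_eq_add_mul_of_sub_mem {A : Type*} [CommRing A] [Algebra ℂ A]
    [Algebra (ConvergentSeries 1) A] [IsScalarTower ℂ (ConvergentSeries 1) A]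
    [Module.Finite (ConvergentSeries 1) A] {w : A}
    (hw : ∀ a, ∃ c d : ℂ, a - (algebraMap ℂ A c + algebraMap ℂ A d * w) ∈
      Ideal.span {algebraMap (ConvergentSeries 1) A (coord 0)}) (a : A) :
    ∃ p q : ConvergentSeries 1,
      a = algebraMap (ConvergentSeries 1) A p + algebraMap (ConvergentSeries 1) A q * w := by
  have h1 : (⊤ : Submodule (ConvergentSeries 1) A) ≤
      Submodule.span (ConvergentSeries 1) {1, w} := by
    refine Submodule.le_of_le_smul_of_le_jacobson_bot (I := maximalIdeal (ConvergentSeries 1))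
      Module.Finite.fg_top (IsLocalRing.maximalIdeal_le_jacobson _) ?_
    rintro a -
    obtain ⟨c, d, h⟩ := hw a
    obtain ⟨b, hb⟩ := Ideal.mem_span_singleton'.1 h
    rw [eq_comm, sub_eq_iff_eq_add'] at hb
    rw [hb]
    refine Submodule.add_mem_sup ?_ ?_
    · rw [Submodule.mem_span_pair]
      refine ⟨algebraMap ℂ _ c, algebraMap ℂ _ d, ?_⟩
      rw [Algebra.smul_def, Algebra.smul_def, ← IsScalarTower.algebraMap_apply,
        ← IsScalarTower.algebraMap_apply, mul_one]
    · rw [mul_comm, ← Algebra.smul_def]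
      exact Submodule.smul_mem_smul (mem_maximalIdeal_iff.2 (evalZero_coord 0)) trivial
  obtain ⟨p, q, h⟩ := Submodule.mem_span_pair.1 (h1 (Submodule.mem_top (x := a)))
  refine ⟨p, q, ?_⟩
  rw [← h, Algebra.smul_def, Algebra.smul_def, mul_one]

end TwoGenerators

section Weight

variable {O : Type*} [CommRing O] [IsLocalRing O] [Algebra ℂ O]
  [IsReduced O] [Algebra (ConvergentSeries 1) O] [IsScalarTower ℂ (ConvergentSeries 1) O]
  [Module.Finite (ConvergentSeries 1) O]

theorem pow_mem_normFiltration {O : Type*} [CommRing O] [IsLocalRing O] {x : O}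
    (hx : x ∈ maximalIdeal O) (l : Lattice O) :
    ∃ k, algebraMap O (Normalization O) x ^ k ∈ normFiltration O l := by
  -- Any bound for all the `l M` would do; the sum is a convenient one.
  refine ⟨∑ M ∈ l.support, l M, ?_⟩
  rw [normFiltration, Ideal.mem_iInf]
  intro M
  have hle : l M ≤ ∑ M ∈ l.support, l M := by
    by_cases hM : M ∈ l.support
    · exact Finset.single_le_sum (f := fun M => l M) (fun _ _ => Nat.zero_le _) hM
    · simp [Finsupp.notMem_support_iff.1 hM]
  exact Ideal.pow_le_pow_right hle
    (Ideal.pow_mem_pow (mem_of_isMaximal_normalization hx M.asIdeal) _)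

theorem finite_quotient_normFiltration (hx : algebraMap (ConvergentSeries 1) O (coord 0) ∈ O⁰)
    (hxm : algebraMap (ConvergentSeries 1) O (coord 0) ∈ maximalIdeal O) (l : Lattice O) :
    Module.Finite ℂ (Normalization O ⧸ (normFiltration O l).restrictScalars ℂ) := by
  have := finite_normalization_convergentSeries hx
  obtain ⟨k, hk⟩ := pow_mem_normFiltration hxm l
  refine finite_quotient_of_coord_pow_mul_mem (k := k) fun a => ?_
  rw [IsScalarTower.algebraMap_apply (ConvergentSeries 1) O (Normalization O)]
  exact Ideal.mul_mem_right _ _ hk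

theorem finrank_quotient_normFiltration
    (hx : algebraMap (ConvergentSeries 1) O (coord 0) ∈ O⁰)
    (hxm : algebraMap (ConvergentSeries 1) O (coord 0) ∈ maximalIdeal O) (l : Lattice O) :
    Module.finrank ℂ (Normalization O ⧸ (normFiltration O l).restrictScalars ℂ) =
      normHilbert O l + hilbert O l := by
  have := finite_quotient_normFiltration hx hxm l
  rw [finrank_quotient_eq_add (normMap O), normHilbert, hilbert,
    ← finrank_restrictScalars_quotient (filtration O l)]
  rfl

theorem one_notMem_span_singleton {O : Type*} [CommRing O] [IsLocalRing O] {x : O}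
    (hx : x ∈ maximalIdeal O) :
    (1 : Normalization O) ∉ Ideal.span {algebraMap O (Normalization O) x} := by
  intro h
  obtain ⟨M, hM⟩ := Ideal.exists_maximal (Normalization O)
  refine hM.ne_top ((Ideal.eq_top_iff_one _).2 ?_)
  exact (Ideal.span_singleton_le_iff_mem _).2 (mem_of_isMaximal_normalization hx M) h

/-- The contraction of `𝔪Ō` contains `𝔪` and is proper, because `x` lies in every maximal ideal of
`Ō`. -/
theorem filtration_eq_maximalIdeal {O : Type*} [CommRing O] [IsLocalRing O] {x : O}
    (hx : IsGoodParameter O x) {l : Lattice O}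
    (hl : normFiltration O l = Ideal.span {algebraMap O (Normalization O) x}) :
    filtration O l = maximalIdeal O := by
  rw [filtration, hl, ← hx.map_eq]
  refine le_antisymm (IsLocalRing.le_maximalIdeal fun h => ?_) Ideal.le_comap_map
  rw [Ideal.comap_eq_top_iff, hx.map_eq, Ideal.eq_top_iff_one] at h
  exact one_notMem_span_singleton hx.mem h

/-- Here `O/F(l) = O/𝔪 = ℂ` has dimension `1`, and the two Hilbert terms add up to `dim Ō/xŌ`, the
colength of `x` in `O`. -/
theorem IsGoodParameter.weight_eq (hO : IsAnalytic O)
    (hx : IsGoodParameter O (algebraMap (ConvergentSeries 1) O (coord 0))) {l : Lattice O}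
    (hl : normFiltration O l = Ideal.span {algebraMap O (Normalization O)
      (algebraMap (ConvergentSeries 1) O (coord 0))}) :
    weight O l = 2 - (Module.finrank ℂ
      (O ⧸ Ideal.span {algebraMap (ConvergentSeries 1) O (coord 0)}) : ℤ) := by
  have h1 := finrank_quotient_normFiltration hx.mem_nonZeroDivisors hx.mem l
  rw [hl, finrank_restrictScalars_quotient,
    ← finrank_quotient_span_singleton hx.mem_nonZeroDivisors hx.mem_nonZeroDivisors] at h1
  have h2 : hilbert O l = 1 := by
    rw [hilbert, filtration_eq_maximalIdeal hx hl]
    refine finrank_eq_one_iff'.2 ⟨1, one_ne_zero, fun a => ?_⟩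
    obtain ⟨a, rfl⟩ := Ideal.Quotient.mk_surjective a
    obtain ⟨c, hc⟩ := hO.exists_sub_mem a
    refine ⟨c, ?_⟩
    rw [Algebra.smul_def, mul_one, eq_comm, ← sub_eq_zero]
    exact Ideal.Quotient.eq_zero_iff_mem.2 hc
  rw [weight, h1, h2]
  push_cast
  ring

/-- With `Ō = D + Dw` and `F = F̄(l)`, `dim Ō/(F + O) ≤ dim Ō/(F + D) ≤ dim D/(F ∩ D)`. The last two
dimensions add up to `dim Ō/F`, the sum of the two Hilbert terms, so the subtracted term is at most
half of it. -/
theorem weight_nonneg (hx : algebraMap (ConvergentSeries 1) O (coord 0) ∈ O⁰)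
    (hxm : algebraMap (ConvergentSeries 1) O (coord 0) ∈ maximalIdeal O)
    (he : Module.finrank ℂ (O ⧸ Ideal.span {algebraMap (ConvergentSeries 1) O (coord 0)}) ≤ 2)
    (l : Lattice O) : 0 ≤ weight O l := by
  have := finite_normalization_convergentSeries hx
  have hfin := finite_quotient_normFiltration hx hxm l
  rw [finrank_quotient_span_singleton hx hx, ← IsScalarTower.algebraMap_apply] at he
  have hfin1 : Module.Finite ℂ (Normalization O ⧸ Ideal.span
      {algebraMap (ConvergentSeries 1) (Normalization O) (coord 0)}) :=
    finite_quotient_of_coord_pow_mem (k := 1) (by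
      rw [pow_one]; exact Ideal.mem_span_singleton_self _)
  have h1 : (1 : Normalization O) ∉ Ideal.span
      {algebraMap (ConvergentSeries 1) (Normalization O) (coord 0)} := by
    rw [IsScalarTower.algebraMap_apply _ O]
    exact one_notMem_span_singleton hxm
  obtain ⟨w, hw⟩ := exists_forall_sub_mem h1 he
  replace hw := exists_eq_add_mul_of_sub_mem hw
  set F := (normFiltration O l).restrictScalars ℂ with hF
  let j : ConvergentSeries 1 →ₗ[ℂ] Normalization O :=
    (IsScalarTower.toAlgHom ℂ (ConvergentSeries 1) (Normalization O)).toLinearMap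
  have h2 := finrank_quotient_normFiltration hx hxm l
  have h3 := finrank_quotient_eq_add j F
  have h4 : normHilbert O l ≤ Module.finrank ℂ (Normalization O ⧸ (F ⊔ LinearMap.range j)) := by
    have : Module.Finite ℂ (Normalization O ⧸ (F ⊔ LinearMap.range j)) :=
      Module.Finite.of_surjective _ (Submodule.factor_surjective
        (le_sup_left : F ≤ F ⊔ LinearMap.range j))
    refine finrank_quotient_le_of_le (sup_le_sup le_rfl ?_)
    rintro _ ⟨d, rfl⟩
    exact ⟨algebraMap _ O d, (IsScalarTower.algebraMap_apply (ConvergentSeries 1) O _ d).symm⟩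
  -- Multiplication by `w` induces the surjection `D/(F ∩ D) → Ō/(F + D)`.
  have h5 : Module.finrank ℂ (Normalization O ⧸ (F ⊔ LinearMap.range j)) ≤
      Module.finrank ℂ (ConvergentSeries 1 ⧸ F.comap j) := by
    have : Module.Finite ℂ (ConvergentSeries 1 ⧸ F.comap j) :=
      Module.Finite.of_injective ((F.comap j).mapQ F j le_rfl) (by
        rw [← LinearMap.ker_eq_bot, Submodule.ker_mapQ]
        simp)
    have hle : F.comap j ≤ (F ⊔ LinearMap.range j).comap (LinearMap.mulRight ℂ w ∘ₗ j) :=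
      fun d hd => Submodule.mem_sup_left (Ideal.mul_mem_right w _ hd)
    refine LinearMap.finrank_le_finrank_of_surjective
      (f := (F.comap j).mapQ (F ⊔ LinearMap.range j) (LinearMap.mulRight ℂ w ∘ₗ j) hle) ?_
    intro z
    obtain ⟨z, rfl⟩ := Submodule.Quotient.mk_surjective _ z
    obtain ⟨p, q, rfl⟩ := hw z
    refine ⟨Submodule.Quotient.mk q, ?_⟩
    rw [Submodule.mapQ_apply, eq_comm, Submodule.Quotient.eq]
    refine Submodule.mem_sup_right ⟨p, ?_⟩
    exact (add_sub_cancel_right _ _).symm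
  rw [← hF, h3] at h2
  rw [weight]
  omega

theorem weight_zero {O : Type*} [CommRing O] [Algebra ℂ O] : weight O 0 = 0 := by
  have h : normFiltration O 0 = ⊤ := by simp [normFiltration]
  have h1 : hilbert O 0 = 0 := by
    have : Subsingleton (O ⧸ filtration O 0) :=
      Ideal.Quotient.subsingleton_iff.2 (by rw [filtration, h, Ideal.comap_top])
    exact Module.finrank_zero_of_subsingleton
  have h2 : normHilbert O 0 = 0 := by
    rw [normHilbert, h]
    have : Subsingleton (Normalization O ⧸ ((⊤ : Ideal (Normalization O)).restrictScalars ℂ ⊔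
        LinearMap.range (normMap O))) :=
      Submodule.Quotient.subsingleton_iff.2 (by simp)
    exact Module.finrank_zero_of_subsingleton
  rw [weight, h1, h2]
  rfl

theorem IsGoodParameter.isLeast_weight_iff (hO : IsAnalytic O)
    (hx : IsGoodParameter O (algebraMap (ConvergentSeries 1) O (coord 0))) :
    IsLeast (Set.range (weight O)) 0 ↔ Module.finrank ℂ
      (O ⧸ Ideal.span {algebraMap (ConvergentSeries 1) O (coord 0)}) ≤ 2 := by
  constructor
  · rintro ⟨-, h⟩
    obtain ⟨l, hl⟩ := hx.exists_filtration
    have h1 := h ⟨l, rfl⟩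
    rw [hx.weight_eq hO hl] at h1
    omega
  · intro he
    refine ⟨⟨0, weight_zero⟩, ?_⟩
    rintro _ ⟨l, rfl⟩
    exact weight_nonneg hx.mem_nonZeroDivisors hx.mem he l

end Weight

end

end CurveGerm

/-! ### Germs of type `A_n` and birational domination. -/

namespace CurveGerm

noncomputable section

open IsLocalRing
open scoped nonZeroDivisors

section AType

variable {A : Type*} [CommRing A] [Algebra ℂ A] {n : ℕ}

/-- A surjection from `ℂ{x, y}` with kernel generated by `x ^ (n + 1) + y ^ 2`. -/
structure IsATypePresentation (n : ℕ) (π : ConvergentSeries 2 →ₐ[ℂ] A) : Prop where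
  surjective : Function.Surjective π
  map_eq_zero_iff : ∀ f, π f = 0 ↔ coord 0 ^ (n + 1) + coord 1 ^ 2 ∣ f

variable {π : ConvergentSeries 2 →ₐ[ℂ] A}

namespace IsATypePresentation

theorem isAnalytic (h : IsATypePresentation n π) : IsAnalytic A := ⟨2, π, h.surjective⟩

theorem sq_eq (h : IsATypePresentation n π) : π (coord 1) ^ 2 = -π (coord 0) ^ (n + 1) := by
  rw [eq_neg_iff_add_eq_zero, add_comm, ← map_pow, ← map_pow, ← map_add, h.map_eq_zero_iff]

/-- Suppose `x * g = (x ^ (n + 1) + y ^ 2) * r`. Then `x ∣ y ^ 2 * r`, so `x ∣ r`, and `x` cancels.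
-/
theorem mem_nonZeroDivisors (h : IsATypePresentation n π) : π (coord 0) ∈ A⁰ := by
  rw [mem_nonZeroDivisors_iff_right]
  intro g hg
  obtain ⟨g, rfl⟩ := h.surjective g
  rw [← map_mul, h.map_eq_zero_iff] at hg
  obtain ⟨r, hr⟩ := hg
  have hdvd : coord 0 ∣ r := by
    have h1 : coord 0 ∣ coord 1 ^ 2 * r :=
      ⟨g - coord 0 ^ n * r, by linear_combination -hr⟩
    rw [coord_dvd_iff] at h1 ⊢
    intro d hd
    have h2 := h1 (Finsupp.single 1 2 + d) (by simp [hd])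
    rw [← h2]
    change _ = MvPowerSeries.coeff _ (MvPowerSeries.X 1 ^ 2 * r.1)
    rw [MvPowerSeries.X_pow_eq, MvPowerSeries.coeff_add_monomial_mul, one_mul]
  obtain ⟨r, rfl⟩ := hdvd
  rw [h.map_eq_zero_iff]
  refine ⟨r, mul_left_cancel₀ (coord_ne_zero 0) ?_⟩
  rw [mul_comm, hr]
  ring

variable [IsLocalRing A]

theorem maximalIdeal_eq (h : IsATypePresentation n π) :
    maximalIdeal A = Ideal.span {π (coord 0), π (coord 1)} := by
  rw [maximalIdeal_eq_map_of_surjective h.surjective, map_maximalIdeal_eq_span]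
  congr 1
  ext z
  simp [Fin.exists_fin_two, eq_comm]

theorem mul_mem (h : IsATypePresentation n π) {a : A} (ha : a ∈ maximalIdeal A) :
    π (coord 1) * a ∈ Ideal.span {π (coord 0)} := by
  rw [h.maximalIdeal_eq, Ideal.mem_span_pair] at ha
  obtain ⟨b, c, rfl⟩ := ha
  rw [Ideal.mem_span_singleton']
  refine ⟨π (coord 1) * b - c * π (coord 0) ^ n, ?_⟩
  linear_combination (-c) * h.sq_eq

theorem exists_sub_mem (h : IsATypePresentation n π) (a : A) : ∃ c d : ℂ,
    a - (algebraMap ℂ A c + algebraMap ℂ A d * π (coord 1)) ∈ Ideal.span {π (coord 0)} := by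
  obtain ⟨c, hc⟩ := h.isAnalytic.exists_sub_mem a
  rw [h.maximalIdeal_eq, Ideal.mem_span_pair] at hc
  obtain ⟨f, g, hfg⟩ := hc
  obtain ⟨d, hd⟩ := h.isAnalytic.exists_sub_mem g
  refine ⟨c, d, ?_⟩
  have h1 := Ideal.add_mem _ (Ideal.mul_mem_left _ f (Ideal.mem_span_singleton_self _))
    (h.mul_mem hd)
  convert h1 using 1
  linear_combination -hfg

theorem maximalIdeal_sq_le (h : IsATypePresentation n π) :
    maximalIdeal A ^ 2 ≤ Ideal.span {π (coord 0)} := by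
  rw [pow_two, Ideal.mul_le]
  intro a ha b hb
  rw [h.maximalIdeal_eq, Ideal.mem_span_pair] at ha
  obtain ⟨c, d, rfl⟩ := ha
  have h1 := Ideal.add_mem _ (Ideal.mul_mem_left _ (c * b) (Ideal.mem_span_singleton_self _))
    (Ideal.mul_mem_left _ d (h.mul_mem hb))
  convert h1 using 1
  ring

theorem finite_quotient (h : IsATypePresentation n π) :
    Module.Finite ℂ (A ⧸ Ideal.span {π (coord 0)}) ∧
      Module.finrank ℂ (A ⧸ Ideal.span {π (coord 0)}) ≤ 2 := by
  classical
  have h1 : Submodule.span ℂ (({1, Ideal.Quotient.mk _ (π (coord 1))} :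
      Finset (A ⧸ Ideal.span {π (coord 0)})) : Set (A ⧸ Ideal.span {π (coord 0)})) = ⊤ := by
    rw [eq_top_iff]
    rintro a -
    obtain ⟨a, rfl⟩ := Ideal.Quotient.mk_surjective a
    obtain ⟨c, d, hcd⟩ := h.exists_sub_mem a
    rw [Finset.coe_pair, Submodule.mem_span_pair]
    refine ⟨c, d, ?_⟩
    rw [← Ideal.Quotient.eq_zero_iff_mem, map_sub, sub_eq_zero] at hcd
    rw [hcd, map_add, map_mul, Algebra.smul_def, Algebra.smul_def, mul_one]
    rfl
  refine ⟨⟨⟨_, h1⟩⟩, ?_⟩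
  have h2 := finrank_span_finset_le_card (R := ℂ) ({1, Ideal.Quotient.mk _ (π (coord 1))} :
      Finset (A ⧸ Ideal.span {π (coord 0)}))
  rw [Set.finrank, h1, finrank_top] at h2
  exact h2.trans Finset.card_le_two

/-- `𝔪² ⊆ (x)` makes `x` a parameter, and `1, y` span modulo `x`, hence over `ℂ{x}`. -/
theorem exists_finite_algHom (h : IsATypePresentation n π) :
    ∃ ρ : ConvergentSeries 1 →ₐ[ℂ] A,
      ρ (coord 0) = π (coord 0) ∧ ρ.toRingHom.Finite ∧
        ∀ a, ∃ p q, a = ρ p + ρ q * π (coord 1) := by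
  obtain ⟨ρ, hρ, hfin⟩ := h.isAnalytic.exists_finite_algHom
    (h.isAnalytic.map_coord_mem π 0) h.maximalIdeal_sq_le
  refine ⟨ρ, hρ, hfin, ?_⟩
  let := ρ.toRingHom.toAlgebra
  have : IsScalarTower ℂ (ConvergentSeries 1) A :=
    IsScalarTower.of_algebraMap_eq fun c => (ρ.commutes c).symm
  have : Module.Finite (ConvergentSeries 1) A := hfin
  refine exists_eq_add_mul_of_sub_mem fun a => ?_
  have h1 : algebraMap (ConvergentSeries 1) A (coord 0) = π (coord 0) := hρ
  rw [h1]
  exact h.exists_sub_mem a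

end IsATypePresentation

instance (n : ℕ) : IsLocalRing (AType n) :=
  have : Nontrivial (AType n) := by
    refine Ideal.Quotient.nontrivial_iff.2 fun h => ?_
    rw [Ideal.span_singleton_eq_top] at h
    exact isUnit_iff.1 h (by simp)
  IsLocalRing.of_surjective' (Ideal.Quotient.mk _) Ideal.Quotient.mk_surjective

theorem isATypePresentation_mkₐ (n : ℕ) :
    IsATypePresentation (A := AType n) n (Ideal.Quotient.mkₐ ℂ _) where
  surjective := Ideal.Quotient.mkₐ_surjective ℂ _
  map_eq_zero_iff _ := Ideal.Quotient.eq_zero_iff_mem.trans Ideal.mem_span_singleton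

end AType

section Domination

/-- The same two-way count as for the normalization, now for any subring `B` of `R` that contains `t
^ k R`. -/
theorem finrank_quotient_span_singleton_of_injective {B R : Type*}
    [CommRing B] [Algebra ℂ B] [CommRing R] [Algebra ℂ R] [Algebra (ConvergentSeries 1) R]
    [IsScalarTower ℂ (ConvergentSeries 1) R] [Module.Finite (ConvergentSeries 1) R]
    {ψ : B →ₐ[ℂ] R} (hψ : Function.Injective ψ) {x : B}
    (hx : ψ x = algebraMap (ConvergentSeries 1) R (coord 0)) (hxR : ψ x ∈ R⁰) {k : ℕ}
    (hk : ∀ z, algebraMap (ConvergentSeries 1) R (coord 0) ^ k * z ∈ ψ.range) :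
    Module.finrank ℂ (B ⧸ Ideal.span {x}) = Module.finrank ℂ (R ⧸ Ideal.span {ψ x}) := by
  have h2 : ((Ideal.span {x}).restrictScalars ℂ).map ψ.toLinearMap =
      (LinearMap.range ψ.toLinearMap).map (LinearMap.mulLeft ℂ (ψ x)) := by
    rw [← range_mulLeft, ← LinearMap.range_comp, ← LinearMap.range_comp]
    congr 1
    ext a
    exact map_mul ψ x a
  have hfin : Module.Finite ℂ (R ⧸ ((Ideal.span {x}).restrictScalars ℂ).map ψ.toLinearMap) := by
    refine finite_quotient_of_coord_pow_mul_mem (k := k + 1) fun z => ?_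
    obtain ⟨b, hb⟩ := hk z
    refine ⟨x * b, Ideal.mul_mem_right _ _ (Ideal.mem_span_singleton_self _), ?_⟩
    change ψ (x * b) = _
    rw [map_mul, hx, pow_succ', mul_assoc]
    exact congrArg _ hb
  have h1 := finrank_quotient_eq_add ψ.toLinearMap
    (((Ideal.span {x}).restrictScalars ℂ).map ψ.toLinearMap)
  rw [Submodule.comap_map_eq_of_injective hψ, sup_eq_right.2 LinearMap.map_le_range,
    finrank_restrictScalars_quotient, h2] at h1
  rw [h2] at hfin
  rw [finrank_quotient_map_eq_add _ (fun a b h =>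
    (mul_cancel_left_mem_nonZeroDivisors hxR).1 h), range_mulLeft,
    finrank_restrictScalars_quotient] at h1
  omega

/-- Both `A` and the intermediate ring `O` have the same colength for the coordinate `x`, namely
that of `x` in the normalization of `A`; for `A` it is at most `2`. -/
theorem BirationallyDominates.exists_finrank_le {O A : Type*} [CommRing O] [IsLocalRing O]
    [Algebra ℂ O] [IsReduced O] [CommRing A] [IsLocalRing A] [Algebra ℂ A]
    (h : BirationallyDominates O A) {n : ℕ} {π : ConvergentSeries 2 →ₐ[ℂ] A}
    (hπ : IsATypePresentation n π) :
    ∃ x ∈ maximalIdeal O, x ∈ O⁰ ∧ Module.finrank ℂ (O ⧸ Ideal.span {x}) ≤ 2 := by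
  obtain ⟨φ, ψ, hφ, hψ, hφψ⟩ := h
  have : IsReduced A := isReduced_of_injective φ hφ
  obtain ⟨ρ, hρ, hfin, -⟩ := hπ.exists_finite_algHom
  let := ρ.toRingHom.toAlgebra
  have : IsScalarTower ℂ (ConvergentSeries 1) A :=
    IsScalarTower.of_algebraMap_eq fun c => (ρ.commutes c).symm
  have : Module.Finite (ConvergentSeries 1) A := hfin
  have hρ' : algebraMap (ConvergentSeries 1) A (coord 0) = π (coord 0) := hρ
  have hx := hπ.mem_nonZeroDivisors
  have hx' := hx
  rw [← hρ'] at hx'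
  have := finite_normalization_convergentSeries hx'
  have hψφ : ∀ a, ψ (φ a) = algebraMap A (Normalization A) a :=
    fun a => DFunLike.congr_fun hφψ a
  have hψx : ψ (φ (π (coord 0))) =
      algebraMap (ConvergentSeries 1) (Normalization A) (coord 0) := by
    rw [hψφ, ← hρ', ← IsScalarTower.algebraMap_apply]
  have hxR : ψ (φ (π (coord 0))) ∈ (Normalization A)⁰ := by
    rw [hψφ]
    exact algebraMap_normalization_mem_nonZeroDivisors hx
  obtain ⟨k, hk⟩ := exists_conductor hx'
  have h1 := finrank_quotient_span_singleton_of_injective hψ hψx hxR (k := k) fun z => by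
    obtain ⟨a, ha⟩ := hk z
    exact ⟨φ a, (hψφ a).trans ha⟩
  have h2 := finrank_quotient_span_singleton hx' hx
  rw [hψφ, ← h2] at h1
  obtain ⟨hf, hf2⟩ := hπ.finite_quotient
  refine ⟨φ (π (coord 0)), fun hu => ?_, ?_, h1 ▸ hf2⟩
  -- A unit would have colength `0` in `O`, hence in `A`, where the coordinate is not a unit. Finite
  -- dimensionality of the quotient of `A` is needed to read `finrank = 0` as triviality.
  · rw [Ideal.span_singleton_eq_top.2 hu] at h1
    have : Subsingleton (O ⧸ (⊤ : Ideal O)) := Ideal.Quotient.subsingleton_iff.2 rfl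
    rw [Module.finrank_zero_of_subsingleton, eq_comm, Module.finrank_zero_iff,
      Ideal.Quotient.subsingleton_iff] at h1
    exact hπ.isAnalytic.map_coord_mem π 0 (Ideal.span_singleton_eq_top.1 h1)
  · rw [mem_nonZeroDivisors_iff_right]
    intro z hz
    refine hψ ?_
    rw [map_zero]
    refine (mem_nonZeroDivisors_iff_right.1 hxR) _ ?_
    rw [← map_mul, hz, map_zero]

theorem BirationallyDominates.of_isAType {O : Type*} [CommRing O] [Algebra ℂ O] {n : ℕ}
    (h : IsAType O n) : BirationallyDominates O (AType n) := by
  obtain ⟨e⟩ := h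
  refine ⟨e.symm.toAlgHom, (IsScalarTower.toAlgHom ℂ (AType n) _).comp e.toAlgHom,
    e.symm.injective, injective_algebraMap_normalization.comp e.injective, ?_⟩
  ext a
  simp

end Domination

end

end CurveGerm

/-! ### The normal form in multiplicity at most two. -/

namespace CurveGerm

noncomputable section

open IsLocalRing
open scoped nonZeroDivisors

section MultiplicityTwo

variable {O : Type*} [CommRing O] [IsLocalRing O] [Algebra (ConvergentSeries 1) O]

theorem isUnit_of_isUnit_algebraMap
    (hxm : algebraMap (ConvergentSeries 1) O (coord 0) ∈ maximalIdeal O)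
    {d : ConvergentSeries 1} (hd : IsUnit (algebraMap (ConvergentSeries 1) O d)) : IsUnit d := by
  by_cases h0 : d = 0
  · rw [h0, map_zero] at hd
    exact absurd hd not_isUnit_zero
  obtain ⟨n, u, hu, rfl⟩ := exists_eq_coord_pow_mul_unit h0
  rw [map_mul, map_pow] at hd
  rcases Nat.eq_zero_or_pos n with rfl | hn
  · simpa using hu
  · exact absurd (isUnit_of_mul_isUnit_left hd)
      (Ideal.pow_mem_of_mem _ hxm n hn)

/-- In a valuation ring one of `p, q` divides the other. Cancelling the divisor leaves `r + w = 0`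
or `1 + r * w = 0`; in the latter `r` is a unit, so in both cases `w` would come from `ℂ{t}`. -/
theorem eq_zero_of_add_mul_eq_zero
    (hx : algebraMap (ConvergentSeries 1) O (coord 0) ∈ O⁰)
    (hxm : algebraMap (ConvergentSeries 1) O (coord 0) ∈ maximalIdeal O) {w : O}
    (hw : w ∉ (algebraMap (ConvergentSeries 1) O).range) {p q : ConvergentSeries 1}
    (h : algebraMap (ConvergentSeries 1) O p + algebraMap (ConvergentSeries 1) O q * w = 0) :
    p = 0 ∧ q = 0 := by
  have hreg : ∀ (d : ConvergentSeries 1) (a : O), d ≠ 0 →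
      algebraMap (ConvergentSeries 1) O d * a = 0 → a = 0 := fun d a hd =>
    (mem_nonZeroDivisors_iff.1 (algebraMap_mem_nonZeroDivisors hx hd)).1 a
  rcases ValuationRing.dvd_total q p with ⟨r, rfl⟩ | ⟨r, rfl⟩
  · by_contra hq
    have h1 := hreg q (algebraMap _ O r + w) (fun h0 => hq (by simp [h0]))
      (by rw [map_mul] at h; linear_combination h)
    exact hw ⟨-r, by rw [map_neg]; linear_combination -h1⟩
  · by_contra hp
    have h1 := hreg p (1 + algebraMap _ O r * w) (fun h0 => hp (by simp [h0]))
      (by rw [map_mul] at h; linear_combination h)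
    have h2 : IsUnit (algebraMap (ConvergentSeries 1) O r) :=
      IsUnit.of_mul_eq_one (-w) (by linear_combination -h1)
    obtain ⟨s, hs⟩ := (isUnit_of_isUnit_algebraMap hxm h2).exists_right_inv
    have h3 : algebraMap (ConvergentSeries 1) O r * algebraMap (ConvergentSeries 1) O s = 1 := by
      rw [← map_mul, hs, map_one]
    exact hw ⟨-s, by
      rw [map_neg]
      linear_combination (-algebraMap (ConvergentSeries 1) O s) * h1 + w * h3⟩

/-- Completing the square in the quadratic equation of `w`. -/
theorem exists_sq_eq_algebraMap {O : Type*} [CommRing O] [Algebra (ConvergentSeries 1) O] {w : O}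
    (hgen : ∀ a, ∃ p q : ConvergentSeries 1,
      a = algebraMap (ConvergentSeries 1) O p + algebraMap (ConvergentSeries 1) O q * w) :
    ∃ y, (∃ b : ConvergentSeries 1, w = algebraMap (ConvergentSeries 1) O b + y) ∧
      ∃ c : ConvergentSeries 1, y ^ 2 = algebraMap (ConvergentSeries 1) O c := by
  obtain ⟨a, b, hab⟩ := hgen (w ^ 2)
  have h2 : algebraMap (ConvergentSeries 1) O (algebraMap ℂ _ (1 / 2)) * 2 = 1 := by
    rw [← map_ofNat (algebraMap (ConvergentSeries 1) O) 2, ← map_mul,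
      ← map_ofNat (algebraMap ℂ (ConvergentSeries 1)) 2, ← map_mul]
    norm_num
  set r := algebraMap (ConvergentSeries 1) O (algebraMap ℂ _ (1 / 2)) with hr
  refine ⟨w - r * algebraMap _ O b, ⟨algebraMap ℂ _ (1 / 2) * b, ?_⟩,
    a + (algebraMap ℂ _ (1 / 2) * b) ^ 2, ?_⟩
  · rw [map_mul]
    ring
  · rw [map_add, map_pow, map_mul, ← hr]
    linear_combination hab - w * algebraMap _ O b * h2

/-- The factors `y - v` and `y + v` differ by the unit `2 * v`, so in a local ring one is invertible
and the other vanishes. -/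
theorem mem_range_of_sq_eq_sq {O D : Type*} [CommRing O] [IsLocalRing O] [CommRing D]
    [Algebra D O] (h2 : IsUnit (2 : O)) {y : O} {v : D} (hv : IsUnit v)
    (h : y ^ 2 = algebraMap D O v ^ 2) : y ∈ (algebraMap D O).range := by
  have h1 : (y - algebraMap D O v) * (y + algebraMap D O v) = 0 := by linear_combination h
  have h3 : IsUnit ((y + algebraMap D O v) + -(y - algebraMap D O v)) := by
    have h4 : (y + algebraMap D O v) + -(y - algebraMap D O v) = 2 * algebraMap D O v := by ring
    rw [h4]
    exact h2.mul (hv.map _)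
  rcases IsLocalRing.isUnit_or_isUnit_of_isUnit_add h3 with h5 | h5
  · exact ⟨v, (sub_eq_zero.1 ((h5.mul_left_eq_zero).1 h1)).symm⟩
  · exact ⟨-v, by
      rw [map_neg]
      linear_combination -((IsUnit.neg_iff _).1 h5).mul_right_eq_zero.1 h1⟩

variable [IsReduced O]

/-- After completing the square, `y ^ 2 = t ^ m * u` with `u` a unit; here the right side is nonzero
because `O` is reduced. Dividing `y` by a square root of `-u` normalizes the equation. -/
theorem exists_sq_eq_neg_pow {w : O}
    (hw : w ∉ (algebraMap (ConvergentSeries 1) O).range)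
    (hgen : ∀ a, ∃ p q : ConvergentSeries 1,
      a = algebraMap (ConvergentSeries 1) O p + algebraMap (ConvergentSeries 1) O q * w) :
    ∃ (n : ℕ) (y : O), y ^ 2 = -algebraMap (ConvergentSeries 1) O (coord 0) ^ (n + 1) ∧
      (∀ a, ∃ p q : ConvergentSeries 1,
        a = algebraMap (ConvergentSeries 1) O p + algebraMap (ConvergentSeries 1) O q * y) ∧
      y ∉ (algebraMap (ConvergentSeries 1) O).range := by
  obtain ⟨y, ⟨b, hb⟩, c, hc⟩ := exists_sq_eq_algebraMap hgen
  have hy : y ∉ (algebraMap (ConvergentSeries 1) O).range := by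
    rintro ⟨d, rfl⟩
    exact hw ⟨b + d, by rw [hb, map_add]⟩
  have hc0 : c ≠ 0 := by
    rintro rfl
    rw [map_zero] at hc
    exact hy ⟨0, by rw [map_zero, pow_eq_zero_iff two_ne_zero |>.1 hc]⟩
  obtain ⟨m, u, hu, rfl⟩ := exists_eq_coord_pow_mul_unit hc0
  obtain ⟨v, hv⟩ := exists_sq_eq_of_isUnit hu.neg
  have hvu : IsUnit v := (isUnit_pow_iff two_ne_zero).1 (hv ▸ hu.neg)
  obtain ⟨s, hs⟩ := hvu.exists_right_inv
  have hs' : algebraMap (ConvergentSeries 1) O v * algebraMap (ConvergentSeries 1) O s = 1 := by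
    rw [← map_mul, hs, map_one]
  have hv' : algebraMap (ConvergentSeries 1) O v ^ 2 = -algebraMap (ConvergentSeries 1) O u := by
    rw [← map_pow, hv, map_neg]
  rw [map_mul, map_pow] at hc
  have hy2 : (algebraMap (ConvergentSeries 1) O s * y) ^ 2 =
      -algebraMap (ConvergentSeries 1) O (coord 0) ^ m := by
    linear_combination (algebraMap (ConvergentSeries 1) O s) ^ 2 * hc +
      algebraMap (ConvergentSeries 1) O (coord 0) ^ m *
        (algebraMap (ConvergentSeries 1) O s) ^ 2 * hv' -
      algebraMap (ConvergentSeries 1) O (coord 0) ^ m *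
        (algebraMap (ConvergentSeries 1) O v * algebraMap (ConvergentSeries 1) O s + 1) * hs'
  have hy3 : algebraMap (ConvergentSeries 1) O s * y ∉
      (algebraMap (ConvergentSeries 1) O).range := by
    rintro ⟨d, hd⟩
    refine hy ⟨v * d, ?_⟩
    rw [map_mul, hd]
    linear_combination y * hs'
  rcases m with _ | n
  -- Exponent zero would give `y ^ 2 = -1`, whence `y = ± i` would come from `ℂ{t}`.
  · exfalso
    have hI : (algebraMap ℂ (ConvergentSeries 1) Complex.I) ^ 2 = -1 := by
      rw [← map_pow, Complex.I_sq, map_neg, map_one]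
    have h2 : IsUnit (2 : O) := by
      rw [← map_ofNat (algebraMap (ConvergentSeries 1) O) 2,
        ← map_ofNat (algebraMap ℂ (ConvergentSeries 1)) 2]
      exact ((isUnit_iff_ne_zero.2 two_ne_zero).map _).map _
    refine hy3 (mem_range_of_sq_eq_sq h2
      (v := algebraMap ℂ (ConvergentSeries 1) Complex.I) ?_ ?_)
    · exact (isUnit_iff_ne_zero.2 Complex.I_ne_zero).map _
    · rw [hy2, pow_zero, ← map_pow, hI, map_neg, map_one]
  · refine ⟨n, _, hy2, fun a => ?_, hy3⟩
    obtain ⟨p, q, rfl⟩ := hgen a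
    -- The original generator is `w = b + v * (s * y)`, where `s` is the inverse of `v`.
    refine ⟨p + q * b, q * v, ?_⟩
    rw [map_add, map_mul, map_mul, hb]
    linear_combination (-algebraMap _ O q * y) * hs'

end MultiplicityTwo

section NormalForm

variable {O : Type*} [CommRing O] [IsLocalRing O] [Algebra ℂ O]

theorem isAType_of_surjective {O : Type*} [CommRing O] [Algebra ℂ O] {n : ℕ}
    {π : ConvergentSeries 2 →ₐ[ℂ] O} (h : IsATypePresentation n π) : IsAType O n := by
  have hker : RingHom.ker π = Ideal.span {coord 0 ^ (n + 1) + coord 1 ^ 2} := by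
    ext f
    rw [RingHom.mem_ker, h.map_eq_zero_iff, Ideal.mem_span_singleton]
  exact ⟨((Ideal.quotientEquivAlgOfEq ℂ hker.symm).trans
    (Ideal.quotientKerAlgEquivOfSurjective h.surjective)).symm⟩

/-- The model is spanned by `1, y` over `ℂ{t}`, and their images form a basis of `O`. So the induced
map from the model is bijective. -/
theorem isATypePresentation_of_eq (hO : IsAnalytic O) [IsNoetherianRing O]
    [Algebra (ConvergentSeries 1) O]
    [IsScalarTower ℂ (ConvergentSeries 1) O] {n : ℕ} {π : ConvergentSeries 2 →ₐ[ℂ] O}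
    (h0 : π (coord 0) = algebraMap (ConvergentSeries 1) O (coord 0))
    (h : π (coord 1) ^ 2 = -π (coord 0) ^ (n + 1))
    (hgen : ∀ a, ∃ p q : ConvergentSeries 1, a = algebraMap (ConvergentSeries 1) O p +
      algebraMap (ConvergentSeries 1) O q * π (coord 1))
    (hind : ∀ p q : ConvergentSeries 1, algebraMap (ConvergentSeries 1) O p +
      algebraMap (ConvergentSeries 1) O q * π (coord 1) = 0 → p = 0 ∧ q = 0) :
    IsATypePresentation n π := by
  have hF : π (coord 0 ^ (n + 1) + coord 1 ^ 2) = 0 := by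
    rw [map_add, map_pow, map_pow, h]
    ring
  have hP := isATypePresentation_mkₐ n
  set κ := Ideal.Quotient.mkₐ ℂ (Ideal.span {coord 0 ^ (n + 1) + coord 1 ^ 2} :
    Ideal (ConvergentSeries 2))
  obtain ⟨ρ, hρ, -, hρg⟩ := hP.exists_finite_algHom
  let θ : AType n →ₐ[ℂ] O := Ideal.Quotient.liftₐ _ π fun a ha => by
    obtain ⟨b, rfl⟩ := Ideal.mem_span_singleton'.1 ha
    rw [map_mul, hF, mul_zero]
  have hθ : ∀ f, θ (κ f) = π f := fun f => rfl
  -- Both homomorphisms send `t` to the same element, and the image of the coordinate determines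
  -- them.
  have hθρ : θ.comp ρ = IsScalarTower.toAlgHom ℂ (ConvergentSeries 1) O := by
    refine hO.algHom_ext fun i => ?_
    rw [Subsingleton.elim i 0, AlgHom.comp_apply, hρ, hθ, h0]
    rfl
  have hθρ' : ∀ d, θ (ρ d) = algebraMap (ConvergentSeries 1) O d :=
    fun d => DFunLike.congr_fun hθρ d
  refine ⟨fun a => ?_, fun f => ⟨fun hf => ?_, ?_⟩⟩
  · obtain ⟨p, q, rfl⟩ := hgen a
    obtain ⟨f, hf⟩ := hP.surjective (ρ p + ρ q * κ (coord 1))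
    refine ⟨f, ?_⟩
    rw [← hθ, hf, map_add, map_mul, hθρ', hθρ', hθ]
  · obtain ⟨p, q, hpq⟩ := hρg (κ f)
    rw [← hθ, hpq, map_add, map_mul, hθρ', hθρ', hθ] at hf
    obtain ⟨rfl, rfl⟩ := hind p q hf
    rw [← hP.map_eq_zero_iff]
    change κ f = 0
    rw [hpq, map_zero, zero_mul, add_zero]
  · rintro ⟨g, rfl⟩
    rw [map_mul, hF, zero_mul]

/-- `A_0` is `x + y ^ 2 = 0`, so the uniformizer must play the role of `y` and `-x ^ 2` that of the
first coordinate. `O` is then free on `1, x` over series in `-x ^ 2`. -/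
theorem isAType_zero_of_maximalIdeal_eq (hO : IsAnalytic O) [IsNoetherianRing O] {x : O}
    (hx : x ∈ O⁰) (hm : maximalIdeal O = Ideal.span {x}) : IsAType O 0 := by
  have hxm : x ∈ maximalIdeal O := hm ▸ Ideal.mem_span_singleton_self x
  have hx2m : -x ^ 2 ∈ maximalIdeal O := neg_mem (Ideal.pow_mem_of_mem _ hxm 2 two_pos)
  have hx2 : -x ^ 2 ∈ O⁰ := by
    rw [neg_eq_neg_one_mul]
    exact mul_mem (isUnit_one.neg.mem_nonZeroDivisors) (pow_mem hx 2)
  have hpow : maximalIdeal O ^ 2 ≤ Ideal.span {-x ^ 2} := by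
    rw [hm, Ideal.span_singleton_pow, Ideal.span_singleton_neg]
  obtain ⟨φ, hφ, hfin⟩ := hO.exists_finite_algHom hx2m hpow
  let := φ.toRingHom.toAlgebra
  have : IsScalarTower ℂ (ConvergentSeries 1) O :=
    IsScalarTower.of_algebraMap_eq fun c => (φ.commutes c).symm
  have : Module.Finite (ConvergentSeries 1) O := hfin
  have hφ' : algebraMap (ConvergentSeries 1) O (coord 0) = -x ^ 2 := hφ
  have hgen : ∀ a, ∃ p q : ConvergentSeries 1, a = algebraMap (ConvergentSeries 1) O p +
      algebraMap (ConvergentSeries 1) O q * x := by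
    refine exists_eq_add_mul_of_sub_mem fun a => ?_
    obtain ⟨c, hc⟩ := hO.exists_sub_mem a
    rw [hm, Ideal.mem_span_singleton'] at hc
    obtain ⟨b, hb⟩ := hc
    obtain ⟨d, hd⟩ := hO.exists_sub_mem b
    rw [hm, Ideal.mem_span_singleton'] at hd
    obtain ⟨e, he⟩ := hd
    refine ⟨c, d, ?_⟩
    rw [hφ', Ideal.mem_span_singleton']
    exact ⟨-e, by linear_combination hb + x * he⟩
  -- A series in `-x ^ 2` lying in the maximal ideal is a multiple of `x ^ 2`; equality with `x`
  -- would make `x` a unit.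
  have hrange : x ∉ (algebraMap (ConvergentSeries 1) O).range := by
    rintro ⟨d, hd⟩
    have h0 : evalZero d = 0 := (hO.map_mem_maximalIdeal_iff (φ := φ)).1 (by
      change algebraMap (ConvergentSeries 1) O d ∈ _
      rwa [hd])
    rw [← mem_maximalIdeal_iff, span_coord_eq_maximalIdeal, Ideal.mem_span_singleton'] at h0
    obtain ⟨b, rfl⟩ := h0
    rw [map_mul, hφ'] at hd
    have h1 : x * (1 + x * algebraMap (ConvergentSeries 1) O b) = 0 := by
      linear_combination -hd
    have h2 := (mem_nonZeroDivisors_iff.1 hx).1 _ h1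
    exact hxm (IsUnit.of_mul_eq_one (-algebraMap (ConvergentSeries 1) O b) (by
      linear_combination -h2))
  obtain ⟨π, hπ, -⟩ := hO.exists_algHom ![-x ^ 2, x] (by
    intro i
    fin_cases i
    · exact hx2m
    · exact hxm)
  have h0 : π (coord 0) = -x ^ 2 := hπ 0
  have h1 : π (coord 1) = x := hπ 1
  refine isAType_of_surjective (isATypePresentation_of_eq hO (h0.trans hφ'.symm) ?_ ?_ ?_)
  · rw [h0, h1]
    ring
  · rwa [h1]
  · rw [h1]
    exact fun p q => eq_zero_of_add_mul_eq_zero (hφ' ▸ hx2) (hφ' ▸ hx2m) hrange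

theorem exists_isAType_of_finrank_le_two (hO : IsAnalytic O) [IsReduced O]
    [Algebra (ConvergentSeries 1) O] [IsScalarTower ℂ (ConvergentSeries 1) O]
    [Module.Finite (ConvergentSeries 1) O]
    (hx : algebraMap (ConvergentSeries 1) O (coord 0) ∈ O⁰)
    (hxm : algebraMap (ConvergentSeries 1) O (coord 0) ∈ maximalIdeal O)
    (he : Module.finrank ℂ (O ⧸ Ideal.span {algebraMap (ConvergentSeries 1) O (coord 0)}) ≤ 2) :
    ∃ n, IsAType O n := by
  have : IsNoetherianRing O := IsNoetherianRing.of_finite (ConvergentSeries 1) O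
  have hfin : Module.Finite ℂ (O ⧸ Ideal.span {algebraMap (ConvergentSeries 1) O (coord 0)}) :=
    finite_quotient_of_coord_pow_mem (k := 1) (by
      rw [pow_one]; exact Ideal.mem_span_singleton_self _)
  have h1 : (1 : O) ∉ Ideal.span {algebraMap (ConvergentSeries 1) O (coord 0)} := fun h =>
    (Ideal.ne_top_iff_one (maximalIdeal O)).1 Ideal.IsPrime.ne_top'
      ((Ideal.span_singleton_le_iff_mem _).2 hxm h)
  obtain ⟨w, hw⟩ := exists_forall_sub_mem h1 he
  replace hw := exists_eq_add_mul_of_sub_mem hw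
  by_cases hr : w ∈ (algebraMap (ConvergentSeries 1) O).range
  -- Here `O` is the image of `ℂ{t}`, so `𝔪 = (x)` and the germ is smooth.
  · refine ⟨0, isAType_zero_of_maximalIdeal_eq hO hx (le_antisymm (fun a ha => ?_)
      ((Ideal.span_singleton_le_iff_mem _).2 hxm))⟩
    obtain ⟨r, rfl⟩ := hr
    obtain ⟨p, q, rfl⟩ := hw a
    rw [← map_mul, ← map_add] at ha ⊢
    have h2 : p + q * r ∈ maximalIdeal (ConvergentSeries 1) := fun hu => ha (hu.map _)
    rw [span_coord_eq_maximalIdeal, Ideal.mem_span_singleton] at h2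
    exact Ideal.mem_span_singleton.2 (map_dvd _ h2)
  · obtain ⟨n, y, hy, hgen, hyr⟩ := exists_sq_eq_neg_pow hr hw
    have hym : y ∈ maximalIdeal O := by
      refine Ideal.IsPrime.mem_of_pow_mem inferInstance 2 ?_
      rw [hy]
      exact neg_mem (Ideal.pow_mem_of_mem _ hxm _ n.succ_pos)
    obtain ⟨π, hπ, -⟩ := hO.exists_algHom ![algebraMap (ConvergentSeries 1) O (coord 0), y] (by
      intro i
      fin_cases i
      · exact hxm
      · exact hym)
    have h2 : π (coord 0) = _ := hπ 0
    have h3 : π (coord 1) = y := hπ 1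
    refine ⟨n, isAType_of_surjective (isATypePresentation_of_eq hO h2 ?_ ?_ ?_)⟩
    · rw [h3, hy, h2]
      rfl
    · rwa [h3]
    · rw [h3]
      exact fun p q => eq_zero_of_add_mul_eq_zero hx hxm hyr

end NormalForm

end

end CurveGerm

theorem mainTheorem7 {O : Type*} [CommRing O] [IsLocalRing O] [Algebra ℂ O]
    (hO : CurveGerm.IsReducedCurveGerm O) :
    List.TFAE [
      ∃ e : ℕ, e ≤ 2 ∧ CurveGerm.HasMultiplicity O e,
      IsLeast (Set.range (CurveGerm.weight O)) 0,
      ∃ n : ℕ, CurveGerm.BirationallyDominates O (CurveGerm.AType n),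
      ∃ n : ℕ, CurveGerm.IsAType O n] := by
  open CurveGerm in
  have hred := hO.reduced
  have hA := hO.isAnalytic
  obtain ⟨x, hx⟩ := hO.exists_isGoodParameter
  obtain ⟨K, hK⟩ := hx.exists_pow_le
  obtain ⟨φ, rfl, hfin⟩ := hA.exists_finite_algHom hx.mem hK
  let := φ.toRingHom.toAlgebra
  have : IsScalarTower ℂ (ConvergentSeries 1) O :=
    IsScalarTower.of_algebraMap_eq fun c => (φ.commutes c).symm
  have : Module.Finite (ConvergentSeries 1) O := hfin
  change IsGoodParameter O (algebraMap (ConvergentSeries 1) O (coord 0)) at hx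
  -- Both sides say that the colength of the good parameter is at most `2`.
  tfae_have 1 ↔ 2 := by
    rw [hx.isLeast_weight_iff hA]
    constructor
    · rintro ⟨e, he, h⟩
      rwa [hx.hasMultiplicity.unique h]
    · exact fun h => ⟨_, h, hx.hasMultiplicity⟩
  tfae_have 2 → 4 := fun h =>
    exists_isAType_of_finrank_le_two hA hx.mem_nonZeroDivisors hx.mem
      ((hx.isLeast_weight_iff hA).1 h)
  tfae_have 4 → 3 := fun ⟨n, h⟩ => ⟨n, .of_isAType h⟩
  tfae_have 3 → 2 := by
    rintro ⟨n, h⟩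
    -- The coordinate of the dominated germ need not be a good parameter of `O`, but its colength
    -- bounds the minimal one.
    obtain ⟨y, hym, hy, hy2⟩ := h.exists_finrank_le (isATypePresentation_mkₐ n)
    exact (hx.isLeast_weight_iff hA).2 ((hx.finrank_quotient_le hy hym).trans hy2)
  tfae_finish
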